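/- \textbf{The envelope game $G$.} Player 1 secretly puts a bit $x\in\{0,1\}$ in an envelope; player 2, without seeing $x$, chooses a bit $y$; then player 1 either opens or destroys the envelope. Player 1 gets $1$ if she opens the envelope and $x\neq y$, and $-1$ otherwise; player 2 gets the opposite. The only non-singleton information set is that of player 2. \textbf{Commitment scheme.} A secure commitment scheme with perfect binding consists of a probabilistic polynomial-time algorithm $C=(C_1,C_2)$ and a deterministic polynomial-time algorithm $R$ with values in $\{0,1,f\}$ such that, for all $k\ge 1$, bits $b$ and random strings $r$: $C_1(1^k,b,r)$ is a $k$-bit string and $C_2(1^k,b,r)$ is a $(k-1)$-bit string; $R(C_1(1^k,b,r),C_2(1^k,b,r))=b$; $R(C_1(1^k,b,r),s)=f$ for all $s\ne C_2(1^k,b,r)$; and the ensembles $\{C_1(1^k,0)\}_k$, $\{C_1(1^k,1)\}_k$ are computationally indistinguishable (hiding). Here machines are uniform Turing machines. \textbf{The sequence $\mathcal G=(G_1,G_2,\dots)$.} In $G_n$ player 1 sends a commitment string $c=C_1(1^n,b,r)$ (for some $b,r$); player 2, seeing $c$, chooses a bit $y$; player 1 then sends a string $s$ of length at most $n$. Player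 1 gets $1$ if $R(c,s)\in\{0,1\}$ and $R(c,s)\ne y$, and $-1$ otherwise; player 2 gets the opposite. $G_n$ has perfect information. \textbf{Strategies.} A strategy of a player in $G$ is a mixed strategy, that is, a probability distribution on deterministic strategies; call it \emph{efficient} if its probabilities can be computed up to a negligible error (in $n$) by a deterministic polynomial-time machine with input $1^n$. A (polynomial-time) strategy $M$ of player $i$ in $\mathcal G$ is a probabilistic polynomial-time machine that on input $1^n$, an information set of player $i$ in $G_n$ and a random tape (drawn once and kept for the whole play) outputs an available action. $\rho_{\vec\sigma}$ denotes the distribution on terminal histories of $G$ induced by $\vec\sigma$; given maps $f_n$ from the histories of $G_n$ to those of $G$, $\phi^{n}_{\vec M}$ denotes the image under $f_n$ of the distribution on terminal histories of $G_n$ induced by $\vec M$. $LA(h)$ is the last action of $h$. \textbf{Statement.} For every secure commitment scheme with perfect binding, $\mathcal G$ represents $G$. That is, $\mathcal G$ is a computable uniform sequence of games: actions in $G_n$ have length polynomial in $n$; a probabilistic polynomial-time algorithm determines from $1^n$ and a history $h\in\bigcup_m H_m$ of a game of the sequence whether $h$ is a history of $G_n$; the player to move and the utilities are computable from the history in polynomial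 time. Moreover: \begin{itemize} \item[UG1.] $G$ and all $G_n$ have the same players. \item[UG2.] For each $n\ge1$ there is a surjection $f_n$ from the histories of $G_n$ onto those of $G$ such that (a) $|f_n(h)|=|h|$; (b) $h$ is terminal iff $f_n(h)$ is, and otherwise the same player moves at both; (c) if $h'$ is a prefix of $h$, then $f_n(h')$ is a prefix of $f_n(h)$; (d) if $h,h'$ are in the same information set of $G_n$, then $f_n(h),f_n(h')$ are in the same information set of $G$; (e) if $h,h'$ are in the same information set of $G_n$ and $a$ is available there, then $LA(f_n(h\|a))=LA(f_n(h'\|a))$. \item[UG3.] For every terminal history $h$ of $G_n$, every player has the same utility in $h$ and in $f_n(h)$. \item[UG4.] There is a map $\mathcal F$ from efficient strategies of each player in $G$ to polynomial-time strategies of that player in $\mathcal G$ such that (a) for every profile $\vec\sigma$ of efficient strategies there is a negligible $\epsilon$ with $\sum_{h}|\phi^{n}_{\mathcal F(\vec\sigma)}(h)-\rho_{\vec\sigma}(h)|\le\epsilon(n)$ for all $n$, where $h$ ranges over the terminal histories of $G$; (b) for every efficient strategy $\sigma$ of player $i$ there is a polynomial-time machine $M^\sigma$ which, for every $n$ and every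 history $h$ of $G_n$ at which $i$ moves and random tape $r$ such that the moves of $i$ in $h$ are those of $\mathcal F(\sigma)$ with tape $r$, outputs, given $1^n$, the information set of $h$ and $r$, the action $LA(f_n(h\|a))$, where $a$ is the action that $\mathcal F(\sigma)$ plays there with tape $r$; (c) for every profile $\vec\sigma$ of efficient strategies, every player $i$ and every polynomial-time strategy $M_i'$ of $i$ in $\mathcal G$ there are mixed strategies $\sigma_1',\sigma_2',\dots$ of $i$ in $G$ such that $\{\phi^{n}_{(M_i',\mathcal F(\vec\sigma_{-i}))}\}_n$ and $\{\rho_{(\sigma'_n,\vec\sigma_{-i})}\}_n$ are computationally indistinguishable. \end{itemize} Furthermore, if a probabilistic polynomial-time algorithm (with success probability at least $2/3$) determines from $1^n$ and an arbitrary string $c$ whether $c$ is a commitment string $C_1(1^n,b,r)$, then one also determines, from $1^n$ and an arbitrary finite sequence $h$ of strings, whether $h$ is a history of $G_n$. -/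

import Mathlib

open MeasureTheory

noncomputable section

namespace CompGame

/-! ### Strings, polynomial time, probabilistic polynomial time -/

/-- Bit strings. -/
abbrev Str := List Bool

/-- Tuples of bit strings. A history is the tuple of the actions played so far. -/
abbrev Hist := List Str

/-- An infinite random tape. -/
abbrev Tape := ℕ → Bool

/-- The unary string `1^n`. -/
def unary (n : ℕ) : Str := List.replicate n true

/-- A tuple of bit strings as a word over `{0, 1, #}`: every component is followed by `#`. -/
def encTuple (x : List Str) : List (Option Bool) :=
  x.flatMap fun w => w.map some ++ [none]

/-- `g` is computed by a deterministic Turing machine in polynomial time. -/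
def IsPolyTime (g : List Str → Str) : Prop :=
  Nonempty (Turing.TM2ComputableInPolyTime encTuple (id : Str → List Bool) g)

/-- The first `m` bits of a tape. -/
def tapePrefix (r : Tape) (m : ℕ) : Str := List.ofFn fun j : Fin m => r j

/-- `A x r`, the output of `A` on input `x` with random tape `r`, is computed by a probabilistic
polynomial-time machine: the machine is deterministic in the input and in the random bits, and
uses only polynomially many of these. -/
def IsPPT (A : List Str → Tape → Str) : Prop :=
  ∃ (q : Polynomial ℕ) (g : List Str → Str), IsPolyTime g ∧
    ∀ x r, A x r = g (tapePrefix r (q.eval (encTuple x).length) :: x)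

/-- The uniform distribution on random tapes (independent fair coin tosses). -/
def coin : Measure Tape :=
  Measure.infinitePi fun _ : ℕ => (PMF.uniformOfFintype Bool).toMeasure

/-- Negligible functions. -/
def Negligible (ε : ℕ → ℝ) : Prop :=
  (∀ k, 0 ≤ ε k) ∧ ∀ c : ℕ, ∀ᶠ k : ℕ in Filter.atTop, ε k < 1 / (k : ℝ) ^ c

/-- The probability that `D(1^n, X) = 1`, where `X` is a tuple of strings drawn from the finitely
supported distribution with weights `X x` and `D` uses its own independent random tape. -/
def acceptProb (D : List Str → Tape → Str) (n : ℕ) (X : List Str → ℝ) : ℝ :=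
  ∑' x, X x * coin.real {r | D (unary n :: x) r = [true]}

/-- Computational indistinguishability of two ensembles of finitely supported distributions. -/
def CompIndist (X Y : ℕ+ → List Str → ℝ) : Prop :=
  ∀ D, IsPPT D → ∃ ε, Negligible ε ∧
    ∀ n : ℕ+, |acceptProb D n (X n) - acceptProb D n (Y n)| ≤ ε n

/-- A probabilistic polynomial-time machine that, given `1^n` and `h ∈ dom`, determines whether
`h ∈ S n` (with the usual success probability `2/3`). -/
def PPTDecides (dom : Set Hist) (S : ℕ+ → Set Hist) : Prop :=
  ∃ D, IsPPT D ∧ ∀ (n : ℕ+), ∀ h ∈ dom,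
    2 / 3 ≤ coin.real {r | D (unary n :: h) r = [true] ↔ h ∈ S n}

/-- The number `0.w` in binary. -/
def binFrac : Str → ℝ
  | [] => 0
  | b :: w => ((if b then 1 else 0) + binFrac w) / 2

/-- The real `p` can be approximated up to negligible precision in polynomial time. -/
def EffReal (p : ℝ) : Prop :=
  ∃ g, IsPolyTime g ∧ ∃ ε, Negligible ε ∧ ∀ n : ℕ+, |p - binFrac (g [unary n])| ≤ ε n

/-- The dyadic rational `± m / 2^k` coded by a sign bit (`true` is minus) followed by the binary
digits of `m`, the least significant digit first. -/
def dyadic (k : ℕ) : Str → ℝ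
  | [] => 0
  | s :: m => (if s then -1 else 1) * (Nat.ofDigits 2 (m.map Bool.toNat) : ℕ) / 2 ^ k

/-- The real-valued function `v` on `dom` is computable in polynomial time: on input `(1^k, h)`
a polynomial-time machine outputs a dyadic rational within `2^{-k}` of `v h`. -/
def PolyTimeRealOn (dom : Set Hist) (v : Hist → ℝ) : Prop :=
  ∃ g, IsPolyTime g ∧ ∀ h ∈ dom, ∀ k : ℕ, |v h - dyadic k (g (unary k :: h))| ≤ 1 / 2 ^ k

/-! ### Extensive-form games -/

/-- A finite extensive-form game with `c` players whose actions are bit strings. The information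
partition is given by labels: two nonterminal histories are in the same information set if and
only if they have the same label `obs`; the label is the representation of the information set. -/
structure Game (c : ℕ) where
  H : Set Hist
  finite : H.Finite
  nil_mem : [] ∈ H
  mem_of_append : ∀ h a, h ++ [a] ∈ H → h ∈ H
  P : Hist → Fin c
  u : Fin c → Hist → ℝ
  obs : Hist → List Str
  two_actions : ∀ h ∈ H, (∃ a, h ++ [a] ∈ H) → ∃ a b, a ≠ b ∧ h ++ [a] ∈ H ∧ h ++ [b] ∈ H
  obs_player : ∀ h h', (∃ a, h ++ [a] ∈ H) → (∃ a, h' ++ [a] ∈ H) → obs h = obs h' → P h = P h'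
  obs_actions : ∀ h h', (∃ a, h ++ [a] ∈ H) → (∃ a, h' ++ [a] ∈ H) → obs h = obs h' →
    ∀ a, h ++ [a] ∈ H ↔ h' ++ [a] ∈ H

namespace Game

variable {c : ℕ}

/-- Nonterminal histories. -/
def nonterminal (G : Game c) : Set Hist := {h | ∃ a, h ++ [a] ∈ G.H}

/-- Terminal histories. -/
def terminal (G : Game c) : Set Hist := {h | h ∈ G.H ∧ ∀ a, h ++ [a] ∉ G.H}

/-- The histories after which player `i` moves. -/
def turn (G : Game c) (i : Fin c) : Set Hist := {h | h ∈ G.nonterminal ∧ G.P h = i}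

/-- Two (nonterminal) histories are in the same information set. -/
def SameInfo (G : Game c) (h h' : Hist) : Prop :=
  h ∈ G.nonterminal ∧ h' ∈ G.nonterminal ∧ G.obs h = G.obs h'

/-- The information sets of player `i`, as labels. -/
def InfoSet (G : Game c) (i : Fin c) : Type := {I : List Str // ∃ h ∈ G.turn i, G.obs h = I}

/-- The actions available at an information set. -/
def actions (G : Game c) {i : Fin c} (I : G.InfoSet i) : Set Str :=
  {a | ∀ h ∈ G.turn i, G.obs h = I.1 → h ++ [a] ∈ G.H}

/-- Deterministic strategies of player `i`. -/
def PureStrategy (G : Game c) (i : Fin c) : Type := (I : G.InfoSet i) → G.actions I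

instance (G : Game c) (i : Fin c) : MeasurableSpace (G.PureStrategy i) := ⊤

/-- Mixed strategies of player `i`. -/
abbrev Mixed (G : Game c) (i : Fin c) : Type := PMF (G.PureStrategy i)

/-- The mixed strategies that a Turing machine can approximate: the probability of every set of
deterministic strategies can be approximated up to negligible precision in polynomial time. -/
def EffMixed (G : Game c) (i : Fin c) : Type :=
  {σ : G.Mixed i // ∀ S : Set (G.PureStrategy i), EffReal (σ.toMeasure.real S)}

/-- `ρ_σ`: the distribution on terminal histories when the players draw deterministic strategies
independently from `σ` and then follow them. A terminal history is the outcome if and only if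
every move in it is the one prescribed to the player who moves. -/
def outcomeDist (G : Game c) (σ : ∀ i, G.Mixed i) (h : Hist) : ℝ :=
  (Measure.pi fun i => (σ i).toMeasure).real
    {s | h ∈ G.terminal ∧ ∀ h' a, h' ++ [a] <+: h →
      ∀ (i : Fin c) (hi : h' ∈ G.turn i), (s i ⟨G.obs h', h', hi, rfl⟩ : Str) = a}

end Game

/-! ### Computational games -/

/-- Computable uniform sequences of games. -/
structure IsComputableUniform {c : ℕ} (𝒢 : ℕ+ → Game c) : Prop where
  /-- action sets consist of strings of polynomial length -/
  action_length : ∃ p : Polynomial ℕ, ∀ (n : ℕ+) h a, h ++ [a] ∈ (𝒢 n).H →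
    a.length ≤ p.eval (n : ℕ)
  /-- given `1^n` and a history (of some game of the sequence), one can determine in
  probabilistic polynomial time whether it is a history of the `n`th game -/
  histories : PPTDecides (⋃ n, (𝒢 n).H) fun n => (𝒢 n).H
  /-- the player who moves is a polynomial-time function of the history -/
  player : ∃ g, IsPolyTime g ∧ ∀ n, ∀ h ∈ (𝒢 n).nonterminal, g h = unary ((𝒢 n).P h)
  /-- the utilities are a polynomial-time function of the terminal history -/
  utility : ∀ i, ∃ v : Hist → ℝ, PolyTimeRealOn (⋃ n, (𝒢 n).terminal) v ∧
    ∀ n, ∀ h ∈ (𝒢 n).terminal, (𝒢 n).u i h = v h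

/-- A polynomial-time strategy for player `i` in a sequence of games: a probabilistic
polynomial-time machine that, given `1^n`, (the representation of) an information set and its
random tape, outputs an available action. The machine is stateful: the tape is drawn once, and
is the same in all rounds of a play. -/
structure Strategy {c : ℕ} (𝒢 : ℕ+ → Game c) (i : Fin c) where
  M : List Str → Tape → Str
  ppt : IsPPT M
  legal : ∀ (n : ℕ+), ∀ h ∈ (𝒢 n).turn i, ∀ r,
    h ++ [M (unary n :: (𝒢 n).obs h) r] ∈ (𝒢 n).H

/-- The moves of player `i` in `h` are those of the strategy `M` with random tape `r`, that is,
`h` and `r` make up a view that is reachable when player `i` plays `M`. -/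
def Strategy.Follows {c : ℕ} {𝒢 : ℕ+ → Game c} {i : Fin c} (M : Strategy 𝒢 i) (n : ℕ+)
    (r : Tape) (h : Hist) : Prop :=
  ∀ h' a, h' ++ [a] <+: h → h' ∈ (𝒢 n).turn i → M.M (unary n :: (𝒢 n).obs h') r = a

/-- `φ_M`: the image under `f` of the distribution on terminal histories of the `n`th game when
the players play `M` with independent random tapes. -/
def imageDist {c : ℕ} (𝒢 : ℕ+ → Game c) (f : Hist → Hist) (M : ∀ i, Strategy 𝒢 i) (n : ℕ+)
    (h : Hist) : ℝ :=
  (Measure.pi fun _ : Fin c => coin).real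
    {r | ∃ h' ∈ (𝒢 n).terminal, f h' = h ∧ ∀ i, (M i).Follows n (r i) h'}

/-- The ensembles `X` and `Y` of distributions on the terminal histories of `G` are
statistically close. -/
def StatClose {c : ℕ} (G : Game c) (X Y : ℕ+ → Hist → ℝ) : Prop :=
  ∃ ε, Negligible ε ∧ ∀ n : ℕ+, ∑ᶠ h ∈ G.terminal, |X n h - Y n h| ≤ ε n

/-- The structural conditions on the map `f` from the histories of `K` to those of `G`. -/
structure HistoryMap {c : ℕ} (K G : Game c) (f : Hist → Hist) : Prop where
  mapsTo : Set.MapsTo f K.H G.H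
  surjOn : Set.SurjOn f K.H G.H
  length_eq : ∀ h ∈ K.H, (f h).length = h.length
  terminal_iff : ∀ h ∈ K.H, f h ∈ G.terminal ↔ h ∈ K.terminal
  player_eq : ∀ h ∈ K.nonterminal, G.P (f h) = K.P h
  prefix_of : ∀ h ∈ K.H, ∀ h', h' <+: h → f h' <+: f h
  sameInfo : ∀ h h', K.SameInfo h h' → G.SameInfo (f h) (f h')
  lastAction : ∀ h h', K.SameInfo h h' → ∀ a, h ++ [a] ∈ K.H →
    (f (h ++ [a])).getLast? = (f (h' ++ [a])).getLast?

/-- The conditions on the map `F` from strategies of `G` to strategies of `𝒢`. -/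
structure StrategyMap {c : ℕ} (𝒢 : ℕ+ → Game c) (G : Game c) (f : ℕ+ → Hist → Hist)
    (F : ∀ i, G.EffMixed i → Strategy 𝒢 i) : Prop where
  /-- every strategy profile corresponds to its image -/
  corresponds : ∀ σ : ∀ i, G.EffMixed i,
    StatClose G (fun n => imageDist 𝒢 (f n) (fun i => F i (σ i)) n)
      (fun _ => G.outcomeDist fun i => (σ i).1)
  /-- the machine `F i σ` knows which action of `G` it plays -/
  knows : ∀ (i : Fin c) (σ : G.EffMixed i), ∃ N, IsPPT N ∧
    ∀ (n : ℕ+), ∀ h ∈ (𝒢 n).turn i, ∀ r, (F i σ).Follows n r h →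
      (f n (h ++ [(F i σ).M (unary n :: (𝒢 n).obs h) r])).getLast?
        = some (N (unary n :: (𝒢 n).obs h) r)
  /-- every polynomial-time deviation of one player is indistinguishable from a sequence of
  strategies of that player in `G` -/
  deviation : ∀ (σ : ∀ i, G.EffMixed i) (i : Fin c) (M' : Strategy 𝒢 i),
    ∃ σ' : ℕ+ → G.Mixed i,
      CompIndist
        (fun n => imageDist 𝒢 (f n) (Function.update (fun j => F j (σ j)) i M') n)
        (fun n => G.outcomeDist (Function.update (fun j => (σ j).1) i (σ' n)))

/-- The sequence `𝒢` is a computable uniform sequence that represents `G`. (That all games have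
the same players is part of the types.) -/
def Represents {c : ℕ} (𝒢 : ℕ+ → Game c) (G : Game c) : Prop :=
  IsComputableUniform 𝒢 ∧
    ∃ f : ℕ+ → Hist → Hist,
      (∀ n, HistoryMap (𝒢 n) G (f n)) ∧
      (∀ n, ∀ h ∈ (𝒢 n).terminal, ∀ i, (𝒢 n).u i h = G.u i (f n h)) ∧
      ∃ F : ∀ i, G.EffMixed i → Strategy 𝒢 i, StrategyMap 𝒢 G f F

/-! ### Commitment schemes -/

/-- The distribution of the one-component tuple `(A r)` for a uniformly random tape `r`. -/
def outputDist (A : Tape → Str) (x : List Str) : ℝ := coin.real {r | [A r] = x}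

/-- A secure commitment scheme with perfect binding: `C₁` gives the commitment string, `C₂` the
commitment key, and `R` opens a commitment (`none` is the failure symbol). -/
structure CommitmentScheme where
  C₁ : ℕ+ → Bool → Tape → Str
  C₂ : ℕ+ → Bool → Tape → Str
  R : Str → Str → Option Bool
  ppt_C₁ : ∃ A, IsPPT A ∧ ∀ (k : ℕ+) b r, A [unary k, [b]] r = C₁ k b r
  ppt_C₂ : ∃ A, IsPPT A ∧ ∀ (k : ℕ+) b r, A [unary k, [b]] r = C₂ k b r
  polyTime_R : ∃ g, IsPolyTime g ∧ ∀ c s, g [c, s] = (R c s).toList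
  length_C₁ : ∀ k b r, (C₁ k b r).length = k
  length_C₂ : ∀ k b r, (C₂ k b r).length = (k : ℕ) - 1
  is_hiding : CompIndist (fun k => outputDist (C₁ k false)) (fun k => outputDist (C₁ k true))
  opens : ∀ k b r, R (C₁ k b r) (C₂ k b r) = some b
  binding : ∀ k b r s, s ≠ C₂ k b r → R (C₁ k b r) s = none

/-- The commitment strings with security parameter `n`. -/
def CommitmentScheme.commitments (S : CommitmentScheme) (n : ℕ+) : Set Str :=
  {c | ∃ b r, c = S.C₁ n b r}

theorem CommitmentScheme.commitments_nontrivial (S : CommitmentScheme) (n : ℕ+) :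
    (S.commitments n).Nontrivial := by
  refine ⟨S.C₁ n false fun _ => false, ⟨_, _, rfl⟩, S.C₁ n true fun _ => false, ⟨_, _, rfl⟩, ?_⟩
  intro h
  have h0 := S.opens n false fun _ => false
  have h1 := S.opens n true fun _ => false
  rw [h] at h0
  by_cases hs : S.C₂ n false (fun _ => false) = S.C₂ n true (fun _ => false)
  · rw [hs, h1] at h0
    simp at h0
  · rw [S.binding n true _ _ hs] at h0
    simp at h0

theorem finite_length_le (m : ℕ) : {s : Str | s.length ≤ m}.Finite := List.finite_length_le Bool m

theorem CommitmentScheme.commitments_finite (S : CommitmentScheme) (n : ℕ+) :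
    (S.commitments n).Finite := by
  refine (finite_length_le n).subset ?_
  rintro _ ⟨b, r, rfl⟩
  exact (S.length_C₁ n b r).le

/-! ### The two games -/

/-- The strings `0` and `1`. -/
def bitStrings : Set Str := {[false], [true]}

/-- `h` has length at most three and its actions are in `A`, `B`, `D`, in this order. -/
def IsStageHist (A B D : Set Str) : Hist → Prop
  | [] => True
  | [a] => a ∈ A
  | [a, b] => a ∈ A ∧ b ∈ B
  | [a, b, d] => a ∈ A ∧ b ∈ B ∧ d ∈ D
  | _ => False

/-- The histories of length at most three with actions in `A`, `B`, `D`, in this order. -/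
def stageHist (A B D : Set Str) : Set Hist := {h | IsStageHist A B D h}

/-- The actions available after `k` moves. -/
def stageSet (A B D : Set Str) : ℕ → Set Str
  | 0 => A
  | 1 => B
  | 2 => D
  | _ => ∅

theorem append_mem_stageHist (A B D : Set Str) (h : Hist) (a : Str) :
    h ++ [a] ∈ stageHist A B D ↔ h ∈ stageHist A B D ∧ a ∈ stageSet A B D h.length := by
  rcases h with _ | ⟨x, _ | ⟨y, _ | ⟨z, _ | ⟨w, l⟩⟩⟩⟩ <;>
    simp [stageHist, IsStageHist, stageSet, and_assoc]

theorem stageHist_finite {A B D : Set Str} (hA : A.Finite) (hB : B.Finite) (hD : D.Finite) :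
    (stageHist A B D).Finite := by
  have h1 := hA.image fun a => ([a] : Hist)
  have h2 := (hA.prod hB).image fun p => ([p.1, p.2] : Hist)
  have h3 := (hA.prod (hB.prod hD)).image fun p => ([p.1, p.2.1, p.2.2] : Hist)
  refine ((((Set.finite_singleton ([] : Hist)).union h1).union h2).union h3).subset ?_
  rintro (_ | ⟨x, _ | ⟨y, _ | ⟨z, _ | ⟨w, l⟩⟩⟩⟩) h <;>
    simp_all [stageHist, IsStageHist, Set.image]

/-- The two-player game in which player `0` chooses an action in `A`, then player `1` chooses an
action in `B`, then player `0` chooses an action in `D`. The utility of player `0` is `win` and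
the utility of player `1` is the opposite. -/
def stageGame (A B D : Set Str) (hA : A.Finite) (hB : B.Finite) (hD : D.Finite)
    (hA' : A.Nontrivial) (hB' : B.Nontrivial) (hD' : D.Nontrivial)
    (win : Hist → ℝ) (obs : Hist → List Str)
    (hobs : ∀ h h', obs h = obs h' → h.length = h'.length) : Game 2 where
  H := stageHist A B D
  finite := stageHist_finite hA hB hD
  nil_mem := trivial
  mem_of_append h a hh := ((append_mem_stageHist A B D h a).1 hh).1
  P h := if h.length = 1 then 1 else 0
  u i h := if i = 0 then win h else -win h
  obs := obs
  two_actions := by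
    rintro h - ⟨a, ha⟩
    obtain ⟨hh, ha⟩ := (append_mem_stageHist A B D h a).1 ha
    have key : (stageSet A B D h.length).Nontrivial := by
      revert ha
      rcases h.length with _ | _ | _ | k <;> simp [stageSet, hA', hB', hD']
    obtain ⟨x, hx, y, hy, hxy⟩ := key
    exact ⟨x, y, hxy, (append_mem_stageHist A B D h x).2 ⟨hh, hx⟩,
      (append_mem_stageHist A B D h y).2 ⟨hh, hy⟩⟩
  obs_player h h' _ _ e := by rw [hobs h h' e]
  obs_actions := by
    rintro h h' ⟨a, ha⟩ ⟨b, hb⟩ e x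
    rw [append_mem_stageHist] at ha hb
    rw [append_mem_stageHist, append_mem_stageHist, hobs h h' e]
    exact ⟨fun t => ⟨hb.1, t.2⟩, fun t => ⟨ha.1, t.2⟩⟩

theorem bitStrings_finite : bitStrings.Finite := by simp [bitStrings]

theorem bitStrings_nontrivial : bitStrings.Nontrivial :=
  ⟨[false], by simp [bitStrings], [true], by simp [bitStrings], by simp⟩

/-- In the third move, `[true]` stands for opening and `[false]` for destroying the envelope. -/
def envelopeWin : Hist → ℝ
  | [x, y, d] => if d = [true] ∧ x ≠ y then 1 else -1
  | _ => 0

/-- The envelope game: player `0` puts a bit in an envelope, player `1`, who does not see it,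
chooses a bit, and player `0` opens or destroys the envelope. Player `0` wins if the envelope is
opened and the bits differ. After the first move all histories have the same label. -/
def envelopeGame : Game 2 :=
  stageGame bitStrings bitStrings bitStrings bitStrings_finite bitStrings_finite bitStrings_finite
    bitStrings_nontrivial bitStrings_nontrivial bitStrings_nontrivial envelopeWin
    (fun h => if h.length = 1 then [[]] else h)
    (by
      intro h h' e
      have e' := congrArg List.length e
      by_cases h1 : h.length = 1 <;> by_cases h2 : h'.length = 1 <;>
        simp only [h1, h2, if_true, if_false, List.length_singleton] at e' ⊢ <;> omega)

/-- Player `0` wins if the key `s` opens the commitment `x` to a bit different from `y`. -/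
def commitmentWin (S : CommitmentScheme) : Hist → ℝ
  | [x, y, s] => if ∃ b, S.R x s = some b ∧ y ≠ [b] then 1 else -1
  | _ => 0

theorem keys_nontrivial (n : ℕ+) : {s : Str | s.length ≤ n}.Nontrivial :=
  ⟨[], by simp, [true], (n.pos : 0 < (n : ℕ)), by simp⟩

/-- The sequence of commitment games: in the `n`th game player `0` sends a commitment string with
security parameter `n`, player `1` chooses a bit, and player `0` sends a string of length at most
`n` (the commitment key, which opens the commitment, or any other string, which destroys it).
This is a game of perfect information: every history is its own label. -/
def commitmentGame (S : CommitmentScheme) (n : ℕ+) : Game 2 :=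
  stageGame (S.commitments n) bitStrings {s | s.length ≤ n}
    (S.commitments_finite n) bitStrings_finite (finite_length_le n)
    (S.commitments_nontrivial n) bitStrings_nontrivial (keys_nontrivial n)
    (commitmentWin S) (fun h => h) (fun _ _ e => congrArg List.length e)

end CompGame

end

open MeasureTheory

noncomputable section

namespace CompGame

open Turing

/-! Perfect binding gives every commitment string `c` a well-defined bit, so a history `[c, y, s]`
of a commitment game can be sent to `[bit c, y, o]`, where `o` tells whether `R c s` is a bit at
all. The conditions on histories and utilities are then direct checks. The map need not be
efficiently computable.

A deterministic strategy of player `0` in the envelope game matters only through three bits: the bit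
in the envelope and the decision after either answer. `exists_sampler` draws the code of such a
triple by comparing a random tape with polynomial-time approximations of a distribution function.
One half of the tape serves for this draw, the other for the commitment. As the tape is kept during
the play, the machine can recompute both at its last move, and sends the key or `1^n`, which is too
long to be a key. Player `1` draws a bit and ignores the commitment. Outcome probabilities are
products or sums of products (`outcomeDist_envHist`, `imageDist_envHist`), so the distributions
agree up to the sampling errors.

Suppose player `0` deviates. Once the tape is fixed, binding determines the committed bit and, for
each answer, whether it gets opened: this is a deterministic strategy of the envelope game, and its
law is the required mixed strategy. No hardness is used. Suppose player `1` deviates. The deviating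
machine is itself a distinguisher for the commitments, so by hiding its answers to commitments to
`0` and to `1` have nearly the same law (`exists_replyProb_close`); the required mixed strategy
plays the answer to a fresh commitment to `0`. Both arguments give statistical closeness on the
eight terminal histories, which implies indistinguishability.

The longest part shows that these strategies really run on polynomial-time machines. `PT u v` says
that a stack machine turns the word `u x` into the word `v x` in polynomial time. It is closed under
composition and concatenation (`PT.comp_append`) and contains finite-state transducers, parallel
reading of two words and unary multiplication; the rest is built from these. `RandPoly` adds random
bits, with a bound on their number that may always be enlarged, so that randomized computations can
be combined. -/

/-! ### Stack machines -/

/-- `b` is reached from `a` in exactly `n` steps. -/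
def Steps {C : Type*} (f : C → Option C) : ℕ → C → C → Prop
  | 0, a, b => a = b
  | n + 1, a, b => ∃ c, f a = some c ∧ Steps f n c b

theorem Steps.trans {C : Type*} {f : C → Option C} {m n : ℕ} {a b c : C}
    (h : Steps f m a b) (h' : Steps f n b c) : Steps f (m + n) a c := by
  induction m generalizing a with
  | zero => cases h; simpa using h'
  | succ m ih =>
    obtain ⟨d, hd, h⟩ := h
    rw [Nat.add_right_comm]
    exact ⟨d, hd, ih h⟩

/-- The right-hand side is the form in which the computations inside `TM2ComputableInPolyTime` are
recorded. -/
theorem steps_iff_iterate {C : Type*} (f : C → Option C) (n : ℕ) (a b : C) :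
    Steps f n a b ↔ (flip bind f)^[n] (some a) = some b := by
  have hn : ∀ n, (flip bind f)^[n] none = none := fun n => Function.iterate_fixed rfl n
  induction n generalizing a with
  | zero => simp [Steps]
  | succ n ih =>
    rw [Function.iterate_succ_apply]
    change (∃ c, f a = some c ∧ Steps f n c b) ↔ (flip bind f)^[n] (f a) = some b
    cases h : f a with
    | none => rw [hn]; simp
    | some c => simp [ih]

/-- A program for a machine with stacks `K`. -/
structure Comp (K : Type) (Γ : K → Type) where
  Λ : Type
  σ : Type
  [finΛ : Fintype Λ]
  [finσ : Fintype σ]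
  main : Λ
  init : σ
  m : Λ → TM2.Stmt Γ Λ σ

attribute [instance] Comp.finΛ Comp.finσ

/-! ### Programs running on part of the stacks and of the variables of a larger machine. -/

section Embedding

variable {K K' : Type} [DecidableEq K] [DecidableEq K'] {Γ : K' → Type} {Λ Λ' σ σ' : Type}

/-- A statement on the stacks `K`, seen as a statement on the stacks `K'` with more variables;
halting is replaced by the statement `ex`. -/
def liftStmt (j : K → K') (get : σ' → σ) (set : σ → σ' → σ') (lab : Λ → Λ')
    (ex : TM2.Stmt Γ Λ' σ') : TM2.Stmt (fun k => Γ (j k)) Λ σ → TM2.Stmt Γ Λ' σ'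
  | .push k f q => .push (j k) (fun s => f (get s)) (liftStmt j get set lab ex q)
  | .peek k f q => .peek (j k) (fun s o => set (f (get s) o) s) (liftStmt j get set lab ex q)
  | .pop k f q => .pop (j k) (fun s o => set (f (get s) o) s) (liftStmt j get set lab ex q)
  | .load f q => .load (fun s => set (f (get s)) s) (liftStmt j get set lab ex q)
  | .branch f q q' => .branch (fun s => f (get s)) (liftStmt j get set lab ex q)
      (liftStmt j get set lab ex q')
  | .goto f => .goto fun s => lab (f (get s))
  | .halt => ex

variable {j : K → K'} {get : σ' → σ} {set : σ → σ' → σ'} {lab : Λ → Λ'}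
  {ex : TM2.Stmt Γ Λ' σ'}

/-- By the two laws for `get` and `set`, a lifted statement sees and changes only its own component
of the variables; by injectivity of `j`, it sees and changes only its own stacks. The two
computations therefore stay in parallel until a halt, where the lifted one goes on with `ex`. -/
theorem stepAux_liftStmt (hj : Function.Injective j) (hget : ∀ v b, get (set v b) = v)
    (hset : ∀ v w b, set v (set w b) = set v b) (q : TM2.Stmt (fun k => Γ (j k)) Λ σ)
    (v : σ) (b : σ') (S : ∀ k, List (Γ (j k))) (S' : ∀ k, List (Γ k)) (hS : ∀ k, S' (j k) = S k) :
    ∃ U : ∀ k, List (Γ k), (∀ k, U (j k) = (TM2.stepAux q v S).stk k) ∧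
      (∀ k ∉ Set.range j, U k = S' k) ∧
      TM2.stepAux (liftStmt j get set lab ex q) (set v b) S' =
        match (TM2.stepAux q v S).l with
        | some l => ⟨some (lab l), set (TM2.stepAux q v S).var b, U⟩
        | none => TM2.stepAux ex (set (TM2.stepAux q v S).var b) U := by
  have upd : ∀ (S : ∀ k, List (Γ (j k))) (S' : ∀ k, List (Γ k)) (_ : ∀ k, S' (j k) = S k) (k : K)
      (l : List (Γ (j k))), (∀ i, Function.update S' (j k) l (j i) = Function.update S k l i) ∧
      (∀ i ∉ Set.range j, Function.update S' (j k) l i = S' i) := by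
    intro S S' hS k l
    constructor
    · intro i
      rcases eq_or_ne i k with rfl | h
      · simp
      · rw [Function.update_of_ne h, Function.update_of_ne (hj.ne h), hS]
    · intro i hi
      exact Function.update_of_ne (fun h => hi ⟨k, h.symm⟩) _ _
  induction q generalizing v S S' with
  | push k f q ih =>
    obtain ⟨h1, h2⟩ := upd S S' hS k (f v :: S k)
    obtain ⟨U, hU, hU', e⟩ := ih v _ _ h1
    refine ⟨U, hU, fun i hi => (hU' i hi).trans (h2 i hi), ?_⟩
    simp only [liftStmt, TM2.stepAux, hget, hS]
    exact e
  | peek k f q ih =>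
    obtain ⟨U, hU, hU', e⟩ := ih (f v (S k).head?) _ _ hS
    refine ⟨U, hU, hU', ?_⟩
    simp only [liftStmt, TM2.stepAux, hget, hS, hset]
    exact e
  | pop k f q ih =>
    obtain ⟨h1, h2⟩ := upd S S' hS k (S k).tail
    obtain ⟨U, hU, hU', e⟩ := ih (f v (S k).head?) _ _ h1
    refine ⟨U, hU, fun i hi => (hU' i hi).trans (h2 i hi), ?_⟩
    simp only [liftStmt, TM2.stepAux, hget, hS, hset]
    exact e
  | load f q ih =>
    obtain ⟨U, hU, hU', e⟩ := ih (f v) _ _ hS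
    refine ⟨U, hU, hU', ?_⟩
    simp only [liftStmt, TM2.stepAux, hget, hset]
    exact e
  | branch f q q' ih ih' =>
    simp only [liftStmt, TM2.stepAux, hget]
    cases f v
    · exact ih' v _ _ hS
    · exact ih v _ _ hS
  | goto f => exact ⟨S', hS, fun _ _ => rfl, by simp [liftStmt, hget]⟩
  | halt => exact ⟨S', hS, fun _ _ => rfl, by simp [liftStmt]⟩

/-- By `hex` the exit statement is a mere jump or halt, executed in the same step as the halt that
it replaces, so the number of steps is unchanged. -/
theorem Steps.lift (hj : Function.Injective j) (hget : ∀ v b, get (set v b) = v)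
    (hset : ∀ v w b, set v (set w b) = set v b) {e : Option Λ'}
    (hex : ∀ v S, TM2.stepAux ex v S = ⟨e, v, S⟩)
    {M : Λ → TM2.Stmt (fun k => Γ (j k)) Λ σ} {M' : Λ' → TM2.Stmt Γ Λ' σ'}
    (hM : ∀ l, M' (lab l) = liftStmt j get set lab ex (M l)) {n : ℕ} {l : Λ} {v w : σ} (b : σ')
    {S T : ∀ k, List (Γ (j k))} {S' : ∀ k, List (Γ k)} (hS : ∀ k, S' (j k) = S k)
    (h : Steps (TM2.step M) n ⟨some l, v, S⟩ ⟨none, w, T⟩) :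
    ∃ U : ∀ k, List (Γ k), (∀ k, U (j k) = T k) ∧ (∀ k ∉ Set.range j, U k = S' k) ∧
      Steps (TM2.step M') n ⟨some (lab l), set v b, S'⟩ ⟨e, set w b, U⟩ := by
  induction n generalizing l v S S' with
  | zero => simp [Steps] at h
  | succ n ih =>
    obtain ⟨c, hc, h⟩ := h
    simp only [TM2.step, Option.some.injEq] at hc
    obtain ⟨U, hU, hU', eq⟩ := stepAux_liftStmt (set := set) (lab := lab) (ex := ex) hj hget hset
      (M l) v b S S' hS
    rw [hc] at eq hU
    obtain ⟨o, v', S₁⟩ := c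
    cases o with
    | some l' =>
      obtain ⟨V, hV, hV', st⟩ := ih hU h
      refine ⟨V, hV, fun k hk => (hV' k hk).trans (hU' k hk), _, ?_, st⟩
      simp only [TM2.step, hM, eq]
    | none =>
      cases n with
      | zero =>
        simp only [Steps, TM2.Cfg.mk.injEq, true_and] at h
        obtain ⟨rfl, rfl⟩ := h
        refine ⟨U, hU, hU', ⟨e, set v' b, U⟩, ?_, rfl⟩
        simp only [TM2.step, hM, eq, hex]
      -- A halted configuration has no successor, so no steps can remain.
      | succ n =>
        obtain ⟨d, hd, -⟩ := h
        simp [TM2.step] at hd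

end Embedding

namespace Comp

variable {K : Type} [DecidableEq K] {Γ : K → Type}

/-- Started with stacks `S`, the program halts in the initial state with stacks `T`. -/
def Runs (c : Comp K Γ) (S T : ∀ k, List (Γ k)) (t : ℕ) : Prop :=
  ∃ n ≤ t, Steps (TM2.step c.m) n ⟨some c.main, c.init, S⟩ ⟨none, c.init, T⟩

theorem Runs.mono {c : Comp K Γ} {S T : ∀ k, List (Γ k)} {t t' : ℕ} (h : c.Runs S T t)
    (ht : t ≤ t') : c.Runs S T t' := by
  obtain ⟨n, hn, h⟩ := h
  exact ⟨n, hn.trans ht, h⟩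

theorem Runs.congr {c : Comp K Γ} {S T S' T' : ∀ k, List (Γ k)} {t t' : ℕ} (h : c.Runs S T t)
    (ht : t ≤ t') (hS : S = S') (hT : T = T') : c.Runs S' T' t' :=
  hS ▸ hT ▸ h.mono ht

/-- Sequential composition. -/
def seq (c d : Comp K Γ) : Comp K Γ where
  Λ := c.Λ ⊕ d.Λ
  σ := c.σ × d.σ
  main := .inl c.main
  init := (c.init, d.init)
  m
    | .inl l => liftStmt (fun k => k) Prod.fst (fun v s => (v, s.2)) Sum.inl
        (.goto fun _ => .inr d.main) (c.m l)
    | .inr l => liftStmt (fun k => k) Prod.snd (fun v s => (s.1, v)) Sum.inr .halt (d.m l)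

/-- The halt of `c` becomes a jump to `d`. A run ends with the variables at their initial value, so
the pair of variables is again initial when `d` starts, and no step is added. -/
theorem Runs.seq {c d : Comp K Γ} {S T U : ∀ k, List (Γ k)} {t t' : ℕ} (h : c.Runs S T t)
    (h' : d.Runs T U t') : (c.seq d).Runs S U (t + t') := by
  obtain ⟨n, hn, h⟩ := h
  obtain ⟨n', hn', h'⟩ := h'
  obtain ⟨V, hV, -, st⟩ := h.lift (j := fun k => k) (M' := (c.seq d).m) (get := Prod.fst)
    (set := fun v s => (v, s.2)) (lab := Sum.inl)
    (ex := .goto fun _ => .inr d.main) Function.injective_id (fun _ _ => rfl) (fun _ _ _ => rfl)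
    (e := some (.inr d.main)) (fun _ _ => rfl) (fun _ => rfl) (c.init, d.init) (S' := S)
    (fun _ => rfl)
  obtain rfl : V = T := funext hV
  obtain ⟨W, hW, -, st'⟩ := h'.lift (j := fun k => k) (M' := (c.seq d).m) (get := Prod.snd)
    (set := fun v s => (s.1, v)) (lab := Sum.inr)
    (ex := .halt) Function.injective_id (fun _ _ => rfl) (fun _ _ _ => rfl)
    (e := none) (fun _ _ => rfl) (fun _ => rfl) (c.init, d.init) (S' := V)
    (fun _ => rfl)
  obtain rfl : W = U := funext hW
  exact ⟨n + n', by omega, st.trans st'⟩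

/-- A program on some of the stacks. -/
def embed {K₀ : Type} (j : K₀ → K) (c : Comp K₀ fun k => Γ (j k)) : Comp K Γ where
  Λ := c.Λ
  σ := c.σ
  main := c.main
  init := c.init
  m l := liftStmt j id (fun v _ => v) id .halt (c.m l)

theorem Runs.embed {K₀ : Type} [DecidableEq K₀] {j : K₀ → K} (hj : Function.Injective j)
    {c : Comp K₀ fun k => Γ (j k)} {S T : ∀ k, List (Γ (j k))} {t : ℕ} (h : c.Runs S T t)
    {S' T' : ∀ k, List (Γ k)} (hS : ∀ k, S' (j k) = S k) (hT : ∀ k, T' (j k) = T k)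
    (hfr : ∀ k ∉ Set.range j, T' k = S' k) : (c.embed j).Runs S' T' t := by
  obtain ⟨n, hn, h⟩ := h
  obtain ⟨U, hU, hU', st⟩ := h.lift (M' := (c.embed j).m) (get := id)
    (set := fun v _ => v) (lab := id) (ex := .halt) hj (fun _ _ => rfl) (fun _ _ _ => rfl)
    (e := none) (fun _ _ => rfl) (fun _ => rfl) c.init hS
  obtain rfl : U = T' := by
    funext k
    by_cases hk : k ∈ Set.range j
    · obtain ⟨i, rfl⟩ := hk
      rw [hU, hT]
    · rw [hU' k hk, hfr k hk]
  exact ⟨n, hn, st⟩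

end Comp

/-! ### Output length -/

section Length

variable {K : Type} [DecidableEq K] {Γ : K → Type} {Λ σ : Type}

/-- The number of push instructions of a statement. -/
def pushCount : TM2.Stmt Γ Λ σ → ℕ
  | .push _ _ q => pushCount q + 1
  | .peek _ _ q => pushCount q
  | .pop _ _ q => pushCount q
  | .load _ q => pushCount q
  | .branch _ q q' => pushCount q + pushCount q'
  | .goto _ => 0
  | .halt => 0

theorem length_stepAux_le (q : TM2.Stmt Γ Λ σ) (v : σ) (S : ∀ k, List (Γ k)) (k : K) :
    ((TM2.stepAux q v S).stk k).length ≤ (S k).length + pushCount q := by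
  induction q generalizing v S with
  | push i f q ih =>
    refine (ih v _).trans ?_
    rcases eq_or_ne k i with rfl | h
    · simp [pushCount]; omega
    · simp [pushCount, h]
  | peek i f q ih => exact ih _ _
  | pop i f q ih =>
    refine (ih _ _).trans ?_
    rcases eq_or_ne k i with rfl | h
    · simp [pushCount]
    · simp [pushCount, h]
  | load f q ih => exact ih _ _
  | branch f q q' ih ih' =>
    simp only [TM2.stepAux, pushCount]
    cases f v
    · exact (ih' v S).trans (by omega)
    · exact (ih v S).trans (by omega)
  | goto f => simp [pushCount]
  | halt => simp [pushCount]

/-- A step pushes at most as many symbols as its statement has push instructions. Hence polynomial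
time bounds the output length, which is what makes compositions polynomial. -/
theorem Comp.exists_length_le [Fintype K] (c : Comp K Γ) : ∃ B : ℕ, ∀ {S T t}, c.Runs S T t →
    ∀ k, (T k).length ≤ (S k).length + B * t := by
  refine ⟨Finset.univ.sup fun l => pushCount (c.m l), ?_⟩
  rintro S T t ⟨n, hn, h⟩ k
  set B := Finset.univ.sup fun l => pushCount (c.m l) with hB
  have key : ∀ (n : ℕ) (a b : TM2.Cfg Γ c.Λ c.σ), Steps (TM2.step c.m) n a b →
      (b.stk k).length ≤ (a.stk k).length + B * n := by
    intro n
    induction n with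
    | zero => rintro a b rfl; simp
    | succ n ih =>
      rintro ⟨l, v, S⟩ b ⟨d, hd, h⟩
      cases l with
      | none => simp [TM2.step] at hd
      | some l =>
        simp only [TM2.step, Option.some.injEq] at hd
        have h1 := length_stepAux_le (c.m l) v S k
        have h2 : pushCount (c.m l) ≤ B := Finset.le_sup (f := fun l => pushCount (c.m l))
          (Finset.mem_univ l)
        rw [hd] at h1
        have h3 := ih d b h
        simp only [Nat.mul_add]
        omega
  refine (key n _ _ h).trans ?_
  gcongr

end Length

/-! ### Automata with stacks -/

/-- An automaton that repeatedly pops a symbol from a stack and pushes symbols. The symbols read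
are decoded to the finite alphabet `A`. -/
structure StackAutomaton (K : Type) (Γ : K → Type) where
  A : Type
  Q : Type
  [finA : Fintype A]
  [finQ : Fintype Q]
  start : Q
  reg : Q → Option (Σ k, (Γ k → A))
  next : Q → Option A → Q × List (Σ k, Γ k)

attribute [instance] StackAutomaton.finA StackAutomaton.finQ

section StackAutomaton

variable {K : Type} [DecidableEq K] {Γ : K → Type}

/-- Push symbols, the first one first. -/
def pushAll (S : ∀ k, List (Γ k)) (L : List (Σ k, Γ k)) : ∀ k, List (Γ k) :=
  L.foldl (fun S p => Function.update S p.1 (p.2 :: S p.1)) S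

/-- The symbols in the list that are for the stack `k`. -/
def forStack (k : K) (L : List (Σ k, Γ k)) : List (Γ k) :=
  L.filterMap fun p => if h : p.1 = k then some (h ▸ p.2) else none

@[simp] theorem forStack_nil (k : K) : forStack k ([] : List (Σ k, Γ k)) = [] := rfl

@[simp] theorem forStack_cons_self (k : K) (a : Γ k) (L : List (Σ k, Γ k)) :
    forStack k (⟨k, a⟩ :: L) = a :: forStack k L := by
  simp [forStack]

theorem forStack_cons_of_ne {k i : K} (h : i ≠ k) (a : Γ i) (L : List (Σ k, Γ k)) :
    forStack k (⟨i, a⟩ :: L) = forStack k L := by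
  simp [forStack, h]

@[simp] theorem forStack_append (k : K) (L L' : List (Σ k, Γ k)) :
    forStack k (L ++ L') = forStack k L ++ forStack k L' := by
  simp [forStack]

theorem pushAll_apply (S : ∀ k, List (Γ k)) (L : List (Σ k, Γ k)) (k : K) :
    pushAll S L k = (forStack k L).reverse ++ S k := by
  induction L generalizing S with
  | nil => simp [pushAll]
  | cons p L ih =>
    obtain ⟨i, a⟩ := p
    change pushAll (Function.update S i (a :: S i)) L k = _
    rw [ih]
    rcases eq_or_ne i k with rfl | h
    · simp
    · rw [forStack_cons_of_ne h, Function.update_of_ne h.symm]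

/-- Push symbols, then continue with `q`. -/
def pushStmt {Λ σ : Type} (q : TM2.Stmt Γ Λ σ) : List (Σ k, Γ k) → TM2.Stmt Γ Λ σ
  | [] => q
  | p :: L => .push p.1 (fun _ => p.2) (pushStmt q L)

theorem stepAux_pushStmt {Λ σ : Type} (q : TM2.Stmt Γ Λ σ) (L : List (Σ k, Γ k)) (v : σ)
    (S : ∀ k, List (Γ k)) : TM2.stepAux (pushStmt q L) v S = TM2.stepAux q v (pushAll S L) := by
  induction L generalizing S with
  | nil => rfl
  | cons p L ih => simp only [pushStmt, TM2.stepAux, ih]; rfl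

namespace StackAutomaton

/-- The program of the automaton. -/
def toComp (P : StackAutomaton K Γ) : Comp K Γ where
  Λ := P.Q ⊕ (P.Q × Option P.A)
  σ := Option P.A
  main := .inl P.start
  init := none
  m
    | .inl q => match P.reg q with
      | none => .halt
      | some p => .pop p.1 (fun _ o => o.map p.2) (.goto fun s => .inr (q, s))
    | .inr (q, o) => pushStmt (.load (fun _ => none) (.goto fun _ => .inl (P.next q o).1))
        (P.next q o).2

/-- The automaton gets from state `q` and stacks `S` to state `q'` and stacks `S'`. -/
def Reach (P : StackAutomaton K Γ) (t : ℕ) (q : P.Q) (S : ∀ k, List (Γ k)) (q' : P.Q)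
    (S' : ∀ k, List (Γ k)) : Prop :=
  ∃ n ≤ t, Steps (TM2.step P.toComp.m) n ⟨some (.inl q), none, S⟩ ⟨some (.inl q'), none, S'⟩

variable {P : StackAutomaton K Γ}

theorem Reach.refl (q : P.Q) (S : ∀ k, List (Γ k)) (t : ℕ) : P.Reach t q S q S :=
  ⟨0, Nat.zero_le _, rfl⟩

theorem Reach.trans {t t' : ℕ} {q q' q'' : P.Q} {S S' S'' : ∀ k, List (Γ k)}
    (h : P.Reach t q S q' S') (h' : P.Reach t' q' S' q'' S'') : P.Reach (t + t') q S q'' S'' := by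
  obtain ⟨n, hn, h⟩ := h
  obtain ⟨n', hn', h'⟩ := h'
  exact ⟨n + n', by omega, h.trans h'⟩

theorem Reach.mono {t t' : ℕ} {q q' : P.Q} {S S' : ∀ k, List (Γ k)}
    (h : P.Reach t q S q' S') (ht : t ≤ t') : P.Reach t' q S q' S' := by
  obtain ⟨n, hn, h⟩ := h
  exact ⟨n, hn.trans ht, h⟩

theorem Reach.congr {t t' : ℕ} {q q' : P.Q} {S S' T : ∀ k, List (Γ k)}
    (h : P.Reach t q S q' S') (ht : t ≤ t') (hT : S' = T) : P.Reach t' q S q' T :=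
  hT ▸ h.mono ht

/-- One step pops a symbol into the variable and branches on it; the next pushes and resets the
variable, so that a run can end with its initial value. -/
theorem reach_read {q q' : P.Q} {p : Σ k, (Γ k → P.A)} {S S' : ∀ k, List (Γ k)}
    {L : List (Σ k, Γ k)} (hreg : P.reg q = some p)
    (hn : P.next q ((S p.1).head?.map p.2) = (q', L))
    (hS' : pushAll (Function.update S p.1 (S p.1).tail) L = S') : P.Reach 2 q S q' S' := by
  refine ⟨2, le_rfl, ⟨some (.inr (q, (S p.1).head?.map p.2)), (S p.1).head?.map p.2,
    Function.update S p.1 (S p.1).tail⟩, ?_, ⟨some (.inl q'), none, S'⟩, ?_, rfl⟩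
  · simp [TM2.step, toComp, hreg]
  · simp [TM2.step, toComp, stepAux_pushStmt, hn, hS']

theorem Reach.runs {t : ℕ} {q : P.Q} {S T : ∀ k, List (Γ k)}
    (h : P.Reach t P.start S q T) (hq : P.reg q = none) : P.toComp.Runs S T (t + 1) := by
  obtain ⟨n, hn, h⟩ := h
  refine ⟨n + 1, by omega, h.trans ?_⟩
  exact ⟨_, by simp [TM2.step, toComp, hq], rfl⟩

end StackAutomaton

end StackAutomaton

/-! ### Finite-state transducers -/

/-- The output of a finite-state transducer started in state `q`. -/
def fstRun {Q A B : Type} (δ : Q → A → Q × List B) (fin : Q → List B) : Q → List A → List B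
  | q, [] => fin q
  | q, a :: l => (δ q a).2 ++ fstRun δ fin (δ q a).1 l

theorem fstRun_unit {A B : Type} (g : A → List B) (l : List A) :
    fstRun (fun _ a => ((), g a)) (fun _ => []) () l = l.flatMap g := by
  induction l with
  | nil => rfl
  | cons a l ih => simp [fstRun, ih]

/-! ### Loops that empty a stack. -/

section Loop

variable {K : Type} [DecidableEq K] {Γ : K → Type}

/-- Empty the stack `k` while running a transducer whose output symbols are pushed. -/
def transduce {Q A : Type} [Fintype Q] [Fintype A] (k : K) (e : Γ k → A)
    (δ : Q → A → Q × List (Σ k, Γ k)) (fin : Q → List (Σ k, Γ k)) (q : Q) :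
    StackAutomaton K Γ where
  A := A
  Q := Option Q
  start := some q
  reg := Option.map fun _ => ⟨k, e⟩
  next
    | some q, some a => (some (δ q a).1, (δ q a).2)
    | some q, none => (none, fin q)
    | none, _ => (none, [])

/-- Nothing is pushed back on `k`, so the loop reads exactly the original content. Each symbol costs
two steps, the discovery of the empty stack two more, and the halt one. The output appears in
reverse, since its first symbol is pushed first. -/
theorem transduce_runs {Q A : Type} [Fintype Q] [Fintype A] {k : K} {e : Γ k → A}
    {δ : Q → A → Q × List (Σ k, Γ k)} {fin : Q → List (Σ k, Γ k)} {q : Q}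
    (hδ : ∀ q a, forStack k (δ q a).2 = []) (hfin : ∀ q, forStack k (fin q) = [])
    {S T : ∀ k, List (Γ k)} (hk : T k = [])
    (hT : ∀ i, i ≠ k → T i = (forStack i (fstRun δ fin q ((S k).map e))).reverse ++ S i) :
    (transduce k e δ fin q).toComp.Runs S T (2 * (S k).length + 3) := by
  have key : ∀ (l : List (Γ k)) (q' : Q) (S : ∀ k, List (Γ k)), S k = l →
      (∀ i, i ≠ k → T i = (forStack i (fstRun δ fin q' (l.map e))).reverse ++ S i) →
      (transduce k e δ fin q).Reach (2 * l.length + 2) (some q') S none T := by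
    intro l
    induction l with
    | nil =>
      intro q' S hS h
      refine (StackAutomaton.reach_read (p := ⟨k, e⟩) (L := fin q') rfl (by rw [hS]; rfl) ?_).mono
        (by simp)
      funext i
      rw [pushAll_apply]
      rcases eq_or_ne i k with rfl | hi
      · simp [hfin, hS, hk]
      · rw [h i hi, Function.update_of_ne hi]
        rfl
    | cons a l ih =>
      intro q' S hS h
      have := ih (δ q' (e a)).1 (pushAll (Function.update S k (S k).tail) (δ q' (e a)).2) (by
        simp [pushAll_apply, hδ, hS]) (by
        intro i hi
        rw [h i hi, pushAll_apply, Function.update_of_ne hi]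
        simp [fstRun])
      refine ((StackAutomaton.reach_read (p := ⟨k, e⟩) (L := (δ q' (e a)).2) rfl
        (by rw [hS]; rfl) rfl).trans this).mono ?_
      simp only [List.length_cons]
      omega
  exact (key _ q S rfl hT).runs rfl

/-- Empty the stack `k` and push the symbols `g a` for every symbol `a`. -/
def pour {A : Type} [Fintype A] (k : K) (e : Γ k → A) (g : A → List (Σ k, Γ k)) : Comp K Γ :=
  (transduce k e (fun _ a => ((), g a)) (fun _ => []) ()).toComp

theorem pour_runs {A : Type} [Fintype A] {k : K} {e : Γ k → A} {g : A → List (Σ k, Γ k)}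
    (hg : ∀ a, forStack k (g a) = []) {S T : ∀ k, List (Γ k)} (hk : T k = [])
    (hT : ∀ i, i ≠ k → T i = (((S k).map e).flatMap fun a => forStack i (g a)).reverse ++ S i) :
    (pour k e g).Runs S T (2 * (S k).length + 3) := by
  refine transduce_runs (fun _ => hg) (fun _ => rfl) hk fun i hi => ?_
  rw [hT i hi, fstRun_unit]
  congr 2
  induction (S k).map e with
  | nil => rfl
  | cons a l ih => simp [ih]

end Loop

/-! ### Polynomial time between words -/

/-- The stack `k` contains `l`, the other stacks are empty. -/
def single {K : Type} [DecidableEq K] {Γ : K → Type} (k : K) (l : List (Γ k)) :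
    ∀ k, List (Γ k) :=
  Function.update (fun _ => []) k l

@[simp] theorem single_self {K : Type} [DecidableEq K] {Γ : K → Type} (k : K) (l : List (Γ k)) :
    single k l k = l := by simp [single]

theorem single_of_ne {K : Type} [DecidableEq K] {Γ : K → Type} {k i : K} (h : i ≠ k)
    (l : List (Γ k)) : single k l i = [] := by simp [single, h]

/-- A machine with input word `u x` outputs the word `v x` in time polynomial in the length of the
input. -/
def PT {X : Type*} {α β : Type} (u : X → List α) (v : X → List β) : Prop :=
  ∃ (K : Type) (_ : DecidableEq K) (_ : Fintype K) (Γ : K → Type) (c : Comp K Γ) (k₀ k₁ : K)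
    (e₀ : Γ k₀ ≃ α) (e₁ : Γ k₁ ≃ β) (p : Polynomial ℕ), ∀ x,
    c.Runs (single k₀ ((u x).map e₀.symm)) (single k₁ ((v x).map e₁.symm)) (p.eval (u x).length)

theorem initList_eq (tm : FinTM2) (s : List (tm.Γ tm.k₀)) :
    initList tm s = ⟨some tm.main, tm.initialState, single tm.k₀ s⟩ := by
  unfold initList
  congr 1
  funext k
  by_cases h : k = tm.k₀
  · subst h; simp
  · simp [single_of_ne h, h]

theorem haltList_eq (tm : FinTM2) (s : List (tm.Γ tm.k₁)) :
    haltList tm s = ⟨none, tm.initialState, single tm.k₁ s⟩ := by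
  unfold haltList
  congr 1
  funext k
  by_cases h : k = tm.k₁
  · subst h; simp
  · simp [single_of_ne h, h]

/-- The initial and halting configurations of `FinTM2` have exactly one possibly nonempty stack and
the initial variable value, so they are the ones in `PT`. -/
theorem isPolyTime_iff {g : List Str → Str} : IsPolyTime g ↔ PT encTuple g := by
  constructor
  · rintro ⟨⟨⟨tm, e₀, e₁⟩, p, h⟩⟩
    refine ⟨tm.K, inferInstance, tm.kFin, tm.Γ,
      @Comp.mk tm.K tm.Γ tm.Λ tm.σ tm.ΛFin tm.σFin tm.main tm.initialState tm.m, tm.k₀, tm.k₁,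
      e₀, e₁, p, fun x => ?_⟩
    obtain ⟨⟨n, hn⟩, hle⟩ := h x
    refine ⟨n, hle, ?_⟩
    rw [steps_iff_iterate]
    rw [initList_eq] at hn
    refine hn.trans ?_
    change some (haltList tm _) = _
    rw [haltList_eq]
    rfl
  · rintro ⟨K, _, _, Γ, c, k₀, k₁, e₀, e₁, p, h⟩
    -- `FinTM2` asks for a finite input alphabet; it is equivalent to `Option Bool`.
    have hΓ : Fintype (Γ k₀) := Fintype.ofEquiv _ e₀.symm
    let tm := @FinTM2.mk K _ _ k₀ k₁ Γ c.Λ c.main c.finΛ c.σ c.init c.finσ hΓ c.m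
    refine ⟨⟨⟨tm, e₀, e₁⟩, p, fun x => ?_⟩⟩
    have hx := h x
    refine Classical.choice ?_
    obtain ⟨n, hle, hn⟩ := hx
    refine ⟨⟨⟨n, ?_⟩, hle⟩⟩
    rw [steps_iff_iterate] at hn
    rw [initList_eq]
    exact hn.trans (congrArg some (haltList_eq tm _).symm)

theorem eval_mono (p : Polynomial ℕ) {m n : ℕ} (h : m ≤ n) : p.eval m ≤ p.eval n := by
  rw [Polynomial.eval_eq_sum_range, Polynomial.eval_eq_sum_range]
  gcongr

namespace PT

variable {X : Type*} {α β γ : Type}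

theorem reindex {Y : Type*} {u : X → List α} {v : X → List β} (h : PT u v) (F : Y → X) :
    PT (fun y => u (F y)) fun y => v (F y) := by
  obtain ⟨K, i₁, i₂, Γ, c, k₀, k₁, e₀, e₁, p, h⟩ := h
  exact ⟨K, i₁, i₂, Γ, c, k₀, k₁, e₀, e₁, p, fun y => h (F y)⟩

theorem exists_length_le {u : X → List α} {v : X → List β} (h : PT u v) :
    ∃ p : Polynomial ℕ, ∀ x, (v x).length ≤ p.eval (u x).length := by
  obtain ⟨K, i₁, i₂, Γ, c, k₀, k₁, e₀, e₁, p, h⟩ := h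
  obtain ⟨B, hB⟩ := c.exists_length_le
  refine ⟨Polynomial.X + Polynomial.C B * p, fun x => ?_⟩
  have h1 := hB (h x) k₁
  -- The output stack may be the input stack, in which case it is not empty at the start.
  have h2 : (single (Γ := Γ) k₀ ((u x).map e₀.symm) k₁).length ≤ (u x).length := by
    rcases eq_or_ne k₁ k₀ with rfl | hk
    · simp
    · simp [single_of_ne hk]
  simp only [single_self, List.length_map] at h1
  simp only [Polynomial.eval_add, Polynomial.eval_X, Polynomial.eval_mul, Polynomial.eval_C]
  omega

end PT

/-! ### Moving and copying words between stacks. -/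

section Moves

variable {K : Type} [DecidableEq K] {Γ : K → Type}

/-- The stacks `k` and `k'` contain `l` and `l'`, the other stacks are empty. -/
def double (k : K) (l : List (Γ k)) (k' : K) (l' : List (Γ k')) : ∀ k, List (Γ k) :=
  Function.update (single k l) k' l'

@[simp] theorem double_right (k : K) (l : List (Γ k)) (k' : K) (l' : List (Γ k')) :
    double k l k' l' k' = l' := by simp [double]

theorem double_left {k k' : K} (h : k ≠ k') (l : List (Γ k)) (l' : List (Γ k')) :
    double k l k' l' k = l := by simp [double, h]

theorem double_of_ne {k k' i : K} (h : i ≠ k) (h' : i ≠ k') (l : List (Γ k)) (l' : List (Γ k')) :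
    double k l k' l' i = [] := by simp [double, h', single_of_ne h]

theorem double_comm {k k' : K} (h : k ≠ k') (l : List (Γ k)) (l' : List (Γ k')) :
    double k l k' l' = double k' l' k l := by
  funext i
  by_cases h1 : i = k
  · subst h1; simp [double_left h]
  · by_cases h2 : i = k'
    · subst h2; simp [double_left h.symm]
    · rw [double_of_ne h1 h2, double_of_ne h2 h1]

/-- Move the content of the stack `k` to the stack `k'`. -/
def move {A : Type} [Fintype A] (k k' : K) (e : Γ k ≃ A) (e' : Γ k' ≃ A) : Comp K Γ :=
  pour k e fun a => [⟨k', e'.symm a⟩]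

theorem move_runs {A : Type} [Fintype A] {k k' : K} {e : Γ k ≃ A} {e' : Γ k' ≃ A} (hk : k' ≠ k)
    {l : List A} {S T : ∀ k, List (Γ k)} (hS : S k = l.map e.symm) (hTk : T k = [])
    (hTk' : T k' = l.reverse.map e'.symm ++ S k') (hT : ∀ i, i ≠ k → i ≠ k' → T i = S i) :
    (move k k' e e').Runs S T (2 * l.length + 3) := by
  refine (pour_runs (fun a => forStack_cons_of_ne hk _ _) hTk fun i hi => ?_).mono (by simp [hS])
  rcases eq_or_ne i k' with rfl | hi'
  · rw [hTk', hS]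
    congr 1
    simp [Function.comp_def, ← List.map_eq_flatMap]
  · rw [hT i hi hi']
    simp [forStack_cons_of_ne hi'.symm]

theorem move_single {A : Type} [Fintype A] {k k' : K} {e : Γ k ≃ A} {e' : Γ k' ≃ A} (hk : k' ≠ k)
    (l : List A) : (move k k' e e').Runs (single k (l.map e.symm))
      (single k' (l.reverse.map e'.symm)) (2 * l.length + 3) := by
  refine move_runs hk (single_self _ _) (single_of_ne hk.symm _) ?_ fun i hi hi' => ?_
  · rw [single_self, single_of_ne hk, List.append_nil]
  · rw [single_of_ne hi, single_of_ne hi']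

theorem move_double {A : Type} [Fintype A] {i k k' : K} {e : Γ k ≃ A} {e' : Γ k' ≃ A}
    (hk : k' ≠ k) (hi : i ≠ k) (hi' : i ≠ k') (x : List (Γ i)) (l : List A) :
    (move k k' e e').Runs (double i x k (l.map e.symm))
      (double i x k' (l.reverse.map e'.symm)) (2 * l.length + 3) := by
  refine move_runs hk (double_right _ _ _ _) (double_of_ne hi.symm hk.symm _ _) ?_
    fun j hj hj' => ?_
  · rw [double_right, double_of_ne hi'.symm hk, List.append_nil]
  · rcases eq_or_ne j i with rfl | hji
    · rw [double_left hi, double_left hi']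
    · rw [double_of_ne hji hj', double_of_ne hji hj]

theorem move_onto {A : Type} [Fintype A] {k k' : K} {e : Γ k ≃ A} {e' : Γ k' ≃ A}
    (hk : k' ≠ k) (x l : List A) :
    (move k k' e e').Runs (double k' (x.map e'.symm) k (l.map e.symm))
      (single k' ((l.reverse ++ x).map e'.symm)) (2 * l.length + 3) := by
  refine move_runs hk (double_right _ _ _ _) (single_of_ne hk.symm _) ?_ fun j hj hj' => ?_
  · rw [single_self, double_left hk, List.map_append]
  · rw [double_of_ne hj' hj, single_of_ne hj']

/-- Move the content of the stack `k` to the stacks `k₁` and `k₂`. -/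
def fork {A : Type} [Fintype A] (k k₁ k₂ : K) (e : Γ k ≃ A) (e₁ : Γ k₁ ≃ A) (e₂ : Γ k₂ ≃ A) :
    Comp K Γ :=
  pour k e fun a => [⟨k₁, e₁.symm a⟩, ⟨k₂, e₂.symm a⟩]

theorem fork_runs {A : Type} [Fintype A] {k k₁ k₂ : K} {e : Γ k ≃ A} {e₁ : Γ k₁ ≃ A}
    {e₂ : Γ k₂ ≃ A} (h₁ : k₁ ≠ k) (h₂ : k₂ ≠ k) (h : k₁ ≠ k₂) (l : List A) :
    (fork k k₁ k₂ e e₁ e₂).Runs (single k (l.map e.symm))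
      (double k₁ (l.reverse.map e₁.symm) k₂ (l.reverse.map e₂.symm)) (2 * l.length + 3) := by
  refine (pour_runs (fun a => ?_) (double_of_ne h₁.symm h₂.symm _ _) fun i hi => ?_).mono (by simp)
  · rw [forStack_cons_of_ne h₁, forStack_cons_of_ne h₂]
    rfl
  · rw [single_of_ne hi, single_self]
    rcases eq_or_ne i k₁ with rfl | hi₁
    · simp [double_left h, forStack_cons_of_ne h.symm, Function.comp_def, ← List.map_eq_flatMap]
    rcases eq_or_ne i k₂ with rfl | hi₂
    · simp [forStack_cons_of_ne h, Function.comp_def, ← List.map_eq_flatMap]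
    · rw [double_of_ne hi₁ hi₂]
      simp [forStack_cons_of_ne hi₁.symm, forStack_cons_of_ne hi₂.symm]

/-- The transducer leaves its output reversed on `k₁`, and the move to `k₂` restores the order. The
cost of this move is bounded through the length of the output. -/
theorem exists_fst_comp [Fintype K] {α β Q : Type} [Fintype Q] [Fintype α] [Fintype β]
    {k₀ k₁ k₂ : K} (h01 : k₁ ≠ k₀) (h12 : k₂ ≠ k₁) (e₀ : Γ k₀ ≃ α)
    (e₁ : Γ k₁ ≃ β) (e₂ : Γ k₂ ≃ β) (δ : Q → α → Q × List β) (fin : Q → List β) (q : Q) :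
    ∃ (c : Comp K Γ) (p : Polynomial ℕ), ∀ l, c.Runs (single k₀ (l.map e₀.symm))
      (single k₂ ((fstRun δ fin q l).map e₂.symm)) (p.eval l.length) := by
  let out : List β → List (Σ k, Γ k) := fun l => l.map fun b => ⟨k₁, e₁.symm b⟩
  have hout : ∀ l, forStack k₁ (out l) = l.map e₁.symm := by
    intro l
    induction l with
    | nil => rfl
    | cons b l ih => exact (forStack_cons_self _ _ _).trans (congrArg _ ih)
  have hout' : ∀ k, k ≠ k₁ → ∀ l, forStack k (out l) = [] := by
    intro k hk l
    induction l with
    | nil => rfl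
    | cons b l ih => exact (forStack_cons_of_ne hk.symm _ _).trans ih
  have hrun : ∀ l q, fstRun (fun q a => ((δ q a).1, out (δ q a).2))
      (fun q => out (fin q)) q l = out (fstRun δ fin q l) := by
    intro l
    induction l with
    | nil => intro q; rfl
    | cons b l ih => intro q; simp only [fstRun, ih]; simp [out]
  let c₁ : Comp K Γ := (transduce k₀ e₀
    (fun q a => ((δ q a).1, out (δ q a).2)) (fun q => out (fin q)) q).toComp
  obtain ⟨B, hB⟩ := c₁.exists_length_le
  refine ⟨c₁.seq (move k₁ k₂ e₁ e₂),
    2 * Polynomial.X + 3 + (2 * (Polynomial.C B * (2 * Polynomial.X + 3)) + 3), fun l => ?_⟩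
  have h₁ : c₁.Runs (single k₀ (l.map e₀.symm))
      (single k₁ ((fstRun δ fin q l).reverse.map e₁.symm)) (2 * l.length + 3) := by
    refine (transduce_runs (fun q a => hout' _ h01.symm _) (fun q => hout' _ h01.symm _)
      (single_of_ne h01.symm _) fun k hk => ?_).mono (by simp)
    rw [hrun, single_of_ne hk, single_self, List.append_nil]
    rcases eq_or_ne k k₁ with rfl | hk'
    · rw [hout]
      simp [Function.comp_def]
    · rw [hout' k hk', single_of_ne hk']
      rfl
  have hl := hB h₁ k₁
  rw [single_self, single_of_ne h01, List.length_nil, zero_add] at hl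
  have h₂ := h₁.seq (move_single (e' := e₂) h12 (fstRun δ fin q l).reverse)
  rw [List.reverse_reverse] at h₂
  refine h₂.mono ?_
  simp only [List.length_map] at hl
  simp only [Polynomial.eval_add, Polynomial.eval_mul, Polynomial.eval_X, Polynomial.eval_C,
    Polynomial.eval_ofNat]
  omega

end Moves

namespace PT

variable {X : Type*} {α β γ : Type}

/-- Finite-state transducers work in polynomial time. -/
theorem fstRun_self {Q : Type} [Fintype Q] [Fintype α] [Fintype β] (u : X → List α)
    (δ : Q → α → Q × List β) (fin : Q → List β) (q : Q) :
    PT u fun x => fstRun δ fin q (u x) := by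
  let Γ : Option Bool → Type := fun k => k.elim α fun _ => β
  obtain ⟨c, p, h⟩ := exists_fst_comp (Γ := Γ) (k₀ := none) (k₁ := some false) (k₂ := some true)
    (by simp) (by simp) (Equiv.refl α) (Equiv.refl β) (Equiv.refl β) δ fin q
  exact ⟨Option Bool, inferInstance, inferInstance, Γ, c, none, some true, Equiv.refl α,
    Equiv.refl β, p, fun x => h (u x)⟩

end PT

/-! ### Running two machines on one input and a third on their joint output. -/

section CompAppend

variable {K Kf Kg Kh : Type} [DecidableEq K] [DecidableEq Kf] [DecidableEq Kg] [DecidableEq Kh]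
  {Γ : K → Type} {α β : Type} [Fintype α] [Fintype β]

/-- Every transfer reverses a word, so each word is transferred twice: the input through `t` and
then forked to both machines, the outputs through `b`. The stacks of the first machine are disjoint
from those of the other two, so its output survives until it is collected. -/
theorem comp_append_runs {jf : Kf → K} {jg : Kg → K} {jh : Kh → K} {a t b : K}
    (hf : Function.Injective jf) (hg : Function.Injective jg) (hh : Function.Injective jh)
    (hfg : ∀ i k, jf i ≠ jg k) (hfh : ∀ i k, jf i ≠ jh k)
    (hat : t ≠ a) (hft : ∀ i, jf i ≠ t) (hgt : ∀ i, jg i ≠ t)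
    (hfb : ∀ i, jf i ≠ b) (hgb : ∀ i, jg i ≠ b) (hhb : ∀ i, jh i ≠ b)
    {cf : Comp Kf fun k => Γ (jf k)} {cg : Comp Kg fun k => Γ (jg k)}
    {ch : Comp Kh fun k => Γ (jh k)} {f₀ f₁ : Kf} {g₀ g₁ : Kg} {h₀ h₁ : Kh}
    {ea : Γ a ≃ α} {et : Γ t ≃ α} {eb : Γ b ≃ β}
    {ef₀ : Γ (jf f₀) ≃ α} {eg₀ : Γ (jg g₀) ≃ α} {ef₁ : Γ (jf f₁) ≃ β} {eg₁ : Γ (jg g₁) ≃ β}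
    {eh₀ : Γ (jh h₀) ≃ β} {w : List α} {v₁ v₂ : List β} {z : List (Γ (jh h₁))} {tf tg th : ℕ}
    (hcf : cf.Runs (single f₀ (w.map ef₀.symm)) (single f₁ (v₁.map ef₁.symm)) tf)
    (hcg : cg.Runs (single g₀ (w.map eg₀.symm)) (single g₁ (v₂.map eg₁.symm)) tg)
    (hch : ch.Runs (single h₀ ((v₁ ++ v₂).map eh₀.symm)) (single h₁ z) th) :
    (((((((((move a t ea et).seq (fork t (jf f₀) (jg g₀) et ef₀ eg₀)).seq (cf.embed jf)).seq
      (cg.embed jg)).seq (move (jg g₁) b eg₁ eb)).seq (move b (jh h₀) eb eh₀)).seq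
      (move (jf f₁) b ef₁ eb)).seq (move b (jh h₀) eb eh₀)).seq (ch.embed jh)).Runs
      (single a (w.map ea.symm)) (single (jh h₁) z)
      (4 * w.length + 4 * v₁.length + 4 * v₂.length + 18 + tf + tg + th) := by
  have r1 := move_single (e := ea) (e' := et) hat w
  have r2 := fork_runs (e := et) (e₁ := ef₀) (e₂ := eg₀) (hft f₀) (hgt g₀) (hfg f₀ g₀) w.reverse
  rw [List.reverse_reverse] at r2
  have emb : ∀ {K₀ : Type} [DecidableEq K₀] {j : K₀ → K} (_ : Function.Injective j) (k i : K₀)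
      (l : List (Γ (j k))), single (Γ := Γ) (j k) l (j i) =
        single (Γ := fun k => Γ (j k)) k l i := by
    intro K₀ _ j hj k i l
    rcases eq_or_ne i k with rfl | h
    · rw [single_self, single_self (Γ := fun k => Γ (j k))]
    · rw [single_of_ne (hj.ne h), single_of_ne (Γ := fun k => Γ (j k)) h]
  have emb2 : ∀ {K₀ : Type} [DecidableEq K₀] {j : K₀ → K} (_ : Function.Injective j) (k i : K₀)
      (l : List (Γ (j k))) (i' : K) (l' : List (Γ i')), (∀ k, j k ≠ i') →
      double (j k) l i' l' (j i) = single (Γ := fun k => Γ (j k)) k l i := by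
    intro K₀ _ j hj k i l i' l' hi'
    rw [← emb hj, double, Function.update_of_ne (hi' i)]
  have fr2 : ∀ {K₀ : Type} [DecidableEq K₀] {j : K₀ → K} (k k' : K₀)
      (l : List (Γ (j k))) (l₁ : List (Γ (j k'))) (i' : K) (l' : List (Γ i')), (∀ k, j k ≠ i') →
      ∀ i ∉ Set.range j, double (j k) l i' l' i = double (j k') l₁ i' l' i := by
    intro K₀ _ j k k' l l₁ i' l' hi' i hi
    rcases eq_or_ne i i' with rfl | hii
    · simp
    · rw [double_of_ne (fun h => hi ⟨_, h.symm⟩) hii, double_of_ne (fun h => hi ⟨_, h.symm⟩) hii]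
  have r3 : (cf.embed jf).Runs (double (jf f₀) (w.map ef₀.symm) (jg g₀) (w.map eg₀.symm))
      (double (jf f₁) (v₁.map ef₁.symm) (jg g₀) (w.map eg₀.symm)) tf :=
    hcf.embed hf (fun k => emb2 hf _ _ _ _ _ fun i => hfg i _)
      (fun k => emb2 hf _ _ _ _ _ fun i => hfg i _)
      (fun k hk => fr2 _ _ _ _ _ _ (fun i => hfg i _) k hk)
  have r4 : (cg.embed jg).Runs (double (jf f₁) (v₁.map ef₁.symm) (jg g₀) (w.map eg₀.symm))
      (double (jf f₁) (v₁.map ef₁.symm) (jg g₁) (v₂.map eg₁.symm)) tg := by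
    rw [double_comm (hfg _ _), double_comm (hfg _ _)]
    exact hcg.embed hg (fun k => emb2 hg _ _ _ _ _ fun i => (hfg _ i).symm)
      (fun k => emb2 hg _ _ _ _ _ fun i => (hfg _ i).symm)
      (fun k hk => fr2 _ _ _ _ _ _ (fun i => (hfg _ i).symm) k hk)
  -- `v₂` is delivered before `v₁`, because the word pushed last comes to lie on top, that is,
  -- first.
  have r5 := move_double (e := eg₁) (e' := eb) (hgb g₁).symm (hfg f₁ g₁) (hfb f₁)
    (v₁.map ef₁.symm) v₂
  have r6 := move_double (e := eb) (e' := eh₀) (hhb h₀) (hfb f₁) (hfh f₁ h₀)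
    (v₁.map ef₁.symm) v₂.reverse
  rw [List.reverse_reverse, double_comm (hfh f₁ h₀)] at r6
  have r7 := move_double (e := ef₁) (e' := eb) (hfb f₁).symm (hfh f₁ h₀).symm (hhb h₀)
    (v₂.map eh₀.symm) v₁
  have r8 := move_onto (e := eb) (e' := eh₀) (hhb h₀) v₂ v₁.reverse
  rw [List.reverse_reverse] at r8
  have r9 : (ch.embed jh).Runs (single (jh h₀) ((v₁ ++ v₂).map eh₀.symm)) (single (jh h₁) z) th :=
    hch.embed hh (fun k => emb hh _ _ _) (fun k => emb hh _ _ _) fun k hk => by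
      rw [single_of_ne (fun h => hk ⟨_, h.symm⟩), single_of_ne (fun h => hk ⟨_, h.symm⟩)]
  refine ((((((((r1.seq r2).seq r3).seq r4).seq r5).seq r6).seq r7).seq r8).seq r9).mono ?_
  simp only [List.length_reverse]
  omega

end CompAppend

namespace PT

variable {X : Type*} {α β γ : Type}

/-- Run two machines on the input and a third one on the concatenation of their outputs. -/
theorem comp_append [Fintype α] [Fintype β] {u : X → List α} {v₁ v₂ : X → List β}
    {w : X → List γ} (hf : PT u v₁) (hg : PT u v₂) (hh : PT (fun x => v₁ x ++ v₂ x) w) :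
    PT u w := by
  obtain ⟨lf, hlf⟩ := hf.exists_length_le
  obtain ⟨lg, hlg⟩ := hg.exists_length_le
  obtain ⟨Kf, i₁, i₂, Γf, cf, f₀, f₁, ef₀, ef₁, pf, hf⟩ := hf
  obtain ⟨Kg, i₃, i₄, Γg, cg, g₀, g₁, eg₀, eg₁, pg, hg⟩ := hg
  obtain ⟨Kh, i₅, i₆, Γh, ch, h₀, h₁, eh₀, eh₁, ph, hh⟩ := hh
  -- Besides the stacks of the three machines: two for the input, and one through which the outputs
  -- pass.
  let K := (Kf ⊕ Kg) ⊕ (Kh ⊕ (Bool ⊕ Unit))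
  let Γ : K → Type := Sum.elim (Sum.elim Γf Γg) (Sum.elim Γh (Sum.elim (fun _ => α) fun _ => β))
  have key := fun x => comp_append_runs (Γ := Γ) (jf := fun k => .inl (.inl k))
    (jg := fun k => .inl (.inr k)) (jh := fun k => .inr (.inl k)) (a := .inr (.inr (.inl false)))
    (t := .inr (.inr (.inl true))) (b := .inr (.inr (.inr ())))
    (fun _ _ h => Sum.inl.inj (Sum.inl.inj h)) (fun _ _ h => Sum.inr.inj (Sum.inl.inj h))
    (fun _ _ h => Sum.inl.inj (Sum.inr.inj h)) (fun _ _ => nofun) (fun _ _ => nofun) nofun (fun _ => nofun)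
    (fun _ => nofun) (fun _ => nofun) (fun _ => nofun) (fun _ => nofun) (ea := Equiv.refl α) (et := Equiv.refl α)
    (eb := Equiv.refl β) (hf x) (hg x) (hh x)
  refine ⟨K, inferInstance, inferInstance, Γ, _, .inr (.inr (.inl false)), .inr (.inl h₁),
    Equiv.refl α, eh₁,
    4 * Polynomial.X + 4 * lf + 4 * lg + 18 + pf + pg + ph.comp (lf + lg),
    fun x => (key x).mono ?_⟩
  have h1 := hlf x
  have h2 := hlg x
  -- The third machine is polynomial in the length of its own input, which the bounds on the output
  -- lengths make polynomial in `|u x|`.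
  have h3 : ph.eval (v₁ x ++ v₂ x).length ≤ ph.eval ((lf + lg).eval (u x).length) := by
    refine eval_mono _ ?_
    simp only [List.length_append, Polynomial.eval_add]
    omega
  simp only [Polynomial.eval_add, Polynomial.eval_mul, Polynomial.eval_X,
    Polynomial.eval_ofNat, Polynomial.eval_comp] at h3 ⊢
  omega

theorem flatMap_self [Fintype α] [Fintype β] (u : X → List α) (g : α → List β) :
    PT u fun x => (u x).flatMap g := by
  have := fstRun_self u (fun (_ : Unit) a => ((), g a)) (fun _ => []) ()
  simpa only [fstRun_unit] using this

theorem refl [Fintype α] (u : X → List α) : PT u u := by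
  simpa using flatMap_self u fun a => [a]

theorem nil [Fintype α] [Fintype β] (u : X → List α) : PT u fun _ => ([] : List β) := by
  have : ∀ w : List α, w.flatMap (fun _ => ([] : List β)) = [] := by simp
  simpa only [this] using flatMap_self u fun _ => ([] : List β)

/-- The case of `comp_append` in which the second machine outputs nothing. -/
theorem comp [Fintype α] [Fintype β] {u : X → List α} {v : X → List β} {w : X → List γ}
    (h : PT u v) (h' : PT v w) : PT u w :=
  h.comp_append (nil u) (by simpa using h')

theorem append [Fintype α] [Fintype β] {u : X → List α} {v₁ v₂ : X → List β}
    (h₁ : PT u v₁) (h₂ : PT u v₂) : PT u fun x => v₁ x ++ v₂ x :=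
  h₁.comp_append h₂ (refl _)

theorem fstRun {Q : Type} [Fintype Q] [Fintype α] [Fintype β] [Fintype γ] {u : X → List α}
    {v : X → List β} (h : PT u v) (δ : Q → β → Q × List γ) (fin : Q → List γ) (q : Q) :
    PT u fun x => CompGame.fstRun δ fin q (v x) :=
  h.comp (fstRun_self v δ fin q)

theorem flatMap [Fintype α] [Fintype β] [Fintype γ] {u : X → List α} {v : X → List β} (h : PT u v)
    (g : β → List γ) : PT u fun x => (v x).flatMap g :=
  h.comp (flatMap_self v g)

theorem map [Fintype α] [Fintype β] [Fintype γ] {u : X → List α} {v : X → List β} (h : PT u v)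
    (g : β → γ) : PT u fun x => (v x).map g := by
  simpa [List.map_eq_flatMap] using h.flatMap fun b => [g b]

theorem const [Fintype α] [Fintype β] (u : X → List α) (l : List β) : PT u fun _ => l := by
  have := fstRun_self u (fun (_ : Unit) _ => ((), [])) (fun _ => l) ()
  have h : ∀ w : List α, CompGame.fstRun (fun (_ : Unit) _ => ((), [])) (fun _ => l) () w = l := by
    intro w
    induction w with
    | nil => rfl
    | cons a w ih => simpa [CompGame.fstRun] using ih
  simpa only [h] using this

end PT

/-! ### Basic polynomial-time functions -/

namespace PT

variable {X : Type*} {α β γ : Type} [Fintype α]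

theorem reverse_self (u : X → List α) : PT u fun x => (u x).reverse := by
  refine ⟨Bool, inferInstance, inferInstance, fun _ => α,
    move false true (Equiv.refl α) (Equiv.refl α), false, true, Equiv.refl α, Equiv.refl α,
    2 * Polynomial.X + 3, fun x => (move_single (by simp) (u x)).mono ?_⟩
  simp only [Polynomial.eval_add, Polynomial.eval_mul, Polynomial.eval_X, Polynomial.eval_ofNat,
    le_refl]

theorem reverse [Fintype β] {u : X → List α} {v : X → List β} (h : PT u v) :
    PT u fun x => (v x).reverse :=
  h.comp (reverse_self v)

/-- Functions of a fixed number of symbols at the beginning. -/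
theorem ofTake [Fintype β] [Fintype γ] {u : X → List α} {v : X → List β} (h : PT u v) (k : ℕ)
    (F : List β → List γ) : PT u fun x => F ((v x).take k) := by
  classical
  -- The state of the transducer is the word read so far, up to length `k`; all output is produced
  -- at the end.
  have : Fintype {l : List β // l.length ≤ k} := (List.finite_length_le β k).fintype
  let δ : {l : List β // l.length ≤ k} → β → {l : List β // l.length ≤ k} × List γ := fun q b =>
    (if h : (q.1 ++ [b]).length ≤ k then ⟨q.1 ++ [b], h⟩ else q, [])
  have key : ∀ (l : List β) (q : {l : List β // l.length ≤ k}),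
      CompGame.fstRun δ (fun q => F q.1) q l = F ((q.1 ++ l).take k) := by
    intro l
    induction l with
    | nil => intro q; simp [CompGame.fstRun, List.take_of_length_le q.2]
    | cons b l ih =>
      intro q
      simp only [CompGame.fstRun, List.nil_append, ih, δ]
      split_ifs with h
      · simp
      · have hq : q.1.length = k := by
          have := q.2
          simp only [List.length_append, List.length_singleton] at h
          omega
        rw [List.take_append_of_le_length hq.ge, List.take_append_of_le_length hq.ge]
  have := h.fstRun δ (fun q => F q.1) ⟨[], Nat.zero_le k⟩
  simpa [key] using this

/-- Functions of a Boolean value. -/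
theorem ofBool [Fintype γ] {u : X → List α} {c : X → Bool} (h : PT u fun x => [c x])
    (F : Bool → List γ) : PT u fun x => F (c x) := by
  simpa using h.flatMap F

/-- Both branches are computed and written after the condition, with a separator between them; a
transducer then erases the wrong one. -/
theorem ite [Fintype γ] {u : X → List α} {c : X → Bool} {f g : X → List γ}
    (hc : PT u fun x => [c x]) (hf : PT u f) (hg : PT u g) :
    PT u fun x => if c x then f x else g x := by
  -- In state `some (b, p)`, `b` is the condition and `p` is true before the separator `.inr none`.
  -- A symbol survives if and only if `b = p`.
  let δ : Option (Bool × Bool) → Bool ⊕ Option γ → Option (Bool × Bool) × List γ := fun q s =>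
    match q, s with
    | some (b, p), .inr (some a) => (some (b, p), if b = p then [a] else [])
    | some (b, _), .inr none => (some (b, false), [])
    | none, .inl b => (some (b, true), [])
    | q, _ => (q, [])
  have key : ∀ (b p : Bool) (l : List γ) (l' : List (Bool ⊕ Option γ)),
      CompGame.fstRun δ (fun _ => []) (some (b, p)) (l.map (fun a => .inr (some a)) ++ l') =
        (if b = p then l else []) ++ CompGame.fstRun δ (fun _ => []) (some (b, p)) l' := by
    intro b p l l'
    induction l with
    | nil => simp
    | cons a l ih =>
      simp only [List.map_cons, List.cons_append, CompGame.fstRun, δ] at ih ⊢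
      rw [ih]
      split_ifs <;> simp
  have h1 := ((hc.map (γ := Bool ⊕ Option γ) .inl).append
    ((hf.map (γ := Bool ⊕ Option γ) fun a => .inr (some a)).append
    ((const u [Sum.inr none]).append (hg.map (γ := Bool ⊕ Option γ) fun a => .inr (some a)))))
  have h2 := h1.fstRun δ (fun _ => []) none
  convert h2 using 2 with x
  simp only [List.map_cons, List.map_nil, List.cons_append, List.nil_append, CompGame.fstRun]
  change _ = [] ++ CompGame.fstRun δ (fun _ => []) (some (c x, true)) _
  rw [List.nil_append, key]
  simp only [CompGame.fstRun]
  change _ = _ ++ ([] ++ CompGame.fstRun δ (fun _ => []) (some (c x, false)) _)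
  rw [← List.append_nil ((g x).map _), key]
  cases c x <;> simp [CompGame.fstRun]

end PT

/-! ### Tuples -/

theorem encTuple_cons (w : Str) (x : List Str) :
    encTuple (w :: x) = w.map some ++ none :: encTuple x := by
  simp [encTuple]

theorem encTuple_length_cons (w : Str) (x : List Str) :
    (encTuple (w :: x)).length = w.length + 1 + (encTuple x).length := by
  simp [encTuple_cons]
  omega

namespace PT

variable {X : Type*} {α β γ : Type} [Fintype α] {u : X → List α}

theorem enc_cons {f : X → Str} {T : X → List Str} (hf : PT u f)
    (hT : PT u fun x => encTuple (T x)) : PT u fun x => encTuple (f x :: T x) := by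
  have := ((hf.map some).append (const u [none])).append hT
  simpa [encTuple_cons] using this

theorem enc_nil : PT u fun _ => encTuple [] := const u _

theorem poly {g : List Str → Str} (hg : IsPolyTime g) {T : X → List Str}
    (hT : PT u fun x => encTuple (T x)) : PT u fun x => g (T x) :=
  hT.comp ((isPolyTime_iff.1 hg).reindex T)

theorem head {T : X → List Str} (hT : PT u fun x => encTuple (T x)) :
    PT u fun x => (T x).headD [] := by
  let δ : Bool → Option Bool → Bool × List Bool := fun q s => match q, s with
    | false, some b => (false, [b])
    | _, _ => (true, [])
  have key : ∀ l : List (Option Bool), CompGame.fstRun δ (fun _ => []) true l = [] := by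
    intro l
    induction l with
    | nil => rfl
    | cons a l ih => simpa [CompGame.fstRun, δ] using ih
  have key' : ∀ (w : Str) (l : List (Option Bool)),
      CompGame.fstRun δ (fun _ => []) false (w.map some ++ none :: l) = w := by
    intro w l
    induction w with
    | nil => simp [CompGame.fstRun, δ, key]
    | cons a w ih => simp only [List.map_cons, List.cons_append, CompGame.fstRun, ih, δ]; rfl
  have := hT.fstRun δ (fun _ => []) false
  convert this using 2 with x
  cases T x with
  | nil => rfl
  | cons w l => simp [encTuple_cons, key']

theorem tail {T : X → List Str} (hT : PT u fun x => encTuple (T x)) :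
    PT u fun x => encTuple (T x).tail := by
  let δ : Bool → Option Bool → Bool × List (Option Bool) := fun q s => match q, s with
    | false, some _ => (false, [])
    | false, none => (true, [])
    | true, s => (true, [s])
  have key : ∀ l : List (Option Bool), CompGame.fstRun δ (fun _ => []) true l = l := by
    intro l
    induction l with
    | nil => rfl
    | cons a l ih => simpa [CompGame.fstRun, δ] using ih
  have key' : ∀ (w : Str) (l : List (Option Bool)),
      CompGame.fstRun δ (fun _ => []) false (w.map some ++ none :: l) = l := by
    intro w l
    induction w with
    | nil => simp [CompGame.fstRun, δ, key]
    | cons a w ih => simp only [List.map_cons, List.cons_append, CompGame.fstRun, ih, δ]; rfl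
  have := hT.fstRun δ (fun _ => []) false
  convert this using 2 with x
  cases T x with
  | nil => rfl
  | cons w l => simp [encTuple_cons, key']

/-- The number of components, in unary. -/
theorem count {T : X → List Str} (hT : PT u fun x => encTuple (T x)) :
    PT u fun x => unary (T x).length := by
  have := hT.flatMap fun s => if s = none then [true] else []
  convert this using 2 with x
  induction T x with
  | nil => rfl
  | cons w l ih =>
    have h : (w.map some).flatMap (fun s : Option Bool => if s = none then [true] else []) = [] := by
      rw [List.flatMap_eq_nil_iff]
      rintro _ hs
      obtain ⟨b, -, rfl⟩ := List.mem_map.1 hs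
      rfl
    rw [encTuple_cons, List.flatMap_append, h, List.flatMap_cons, ← ih]
    simp [unary, List.replicate_succ]

theorem unary_length [Fintype β] {v : X → List β} (h : PT u v) :
    PT u fun x => unary (v x).length := by
  have := h.map fun _ => true
  simpa [unary] using this

/-- Test of equality with a constant. -/
theorem eqConst [Fintype β] [DecidableEq β] {v : X → List β} (h : PT u v) (w : List β) :
    PT u fun x => [decide (v x = w)] := by
  -- One symbol more than `w` has is needed, in order to reject proper extensions of `w`.
  have := h.ofTake (w.length + 1) fun l => [decide (l = w)]
  convert this using 4 with x
  constructor
  · intro h; simp [h]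
  · intro h
    have h1 := congrArg List.length h
    rw [List.length_take] at h1
    rwa [List.take_of_length_le (by omega)] at h

theorem and {c d : X → Bool} (hc : PT u fun x => [c x]) (hd : PT u fun x => [d x]) :
    PT u fun x => [c x && d x] := by
  have := hc.ite hd (const u [false])
  convert this using 2 with x
  cases c x <;> simp

theorem or {c d : X → Bool} (hc : PT u fun x => [c x]) (hd : PT u fun x => [d x]) :
    PT u fun x => [c x || d x] := by
  have := hc.ite (const u [true]) hd
  convert this using 2 with x
  cases c x <;> simp

end PT

/-! ### Two words read in parallel -/

/-- The pairs of corresponding symbols of two words. -/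
def zipPad : List Bool → List Bool → List (Option Bool × Option Bool)
  | [], [] => []
  | x :: a, [] => (some x, none) :: zipPad a []
  | [], y :: b => (none, some y) :: zipPad [] b
  | x :: a, y :: b => (some x, some y) :: zipPad a b

theorem length_zipPad_le (a b : List Bool) : (zipPad a b).length ≤ a.length + b.length := by
  fun_induction zipPad a b <;> simp only [List.length_cons, List.length_nil] at * <;> omega

/-- The automaton that computes `zipPad`. The states are: reading the first word; popping its
next symbol; popping the next symbol of the second word. -/
def zipAutomaton : StackAutomaton (Fin 3) fun _ => Option Bool × Option Bool where
  A := Option Bool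
  Q := Option (Bool ⊕ Option Bool)
  start := some (.inl false)
  reg
    | none => none
    | some (.inl false) => some ⟨0, Prod.fst⟩
    | some (.inl true) => some ⟨1, Prod.fst⟩
    | some (.inr _) => some ⟨0, Prod.fst⟩
  next
    | some (.inl false), some (some x) => (some (.inl false), [⟨1, (some x, none)⟩])
    | some (.inl false), _ => (some (.inl true), [])
    | some (.inl true), o => (some (.inr o.join), [])
    | some (.inr o), o' => if o = none ∧ o'.join = none then (none, [])
        else (some (.inl true), [⟨2, (o, o'.join)⟩])
    | none, _ => (none, [])

/-- The input stack holds one word, the separator `(none, none)`, and the other word. The first is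
transferred, reversed, to stack `1`; the second stays where it is. -/
theorem zipAutomaton_load (a : List Bool) (l l' : List (Option Bool × Option Bool)) :
    zipAutomaton.Reach (2 * a.length + 2) (some (.inl false))
      ![a.map (fun x => (some x, none)) ++ (none, none) :: l, l', []] (some (.inl true))
      ![l, (a.map fun x => (some x, none)).reverse ++ l', []] := by
  induction a generalizing l' with
  | nil =>
    refine StackAutomaton.reach_read (p := ⟨0, Prod.fst⟩) (L := []) rfl rfl ?_
    funext i
    fin_cases i <;> rfl
  | cons x a ih =>
    have h : zipAutomaton.Reach 2 (some (.inl false))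
        ![(x :: a).map (fun x => (some x, none)) ++ (none, none) :: l, l', []] (some (.inl false))
        ![a.map (fun x => (some x, none)) ++ (none, none) :: l, (some x, none) :: l', []] := by
      refine StackAutomaton.reach_read (p := ⟨0, Prod.fst⟩) (L := [⟨1, (some x, none)⟩]) rfl rfl ?_
      funext i
      fin_cases i <;> rfl
    refine (h.trans (ih ((some x, none) :: l'))).congr ?_ ?_
    · simp only [List.length_cons]; omega
    · simp

/-- Symbols are popped alternately from the stacks `1` and `0`, an empty stack supplying `none`. The
loop ends when both are empty, so a round costs four steps and the final, unsuccessful round four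
more. -/
theorem zipAutomaton_zip (a b : List Bool) (l : List (Option Bool × Option Bool)) :
    zipAutomaton.Reach (4 * (zipPad a b).length + 4) (some (.inl true))
      ![b.map (fun x => (some x, none)), a.map (fun x => (some x, none)), l] none
      ![[], [], (zipPad a b).reverse ++ l] := by
  have h1 : ∀ (a : List Bool) b l, zipAutomaton.Reach 2 (some (.inl true))
      ![b, a.map (fun x => (some x, none)), l] (some (.inr a.head?))
      ![b, a.tail.map (fun x => (some x, none)), l] := by
    intro a b l
    refine StackAutomaton.reach_read (p := ⟨1, Prod.fst⟩) (L := []) rfl ?_ ?_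
    · cases a <;> rfl
    · funext i
      fin_cases i
      · rfl
      · cases a <;> rfl
      · rfl
  have h2 : ∀ (o : Option Bool) (b : List Bool) a l, (o ≠ none ∨ b ≠ []) →
      zipAutomaton.Reach 2 (some (.inr o))
      ![b.map (fun x => (some x, none)), a, l] (some (.inl true))
      ![b.tail.map (fun x => (some x, none)), a, (o, b.head?) :: l] := by
    intro o b a l h
    refine StackAutomaton.reach_read (p := ⟨0, Prod.fst⟩) (L := [⟨2, (o, b.head?)⟩]) rfl ?_ ?_
    · cases b <;> simp_all [zipAutomaton]
    · funext i
      fin_cases i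
      · cases b <;> rfl
      · rfl
      · cases b <;> rfl
  have h3 : ∀ (a b : List Bool) l, (a ≠ [] ∨ b ≠ []) → zipAutomaton.Reach 4 (some (.inl true))
      ![b.map (fun x => (some x, none)), a.map (fun x => (some x, none)), l] (some (.inl true))
      ![b.tail.map (fun x => (some x, none)), a.tail.map (fun x => (some x, none)),
        (a.head?, b.head?) :: l] :=
    fun a b l h => (h1 a _ l).trans (h2 a.head? b _ l (by simpa using h))
  fun_induction zipPad a b generalizing l with
  | case1 =>
    refine (h1 [] [] l).trans (StackAutomaton.reach_read (p := ⟨0, Prod.fst⟩) (L := []) rfl rfl ?_)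
    funext i
    fin_cases i <;> rfl
  | case2 x a ih =>
    refine ((h3 (x :: a) [] l (by simp)).trans (ih _)).congr ?_ ?_
    · simp only [List.length_cons]; omega
    · simp
  | case3 y b ih =>
    refine ((h3 [] (y :: b) l (by simp)).trans (ih _)).congr ?_ ?_
    · simp only [List.length_cons]; omega
    · simp
  | case4 x a y b ih =>
    refine ((h3 (x :: a) (y :: b) l (by simp)).trans (ih _)).congr ?_ ?_
    · simp only [List.length_cons]; omega
    · simp

/-! ### Multiplication in unary -/

/-- The automaton that multiplies in unary. The states are: reading the first factor, popping a
symbol of it, copying the second factor, restoring it, cleaning up. -/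
def mulAutomaton : StackAutomaton (Fin 4) fun _ => Bool where
  A := Bool
  Q := Option (Fin 5)
  start := some 0
  reg := Option.map ![⟨0, id⟩, ⟨1, id⟩, ⟨0, id⟩, ⟨2, id⟩, ⟨0, id⟩]
  next
    | some 0, some true => (some 0, [⟨1, true⟩])
    | some 0, _ => (some 1, [])
    | some 1, some _ => (some 2, [])
    | some 1, none => (some 4, [])
    | some 2, some _ => (some 2, [⟨2, true⟩, ⟨3, true⟩])
    | some 2, none => (some 3, [])
    | some 3, some _ => (some 3, [⟨0, true⟩])
    | some 3, none => (some 1, [])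
    | some 4, some _ => (some 4, [])
    | some 4, none => (none, [])
    | none, _ => (none, [])

/-- The stacks of `mulAutomaton`. -/
def mulStacks (w : List Bool) (a b c : ℕ) : Fin 4 → List Bool := ![w, unary a, unary b, unary c]

/-- The symbol `false` separates the two unary factors; the first goes to stack `1`, the second
stays on stack `0`. -/
theorem mulAutomaton_load (m a : ℕ) (w : List Bool) :
    mulAutomaton.Reach (2 * m + 2) (some 0) (mulStacks (unary m ++ false :: w) a 0 0) (some 1)
      (mulStacks w (m + a) 0 0) := by
  induction m generalizing a with
  | zero =>
    refine StackAutomaton.reach_read (p := ⟨0, id⟩) (L := []) rfl rfl ?_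
    funext i
    fin_cases i
    · rfl
    · simp [mulStacks, pushAll]
    · rfl
    · rfl
  | succ m ih =>
    have h : mulAutomaton.Reach 2 (some 0) (mulStacks (unary (m + 1) ++ false :: w) a 0 0)
        (some 0) (mulStacks (unary m ++ false :: w) (a + 1) 0 0) := by
      refine StackAutomaton.reach_read (p := ⟨0, id⟩) (L := [⟨1, true⟩]) rfl rfl ?_
      funext i
      fin_cases i <;> rfl
    exact (h.trans (ih (a + 1))).congr (by omega) (by rw [Nat.add_right_comm, Nat.add_assoc])

theorem mulAutomaton_copy (n a b c : ℕ) :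
    mulAutomaton.Reach (2 * n + 2) (some 2) (mulStacks (unary n) a b c) (some 3)
      (mulStacks [] a (n + b) (n + c)) := by
  induction n generalizing b c with
  | zero =>
    refine StackAutomaton.reach_read (p := ⟨0, id⟩) (L := []) rfl rfl ?_
    funext i
    fin_cases i <;> simp [mulStacks, pushAll, unary]
  | succ n ih =>
    have h : mulAutomaton.Reach 2 (some 2) (mulStacks (unary (n + 1)) a b c)
        (some 2) (mulStacks (unary n) a (b + 1) (c + 1)) := by
      refine StackAutomaton.reach_read (p := ⟨0, id⟩) (L := [⟨2, true⟩, ⟨3, true⟩]) rfl rfl ?_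
      funext i
      fin_cases i <;> rfl
    exact (h.trans (ih (b + 1) (c + 1))).congr (by omega) (by
      rw [Nat.add_right_comm n 1 b, Nat.add_assoc n b, Nat.add_right_comm n 1 c, Nat.add_assoc n c])

theorem mulAutomaton_restore (m n a c : ℕ) :
    mulAutomaton.Reach (2 * n + 2) (some 3) (mulStacks (unary m) a n c) (some 1)
      (mulStacks (unary (n + m)) a 0 c) := by
  induction n generalizing m with
  | zero =>
    refine StackAutomaton.reach_read (p := ⟨2, id⟩) (L := []) rfl rfl ?_
    funext i
    fin_cases i <;> simp [mulStacks, pushAll, unary]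
  | succ n ih =>
    have h : mulAutomaton.Reach 2 (some 3) (mulStacks (unary m) a (n + 1) c)
        (some 3) (mulStacks (unary (m + 1)) a n c) := by
      refine StackAutomaton.reach_read (p := ⟨2, id⟩) (L := [⟨0, true⟩]) rfl rfl ?_
      funext i
      fin_cases i <;> rfl
    exact (h.trans (ih (m + 1))).congr (by omega) (by rw [Nat.add_right_comm, Nat.add_assoc])

theorem mulAutomaton_clean (n c : ℕ) :
    mulAutomaton.Reach (2 * n + 2) (some 4) (mulStacks (unary n) 0 0 c) none
      (mulStacks [] 0 0 c) := by
  induction n with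
  | zero =>
    refine StackAutomaton.reach_read (p := ⟨0, id⟩) (L := []) rfl rfl ?_
    funext i
    fin_cases i <;> simp [mulStacks, pushAll, unary]
  | succ n ih =>
    have h : mulAutomaton.Reach 2 (some 4) (mulStacks (unary (n + 1)) 0 0 c)
        (some 4) (mulStacks (unary n) 0 0 c) := by
      refine StackAutomaton.reach_read (p := ⟨0, id⟩) (L := []) rfl rfl ?_
      funext i
      fin_cases i <;> rfl
    exact (h.trans ih).congr (by omega) rfl

/-- For each unit of the first factor, the second is poured from stack `0` to the stacks `2` and `3`
and then restored from stack `2`, in `2 + (2n+2) + (2n+2)` steps; stack `3` accumulates the product.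
The remaining `2n + 4` steps discover that stack `1` is empty and erase the second factor. -/
theorem mulAutomaton_mul (n a c : ℕ) :
    mulAutomaton.Reach (a * (4 * n + 6) + 2 * n + 4) (some 1) (mulStacks (unary n) a 0 c) none
      (mulStacks [] 0 0 (a * n + c)) := by
  induction a generalizing c with
  | zero =>
    have h : mulAutomaton.Reach 2 (some 1) (mulStacks (unary n) 0 0 c) (some 4)
        (mulStacks (unary n) 0 0 c) := by
      refine StackAutomaton.reach_read (p := ⟨1, id⟩) (L := []) rfl rfl ?_
      funext i
      fin_cases i <;> rfl
    exact (h.trans (mulAutomaton_clean n c)).congr (by omega) (by simp)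
  | succ a ih =>
    have h : mulAutomaton.Reach 2 (some 1) (mulStacks (unary n) (a + 1) 0 c) (some 2)
        (mulStacks (unary n) a 0 c) := by
      refine StackAutomaton.reach_read (p := ⟨1, id⟩) (L := []) rfl rfl ?_
      funext i
      fin_cases i <;> rfl
    have := ((h.trans (mulAutomaton_copy n a 0 c)).trans
      (mulAutomaton_restore 0 n a (n + c))).trans (ih (n + c))
    have e : a * n + (n + c) = (a + 1) * n + c := by ring
    rw [e] at this
    refine this.mono ?_
    ring_nf
    omega

namespace PT

variable {X : Type*} {α : Type} [Fintype α] {u : X → List α}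

theorem zipPad {a b : X → List Bool} (ha : PT u a) (hb : PT u b) :
    PT u fun x => zipPad (a x) (b x) := by
  -- The first word is reversed in advance because loading reverses it.
  have h1 : PT u fun x => (a x).reverse.map (fun s => (some s, (none : Option Bool))) ++
      ((none, none) :: (b x).map fun s => (some s, none)) := by
    have := (ha.reverse.map (fun s => (some s, (none : Option Bool)))).append
      ((const u [(none, none)]).append (hb.map fun s => (some s, none)))
    simpa using this
  have h2 : PT (fun x => (a x).reverse.map (fun s => (some s, (none : Option Bool))) ++
      ((none, none) :: (b x).map fun s => (some s, none)))
      fun x => (CompGame.zipPad (a x) (b x)).reverse := by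
    refine ⟨Fin 3, inferInstance, inferInstance, fun _ => Option Bool × Option Bool,
      zipAutomaton.toComp, 0, 2, Equiv.refl _, Equiv.refl _, 6 * Polynomial.X + 10, fun x => ?_⟩
    have r := zipAutomaton_zip (a x) (b x) []
    have r' := zipAutomaton_load (a x).reverse ((b x).map fun s => (some s, none)) []
    rw [List.map_reverse, List.reverse_reverse, List.append_nil] at r'
    refine ((r'.trans r).runs rfl).congr ?_ ?_ ?_
    · have := length_zipPad_le (a x) (b x)
      simp
      omega
    · funext i
      fin_cases i <;> simp [single]
    · funext i
      fin_cases i <;> simp [single]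
  simpa only [List.reverse_reverse] using (h1.comp h2).reverse

theorem mul {a b : X → ℕ} (ha : PT u fun x => unary (a x)) (hb : PT u fun x => unary (b x)) :
    PT u fun x => unary (a x * b x) := by
  have h1 : PT u fun x => unary (a x) ++ (false :: unary (b x)) := by
    simpa using ha.append ((const u [false]).append hb)
  have h2 : PT (fun x => unary (a x) ++ (false :: unary (b x))) fun x => unary (a x * b x) := by
    refine ⟨Fin 4, inferInstance, inferInstance, fun _ => Bool,
      mulAutomaton.toComp, 0, 3, Equiv.refl _, Equiv.refl _,
      Polynomial.X * (4 * Polynomial.X + 6) + 4 * Polynomial.X + 10, fun x => ?_⟩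
    have r := ((mulAutomaton_load (a x) 0 (unary (b x))).trans
      (mulAutomaton_mul (b x) (a x) 0)).runs rfl
    refine r.congr ?_ ?_ ?_
    · have h1 : a x ≤ (unary (a x) ++ (false :: unary (b x))).length := by simp [unary]
      have h2 : b x ≤ (unary (a x) ++ (false :: unary (b x))).length := by simp [unary]; omega
      have h3 := Nat.mul_le_mul h1 (Nat.add_le_add_right (Nat.mul_le_mul_left 4 h2) 6)
      simp only [Polynomial.eval_add, Polynomial.eval_mul, Polynomial.eval_X,
        Polynomial.eval_ofNat]
      omega
    · funext i
      fin_cases i <;> simp [single, mulStacks, unary]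
    · funext i
      fin_cases i <;> simp [single, mulStacks, unary]
  exact h1.comp h2

/-- In unary a sum is a concatenation, so only products need a machine of their own. -/
theorem polynomial {a : X → ℕ} (ha : PT u fun x => unary (a x)) (p : Polynomial ℕ) :
    PT u fun x => unary (p.eval (a x)) := by
  induction p using Polynomial.induction_on' with
  | add p q hp hq =>
    simpa only [unary, Polynomial.eval_add, List.replicate_add] using hp.append hq
  | monomial k c =>
    simp only [Polynomial.eval_monomial]
    refine (const u (unary c)).mul ?_
    induction k with
    | zero => simpa using const u (unary 1)
    | succ k ih => simpa only [pow_succ] using ih.mul ha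

theorem take {a b : X → List Bool} (ha : PT u a) (hb : PT u b) :
    PT u fun x => (a x).take (b x).length := by
  have := (ha.zipPad hb).flatMap fun p => if p.2 = none then [] else p.1.toList
  convert this using 2 with x
  induction a x, b x using CompGame.zipPad.induct with
  | case1 => simp [CompGame.zipPad]
  | case2 y a ih => simpa [CompGame.zipPad] using ih
  | case3 y b ih => simpa [CompGame.zipPad] using ih
  | case4 y a z b ih => simpa [CompGame.zipPad] using ih

/-- When the two words are read in parallel, `a` is longer if and only if the symbol of `b` is
missing in some pair. -/
theorem length_le {a b : X → List Bool} (ha : PT u a) (hb : PT u b) :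
    PT u fun x => [decide ((a x).length ≤ (b x).length)] := by
  have := ((ha.zipPad hb).flatMap fun p => if p.2 = none then [true] else []).eqConst []
  convert this using 4 with x
  induction a x, b x using CompGame.zipPad.induct with
  | case1 => simp [CompGame.zipPad]
  | case2 y a ih => simp [CompGame.zipPad]
  | case3 y b ih => simpa [CompGame.zipPad] using ih
  | case4 y a z b ih => simpa [CompGame.zipPad] using ih

end PT

/-- Comparison of the binary fractions given by two words, up to the length of the shorter. -/
def ltList : List Bool → List Bool → Bool
  | x :: t, y :: w => if x = y then ltList t w else y
  | _, _ => false

theorem PT.ltList {X : Type*} {α : Type} [Fintype α] {u : X → List α} {a b : X → List Bool}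
    (ha : PT u a) (hb : PT u b) : PT u fun x => [ltList (a x) (b x)] := by
  -- State `none` means no difference so far; `some y` keeps the verdict of the first difference.
  -- Without a difference the answer is `false`.
  let δ : Option Bool → Option Bool × Option Bool → Option Bool × List Bool := fun q p =>
    (match q, p with
    | none, (some x, some y) => if x = y then none else some y
    | q, _ => q, [])
  have h0 : ∀ b l, CompGame.fstRun δ (fun q => [q.getD false]) (some b) l = [b] := by
    intro b l
    induction l with
    | nil => rfl
    | cons p l ih => simpa [CompGame.fstRun, δ] using ih
  have h1 : ∀ a b : List Bool, CompGame.fstRun δ (fun q => [q.getD false]) none (CompGame.zipPad a b) =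
      [CompGame.ltList a b] := by
    intro a b
    fun_induction CompGame.zipPad a b with
    | case1 => rfl
    | case2 x a ih => cases a <;> simpa [CompGame.fstRun, δ, CompGame.ltList] using ih
    | case3 y b ih => cases b <;> simpa [CompGame.fstRun, δ, CompGame.ltList] using ih
    | case4 x a y b ih =>
      by_cases h : x = y
      · simpa [CompGame.fstRun, δ, CompGame.ltList, h] using ih
      · simp [CompGame.fstRun, δ, CompGame.ltList, h, h0]
  simpa only [h1] using (ha.zipPad hb).fstRun δ (fun q => [q.getD false]) none

/-! ### Probabilistic polynomial time -/

theorem Steps.halt_unique {K : Type} [DecidableEq K] {Γ : K → Type} {Λ σ : Type}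
    {M : Λ → TM2.Stmt Γ Λ σ} {m n : ℕ} {a : TM2.Cfg Γ Λ σ} {v w : σ} {S T : ∀ k, List (Γ k)}
    (h : Steps (TM2.step M) m a ⟨none, v, S⟩) (h' : Steps (TM2.step M) n a ⟨none, w, T⟩) :
    S = T := by
  induction m generalizing a n with
  | zero =>
    cases h
    cases n with
    | zero => cases h'; rfl
    | succ n => obtain ⟨c, hc, -⟩ := h'; simp [TM2.step] at hc
  | succ m ih =>
    obtain ⟨c, hc, h⟩ := h
    cases n with
    | zero => cases h'; simp [TM2.step] at hc
    | succ n =>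
      obtain ⟨d, hd, h'⟩ := h'
      rw [hc] at hd
      cases hd
      exact ih h h'

/-- The machine is deterministic and sees only the word `u x`. -/
theorem PT.congr {X : Type*} {α β : Type} {u : X → List α} {v : X → List β} (h : PT u v)
    {x y : X} (hxy : u x = u y) : v x = v y := by
  obtain ⟨K, i₁, i₂, Γ, c, k₀, k₁, e₀, e₁, p, h⟩ := h
  obtain ⟨m, -, hm⟩ := h x
  obtain ⟨n, -, hn⟩ := h y
  rw [hxy] at hm
  have := congrFun (hm.halt_unique hn) k₁
  rw [single_self, single_self] at this
  exact List.map_injective_iff.2 e₁.symm.injective this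

@[simp] theorem length_tapePrefix (r : Tape) (m : ℕ) : (tapePrefix r m).length = m := by
  simp [tapePrefix]

theorem tapePrefix_succ (r : Tape) (m : ℕ) :
    tapePrefix r (m + 1) = r 0 :: tapePrefix (fun n => r (n + 1)) m := by
  simp [tapePrefix, List.ofFn_succ]

theorem take_tapePrefix (r : Tape) {m n : ℕ} (h : m ≤ n) :
    (tapePrefix r n).take m = tapePrefix r m := by
  apply List.ext_getElem
  · simpa using h
  · intro i h1 h2
    simp [tapePrefix]

theorem tapePrefix_getD (w : Str) : tapePrefix (fun n => w.getD n false) w.length = w := by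
  apply List.ext_getElem
  · simp
  · intro i h1 h2
    simp [tapePrefix]

/-- The input `x` with `q(|x|)` random bits. -/
def tapeWord (q : Polynomial ℕ) (p : List Str × Tape) : List (Option Bool) :=
  encTuple (tapePrefix p.2 (q.eval (encTuple p.1).length) :: p.1)

/-- The function can be computed in polynomial time from the input and any sufficiently large
polynomial number of random bits. -/
def RandPoly {β : Type} (v : List Str × Tape → List β) : Prop :=
  ∃ q, ∀ q', PT (tapeWord (q + q')) v

theorem tapeWord_input (q : Polynomial ℕ) : PT (tapeWord q) fun p => encTuple p.1 :=
  PT.tail (PT.refl (tapeWord q))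

theorem tapeWord_tape (q : Polynomial ℕ) :
    PT (tapeWord q) fun p => tapePrefix p.2 (q.eval (encTuple p.1).length) :=
  PT.head (PT.refl (tapeWord q))

theorem tapeWord_prefix {q : Polynomial ℕ} {n : List Str × Tape → ℕ}
    (hn : PT (tapeWord q) fun p => unary (n p)) (h : ∀ p, n p ≤ q.eval (encTuple p.1).length) :
    PT (tapeWord q) fun p => tapePrefix p.2 (n p) := by
  have := (tapeWord_tape q).take hn
  convert this using 2 with p
  rw [unary, List.length_replicate, take_tapePrefix _ (h p)]

/-- Superfluous random bits can be cut off, since the number `q(|x|)` of bits to keep is computable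
in unary. -/
theorem tapeWord_mono (q q' : Polynomial ℕ) : PT (tapeWord (q + q')) (tapeWord q) := by
  refine PT.enc_cons (tapeWord_prefix ?_ fun p => ?_) (tapeWord_input _)
  · exact (tapeWord_input _).unary_length.polynomial q
  · simp

theorem PT.randPoly {β : Type} {q : Polynomial ℕ} {v : List Str × Tape → List β}
    (h : PT (tapeWord q) v) : RandPoly v :=
  ⟨q, fun q' => (tapeWord_mono q q').comp h⟩

/-- `IsPPT` asks for a machine defined on all tuples, also on those whose first component has the
wrong length for a tape prefix. These are normalized before the given machine is applied. -/
theorem RandPoly.isPPT {A : List Str → Tape → Str} (h : RandPoly fun p => A p.1 p.2) :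
    IsPPT A := by
  obtain ⟨q, h⟩ := h
  have h := h 0
  rw [add_zero] at h
  let m : List Str → ℕ := fun y => q.eval (encTuple y.tail).length
  -- The first component, padded with zeros or cut to exactly `m y` bits.
  let w : List Str → Str := fun y => (y.headD [] ++ List.replicate (m y) false).take (m y)
  have hw : ∀ y, (w y).length = m y := fun y => by simp [w]
  let F : List Str → List Str × Tape := fun y => (y.tail, fun n => (w y).getD n false)
  have hF : ∀ y, tapeWord q (F y) = encTuple (w y :: y.tail) := by
    intro y
    have := tapePrefix_getD (w y)
    rw [hw] at this
    simp only [tapeWord, F]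
    rw [this]
  refine ⟨q, fun y => A (F y).1 (F y).2, ?_, fun x r => ?_⟩
  · rw [isPolyTime_iff]
    have h1 : PT encTuple fun y => encTuple (w y :: y.tail) := by
      have ht : PT encTuple fun y : List Str => encTuple y.tail :=
        PT.tail (T := fun y => y) (PT.refl _)
      have hm : PT encTuple fun y => unary (m y) := ht.unary_length.polynomial q
      refine PT.enc_cons ?_ ht
      have := ((PT.head (T := fun y => y) (PT.refl _)).append (hm.map fun _ => false)).take hm
      simpa [unary, w] using this
    exact h1.comp (by simpa only [hF] using h.reindex F)
  · have : tapeWord q (x, r) = tapeWord q (F (tapePrefix r (q.eval (encTuple x).length) :: x)) := by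
      rw [hF]
      simp [tapeWord, w, m, List.take_append, List.take_of_length_le]
    -- The infinite tape enters `A` only through the prefix in `tapeWord`, so it may be replaced by
    -- the prefix followed by zeros.
    exact h.congr this

namespace RandPoly

variable {β γ δ : Type}

theorem map₁ {v : List Str × Tape → List β} {w : List Str × Tape → List γ} (hv : RandPoly v)
    (h : ∀ q, PT (tapeWord q) v → PT (tapeWord q) w) : RandPoly w := by
  obtain ⟨q, hv⟩ := hv
  exact ⟨q, fun q' => h _ (hv q')⟩

theorem map₂ {v : List Str × Tape → List β} {w : List Str × Tape → List γ}
    {z : List Str × Tape → List δ} (hv : RandPoly v) (hw : RandPoly w)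
    (h : ∀ q, PT (tapeWord q) v → PT (tapeWord q) w → PT (tapeWord q) z) : RandPoly z := by
  obtain ⟨q, hv⟩ := hv
  obtain ⟨q', hw⟩ := hw
  refine ⟨q + q', fun q'' => h _ ?_ ?_⟩
  · rw [add_assoc]
    exact hv _
  · rw [add_comm q, add_assoc]
    exact hw _

theorem input : RandPoly fun p => encTuple p.1 := ⟨0, fun _ => tapeWord_input _⟩

theorem const [Fintype β] (l : List β) : RandPoly fun _ => l := ⟨0, fun _ => PT.const _ _⟩

theorem enc_cons {f : List Str × Tape → Str} {T : List Str × Tape → List Str} (hf : RandPoly f)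
    (hT : RandPoly fun p => encTuple (T p)) : RandPoly fun p => encTuple (f p :: T p) :=
  hf.map₂ hT fun _ => PT.enc_cons

theorem head {T : List Str × Tape → List Str} (hT : RandPoly fun p => encTuple (T p)) :
    RandPoly fun p => (T p).headD [] :=
  hT.map₁ fun _ => PT.head

theorem tail {T : List Str × Tape → List Str} (hT : RandPoly fun p => encTuple (T p)) :
    RandPoly fun p => encTuple (T p).tail :=
  hT.map₁ fun _ => PT.tail

theorem poly {g : List Str → Str} (hg : IsPolyTime g) {T : List Str × Tape → List Str}
    (hT : RandPoly fun p => encTuple (T p)) : RandPoly fun p => g (T p) :=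
  hT.map₁ fun _ => PT.poly hg

theorem ite [Fintype γ] {c : List Str × Tape → Bool} {f g : List Str × Tape → List γ}
    (hc : RandPoly fun p => [c p]) (hf : RandPoly f) (hg : RandPoly g) :
    RandPoly fun p => if c p then f p else g p := by
  -- `map₂` combines two computations; three are combined as the concatenation of two halves, one of
  -- which is empty.
  have : RandPoly fun p => (if c p then f p else []) :=
    hc.map₂ hf fun _ h h' => h.ite h' (PT.const _ _)
  have h' : RandPoly fun p => (if c p then [] else g p) :=
    hc.map₂ hg fun _ h h' => h.ite (PT.const _ _) h'
  have := this.map₂ h' fun _ h h' => h.append h'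
  convert this using 2 with p
  cases c p <;> simp

/-- Random bits, as many as can be computed in unary. -/
theorem tapePrefix {n : List Str × Tape → ℕ} (hn : RandPoly fun p => unary (n p)) :
    RandPoly fun p => tapePrefix p.2 (n p) := by
  obtain ⟨q, hn⟩ := hn
  obtain ⟨b, hb⟩ := (hn 0).exists_length_le
  -- The input word of the machine for `n` consists of `q(|x|)` random bits, a separator and `x`.
  -- This bounds `n` by a polynomial in `|x|`, which is then taken as the number of additional
  -- random bits.
  have hL : ∀ p, n p ≤ ((b.comp (q + 1 + Polynomial.X))).eval (encTuple p.1).length := by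
    intro p
    have := hb p
    simp only [unary, List.length_replicate, add_zero, tapeWord, encTuple_length_cons,
      length_tapePrefix] at this
    simpa using this
  exact (tapeWord_prefix (hn (b.comp (q + 1 + Polynomial.X))) fun p => (hL p).trans
    (by simp)).randPoly

end RandPoly

/-- The bits of the tape at even positions. -/
def evenTape (r : Tape) : Tape := fun n => r (2 * n)

/-- The bits of the tape at odd positions. -/
def oddTape (r : Tape) : Tape := fun n => r (2 * n + 1)

theorem PT.alternate {X : Type*} {α : Type} [Fintype α] {u : X → List α} {n : X → ℕ}
    {r : X → Tape} (h : PT u fun x => tapePrefix (r x) (2 * n x)) :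
    (PT u fun x => tapePrefix (evenTape (r x)) (n x)) ∧
      PT u fun x => tapePrefix (oddTape (r x)) (n x) := by
  -- `c` is the parity of the positions kept, `q` the parity of the current position.
  let δ : Bool → Bool → Bool → Bool × List Bool := fun c q b => (!q, if q = c then [b] else [])
  have key : ∀ (n : ℕ) (r : Tape), CompGame.fstRun (δ false) (fun _ => []) false
      (tapePrefix r (2 * n)) = tapePrefix (evenTape r) n ∧
      CompGame.fstRun (δ true) (fun _ => []) false
      (tapePrefix r (2 * n)) = tapePrefix (oddTape r) n := by
    intro n
    induction n with
    | zero => intro r; exact ⟨rfl, rfl⟩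
    | succ n ih =>
      intro r
      obtain ⟨h1, h2⟩ := ih fun n => r (n + 1 + 1)
      rw [Nat.mul_succ, tapePrefix_succ, tapePrefix_succ, tapePrefix_succ, tapePrefix_succ]
      simp only [CompGame.fstRun, δ, Bool.not_false, Bool.not_true, if_true] at h1 h2 ⊢
      exact ⟨by rw [h1]; rfl, by rw [h2]; rfl⟩
  exact ⟨by simpa only [key] using h.fstRun (δ false) (fun _ => []) false,
    by simpa only [key] using h.fstRun (δ true) (fun _ => []) false⟩

namespace RandPoly

theorem tapePrefix_two {n : List Str × Tape → ℕ} (hn : RandPoly fun p => unary (n p)) :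
    RandPoly fun p => CompGame.tapePrefix p.2 (2 * n p) :=
  RandPoly.tapePrefix (hn.map₁ fun _ h => (PT.const _ (unary 2)).mul h)

theorem evenPrefix {n : List Str × Tape → ℕ} (hn : RandPoly fun p => unary (n p)) :
    RandPoly fun p => CompGame.tapePrefix (evenTape p.2) (n p) :=
  (tapePrefix_two hn).map₁ fun _ h => h.alternate.1

theorem oddPrefix {n : List Str × Tape → ℕ} (hn : RandPoly fun p => unary (n p)) :
    RandPoly fun p => CompGame.tapePrefix (oddTape p.2) (n p) :=
  (tapePrefix_two hn).map₁ fun _ h => h.alternate.2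

/-- Calls of a probabilistic machine with a part of the random tape. -/
theorem call {A : List Str → Tape → Str} (hA : IsPPT A) {φ : Tape → Tape}
    (hφ : ∀ n : List Str × Tape → ℕ, RandPoly (fun p => unary (n p)) →
      RandPoly fun p => CompGame.tapePrefix (φ p.2) (n p))
    {T : List Str × Tape → List Str} (hT : RandPoly fun p => encTuple (T p)) :
    RandPoly fun p => A (T p) (φ p.2) := by
  obtain ⟨q, g, hg, e⟩ := hA
  simp only [e]
  refine poly hg (enc_cons (hφ _ ?_) hT)
  exact hT.map₁ fun _ h => h.unary_length.polynomial q

theorem ltList {a b : List Str × Tape → List Bool} (ha : RandPoly a) (hb : RandPoly b) :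
    RandPoly fun p => [CompGame.ltList (a p) (b p)] :=
  ha.map₂ hb fun _ => PT.ltList

end RandPoly

/-- The first `i < m` with `p i`, or `m` if there is none. -/
def pick : ℕ → (ℕ → Bool) → ℕ
  | 0, _ => 0
  | m + 1, p => if p 0 then 0 else pick m (fun i => p (i + 1)) + 1

theorem RandPoly.pick {γ : Type} [Fintype γ] (m : ℕ) (c : ℕ → List Str × Tape → Bool)
    (hc : ∀ i, RandPoly fun p => [c i p]) (F : ℕ → List γ) :
    RandPoly fun p => F (CompGame.pick m fun i => c i p) := by
  induction m generalizing c F with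
  | zero => exact RandPoly.const (F 0)
  | succ m ih =>
    have := (hc 0).ite (RandPoly.const (F 0)) (ih (fun i => c (i + 1)) (fun i => hc _)
      fun i => F (i + 1))
    convert this using 2 with p
    rw [CompGame.pick]
    split_ifs <;> rfl

theorem IsPolyTime.isPPT {g : List Str → Str} (hg : IsPolyTime g) : IsPPT fun x _ => g x :=
  RandPoly.isPPT (RandPoly.poly hg RandPoly.input)

/-! ### Negligible functions -/

theorem negligible_zero : Negligible 0 :=
  ⟨fun _ => le_rfl, fun c => (Filter.eventually_gt_atTop 0).mono fun k hk => by
    simp only [Pi.zero_apply]; positivity⟩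

theorem Negligible.mono {ε δ : ℕ → ℝ} (h : Negligible ε) (h0 : ∀ k, 0 ≤ δ k)
    (hle : ∀ k, δ k ≤ ε k) : Negligible δ :=
  ⟨h0, fun c => (h.2 c).mono fun k hk => (hle k).trans_lt hk⟩

/-- Eventually `a < k`, so the factor costs only one power of `k`. -/
theorem Negligible.const_mul {ε : ℕ → ℝ} (h : Negligible ε) {a : ℝ} (ha : 0 ≤ a) :
    Negligible fun k => a * ε k := by
  refine ⟨fun k => mul_nonneg ha (h.1 k), fun c => ?_⟩
  obtain ⟨N, hN⟩ := exists_nat_gt a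
  filter_upwards [h.2 (c + 1), Filter.eventually_ge_atTop (N + 1)] with k hk hkN
  have hk0 : (0 : ℝ) < k := by exact_mod_cast (by omega : 0 < k)
  have hka : a < k := hN.trans_le (by exact_mod_cast (by omega : N ≤ k))
  calc a * ε k ≤ k * ε k := by have := h.1 k; gcongr
    _ < k * (1 / (k : ℝ) ^ (c + 1)) := by gcongr
    _ = 1 / (k : ℝ) ^ c := by rw [pow_succ]; field_simp

theorem Negligible.add {ε δ : ℕ → ℝ} (h : Negligible ε) (h' : Negligible δ) :
    Negligible fun k => ε k + δ k := by
  have h2 := h.const_mul (a := 2) (by norm_num)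
  have h2' := h'.const_mul (a := 2) (by norm_num)
  refine ⟨fun k => add_nonneg (h.1 k) (h'.1 k), fun c => ?_⟩
  filter_upwards [h2.2 c, h2'.2 c] with k hk hk'
  linarith

theorem Negligible.sum {ι : Type*} (s : Finset ι) {ε : ι → ℕ → ℝ} (h : ∀ i, Negligible (ε i)) :
    Negligible fun k => ∑ i ∈ s, ε i k := by
  classical
  induction s using Finset.induction_on with
  | empty => exact negligible_zero.mono (by simp) (by simp)
  | insert i s hi ih => simpa only [Finset.sum_insert hi] using (h i).add ih

/-! ### Coin tosses -/

instance : IsProbabilityMeasure coin := by unfold coin; infer_instance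

theorem measurableSet_prefix (m : ℕ) (P : Str → Prop) :
    MeasurableSet {r : Tape | P (tapePrefix r m)} := by
  have : Measurable fun (r : Tape) (j : Fin m) => r j := by fun_prop
  exact this (Set.toFinite {f : Fin m → Bool | P (List.ofFn f)}).measurableSet

theorem IsPPT.measurableSet {A : List Str → Tape → Str} (hA : IsPPT A) (x : List Str)
    (P : Str → Prop) : MeasurableSet {r | P (A x r)} := by
  obtain ⟨q, g, -, h⟩ := hA
  simp only [h]
  exact measurableSet_prefix _ fun w => P (g (w :: x))

/-- Disjoint families of coin tosses are independent: glueing two independent families gives the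
right value on every box, and boxes determine the infinite product measure. -/
theorem coin_join {ι κ : Type} (e : ι ⊕ κ ≃ ℕ) {A : Set (ι → Bool)} {B : Set (κ → Bool)}
    (hA : MeasurableSet A) (hB : MeasurableSet B) :
    coin {r | (fun i => r (e (.inl i))) ∈ A ∧ (fun i => r (e (.inr i))) ∈ B} =
      Measure.infinitePi (fun _ : ι => (PMF.uniformOfFintype Bool).toMeasure) A *
      Measure.infinitePi (fun _ : κ => (PMF.uniformOfFintype Bool).toMeasure) B := by
  set μ := (PMF.uniformOfFintype Bool).toMeasure
  let J : (ι → Bool) × (κ → Bool) → Tape := fun p n => Sum.elim p.1 p.2 (e.symm n)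
  have hJ : Measurable J := by
    refine measurable_pi_lambda _ fun n => ?_
    rcases h : e.symm n with i | i
    · simp only [J, h, Sum.elim_inl]; fun_prop
    · simp only [J, h, Sum.elim_inr]; fun_prop
  have key : ((Measure.infinitePi fun _ : ι => μ).prod (Measure.infinitePi fun _ : κ => μ)).map J
      = coin := by
    refine Measure.eq_infinitePi _ fun s t ht => ?_
    let u := s.map e.symm.toEmbedding
    have hpre : J ⁻¹' Set.pi s t =
        (Set.pi (u.toLeft : Set ι) fun i => t (e (.inl i))) ×ˢ
          (Set.pi (u.toRight : Set κ) fun i => t (e (.inr i))) := by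
      ext p
      simp only [Set.mem_preimage, Set.mem_pi, Set.mem_prod, Finset.mem_coe, J, u]
      constructor
      · intro h
        constructor
        · intro i hi
          have := h (e (.inl i)) (by simpa [Equiv.symm_apply_eq] using hi)
          simpa using this
        · intro i hi
          have := h (e (.inr i)) (by simpa [Equiv.symm_apply_eq] using hi)
          simpa using this
      · rintro ⟨h1, h2⟩ n hn
        rcases h : e.symm n with i | i
        · have hn' : n = e (.inl i) := by rw [← h]; simp
          have := h1 i (by simpa [Equiv.symm_apply_eq, ← hn'] using hn)
          rwa [hn']
        · have hn' : n = e (.inr i) := by rw [← h]; simp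
          have := h2 i (by simpa [Equiv.symm_apply_eq, ← hn'] using hn)
          rwa [hn']
    rw [Measure.map_apply hJ (MeasurableSet.pi s.countable_toSet fun i _ => ht i), hpre,
      Measure.prod_prod, Measure.infinitePi_pi _ fun _ _ => ht _,
      Measure.infinitePi_pi _ fun _ _ => ht _]
    have : ∏ i ∈ s, μ (t i) = ∏ x ∈ u, μ (t (e x)) := by simp [u]
    rw [this, Finset.prod_sum_eq_prod_toLeft_mul_prod_toRight]
  rw [← key, Measure.map_apply hJ, ← Measure.prod_prod]
  · congr 1
    ext p
    simp [J]
  · exact ((measurable_pi_lambda _ fun i => measurable_pi_apply _) hA).inter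
      ((measurable_pi_lambda _ fun i => measurable_pi_apply _) hB)

theorem coin_even_odd {A B : Set Tape} (hA : MeasurableSet A) (hB : MeasurableSet B) :
    coin.real {r | evenTape r ∈ A ∧ oddTape r ∈ B} = coin.real A * coin.real B := by
  have := coin_join Equiv.natSumNatEquivNat hA hB
  rw [measureReal_def, measureReal_def, measureReal_def, ← ENNReal.toReal_mul]
  exact congrArg _ this

theorem coin_cons (b : Bool) {A : Set Tape} (hA : MeasurableSet A) :
    coin.real {r | r 0 = b ∧ (fun n => r (n + 1)) ∈ A} = coin.real A / 2 := by
  have h := coin_join ((Equiv.sumComm Unit ℕ).trans Equiv.natSumPUnitEquivNat)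
    (A := {f | f () = b}) (measurableSet_eq_fun (measurable_pi_apply ()) measurable_const) hA
  have h1 : Measure.infinitePi (fun _ : Unit => (PMF.uniformOfFintype Bool).toMeasure)
      {f | f () = b} = 2⁻¹ := by
    have := Measure.infinitePi_pi (fun _ : Unit => (PMF.uniformOfFintype Bool).toMeasure)
      (s := {()}) (t := fun _ => {b}) fun _ _ => measurableSet_singleton b
    rw [Finset.prod_singleton, PMF.toMeasure_apply_singleton _ _ (measurableSet_singleton b),
      PMF.uniformOfFintype_apply] at this
    convert this using 2
    · ext f
      simp
    · simp
  rw [h1] at h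
  rw [measureReal_def, measureReal_def, div_eq_inv_mul]
  have := congrArg ENNReal.toReal h
  rw [ENNReal.toReal_mul, ENNReal.toReal_inv, ENNReal.toReal_ofNat] at this
  exact this

/-! ### Sampling -/

/-- Whether the binary fraction given by the tape is less than the one given by the word. -/
def ltTape (r : Tape) (w : Str) : Bool := ltList (tapePrefix r w.length) w

theorem ltTape_cons (r : Tape) (b : Bool) (w : Str) :
    ltTape r (b :: w) = if r 0 = b then ltTape (fun n => r (n + 1)) w else b := by
  simp [ltTape, tapePrefix_succ, ltList]

theorem measurableSet_ltTape (w : Str) : MeasurableSet {r | ltTape r w = true} :=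
  measurableSet_prefix w.length fun v => ltList v w = true

/-- Compare the first bits. If the word starts with `0`, the tape must start with `0` and win on the
rest; if it starts with `1`, the tape wins outright with a `0` and on the rest with a `1`. This is
the recursion of `binFrac`. -/
theorem coin_ltTape (w : Str) : coin.real {r | ltTape r w = true} = binFrac w := by
  induction w with
  | nil => simp [ltTape, ltList, tapePrefix, binFrac]
  | cons b w ih =>
    have h1 := coin_cons b (measurableSet_ltTape w)
    cases b with
    | false =>
      have : {r | ltTape r (false :: w) = true} =
          {r | r 0 = false ∧ (fun n => r (n + 1)) ∈ {r | ltTape r w = true}} := by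
        ext r
        simp [ltTape_cons]
      rw [this, h1, ih]
      simp [binFrac]
    | true =>
      have : {r | ltTape r (true :: w) = true} =
          {r | r 0 = true ∧ (fun n => r (n + 1)) ∈ {r | ltTape r w = true}} ∪
          {r | r 0 = false ∧ (fun n => r (n + 1)) ∈ (Set.univ : Set Tape)} := by
        ext r
        cases h : r 0 <;> simp [ltTape_cons, h]
      have hs : Measurable fun (r : Tape) (n : ℕ) => r (n + 1) := by fun_prop
      have h0 : Measurable fun r : Tape => r 0 := by fun_prop
      rw [this, measureReal_union, h1, coin_cons false MeasurableSet.univ, ih]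
      · simp [binFrac]
        ring
      · rw [Set.disjoint_left]
        rintro r ⟨h, -⟩ ⟨h', -⟩
        rw [h] at h'
        exact absurd h' (by simp)
      · exact (h0 (measurableSet_singleton false)).inter (hs MeasurableSet.univ)

theorem binFrac_mem (w : Str) : 0 ≤ binFrac w ∧ binFrac w < 1 := by
  induction w with
  | nil => simp [binFrac]
  | cons b w ih =>
    obtain ⟨h1, h2⟩ := ih
    cases b <;> simp only [binFrac] <;> constructor <;> norm_num <;> linarith

/-- The longer prefix `m` makes it possible to compare one and the same number from the tape with
words of different lengths. -/
theorem ltTape_iff (r : Tape) (w : Str) (m : ℕ) (h : w.length ≤ m) :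
    ltTape r w = true ↔ binFrac (tapePrefix r m) < binFrac w := by
  induction w generalizing r m with
  | nil => simpa [ltTape, ltList, tapePrefix, binFrac] using (binFrac_mem (tapePrefix r m)).1
  | cons b w ih =>
    obtain _ | m := m
    · simp at h
    have ih' := ih (fun n => r (n + 1)) m (by simpa using h)
    have h1 := binFrac_mem (tapePrefix (fun n => r (n + 1)) m)
    have h2 := binFrac_mem w
    rw [ltTape_cons, tapePrefix_succ]
    simp only [binFrac]
    cases b <;> cases r 0 <;> simp [ih'] <;> first | (constructor <;> intro <;> linarith) | linarith

theorem ltTape_mono {r : Tape} {w w' : Str} (h : binFrac w ≤ binFrac w')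
    (hw : ltTape r w = true) : ltTape r w' = true := by
  rw [ltTape_iff r w (w.length + w'.length) (by omega)] at hw
  rw [ltTape_iff r w' (w.length + w'.length) (by omega)]
  exact hw.trans_le h

theorem pick_le (m : ℕ) (p : ℕ → Bool) : pick m p ≤ m := by
  induction m generalizing p with
  | zero => simp [pick]
  | succ m ih =>
    rw [pick]
    split_ifs
    · omega
    · have := ih fun i => p (i + 1)
      omega

theorem pick_le_iff {m j : ℕ} (h : j < m) (p : ℕ → Bool) :
    pick m p ≤ j ↔ ∃ i ≤ j, p i = true := by
  induction m generalizing p j with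
  | zero => omega
  | succ m ih =>
    rw [pick]
    split_ifs with h0
    · simp only [Nat.zero_le, true_iff]
      exact ⟨0, Nat.zero_le _, h0⟩
    · obtain _ | j := j
      · simpa using h0
      · rw [Nat.add_le_add_iff_right, ih (by omega)]
        constructor
        · rintro ⟨i, hi, hp⟩
          exact ⟨i + 1, by omega, hp⟩
        · rintro ⟨_ | i, hi, hp⟩
          · exact absurd hp h0
          · exact ⟨i, by omega, hp⟩

/-- All approximations are compared with the same tape, so the event says that the tape lies below
the largest of `w 0, …, w j`. The approximations need not be monotone, but since `p` is, their
maximum is still within `ε` of `p j`. -/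
theorem coin_pick_le {m j : ℕ} (h : j < m) (w : ℕ → Str) {p : ℕ → ℝ} (hp : Monotone p) {ε : ℝ}
    (hw : ∀ i < m, |p i - binFrac (w i)| ≤ ε) :
    |coin.real {r | pick m (fun i => ltTape r (w i)) ≤ j} - p j| ≤ ε := by
  obtain ⟨i, hi, hmax⟩ := Finset.exists_max_image (Finset.range (j + 1)) (fun i => binFrac (w i))
    ⟨0, by simp⟩
  have hij : i ≤ j := by simpa [Nat.lt_succ_iff] using hi
  have : {r | pick m (fun i => ltTape r (w i)) ≤ j} = {r | ltTape r (w i) = true} := by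
    ext r
    simp only [Set.mem_ofPred_eq, pick_le_iff h]
    constructor
    · rintro ⟨k, hk, hr⟩
      exact ltTape_mono (hmax k (by simpa [Nat.lt_succ_iff] using hk)) hr
    · exact fun hr => ⟨i, hij, hr⟩
  rw [this, coin_ltTape]
  have h1 := abs_le.1 (hw i (by omega))
  have h2 := abs_le.1 (hw j h)
  have h3 := hmax j (by simp)
  have h4 := hp hij
  rw [abs_le]
  constructor <;> linarith

theorem measurableSet_pick (m : ℕ) (w : ℕ → Str) (E : Set ℕ) :
    MeasurableSet {r | pick m (fun i => ltTape r (w i)) ∈ E} := by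
  have : Measurable fun r => pick m (fun i => ltTape r (w i)) := by
    have hf : ∀ i, Measurable fun r => ltTape r (w i) := fun i =>
      measurable_to_bool (measurableSet_ltTape (w i))
    clear E
    induction m generalizing w with
    | zero => exact measurable_const
    | succ m ih =>
      simp only [pick]
      exact Measurable.ite (measurableSet_ltTape (w 0)) measurable_const
        ((ih (fun i => w (i + 1)) fun i => hf _).add_const 1)
  exact this (MeasurableSet.of_discrete)

/-- Sampling from a distribution with approximately computable distribution function. -/
theorem exists_sampler {Ω : Type*} [MeasurableSpace Ω] [DiscreteMeasurableSpace Ω] (μ : Measure Ω)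
    [IsProbabilityMeasure μ] (m : ℕ) (J : Ω → ℕ) (hJ : ∀ s, J s ≤ m)
    (heff : ∀ S : Set Ω, EffReal (μ.real S)) :
    ∃ g : ℕ → List Str → Str, (∀ i, IsPolyTime (g i)) ∧ ∃ ε, Negligible ε ∧
      ∀ (n : ℕ+) (E : Set ℕ),
        |coin.real {r | pick m (fun i => ltTape r (g i [unary n])) ∈ E} - μ.real {s | J s ∈ E}|
          ≤ ε n := by
  -- The words `g i` approximate the distribution function of `J` at `i < m`; the value `m` is taken
  -- when the tape lies below none of them.
  choose g hg ε hε hle using fun i => heff {s | J s ≤ i}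
  -- A point probability is a difference of two values of the distribution function, hence the `2`;
  -- an event contains at most `m + 1` of the possible values.
  refine ⟨g, hg, fun k => (m + 1) * (2 * ∑ i ∈ Finset.range m, ε i k),
    ((Negligible.sum _ hε).const_mul zero_le_two).const_mul (by positivity), fun n E => ?_⟩
  set η := ∑ i ∈ Finset.range m, ε i n with hη
  have hη0 : 0 ≤ η := Finset.sum_nonneg fun i _ => (hε i).1 n
  set I : Tape → ℕ := fun r => pick m (fun i => ltTape r (g i [unary n])) with hI
  have hIm : ∀ E : Set ℕ, MeasurableSet {r | I r ∈ E} := fun E => measurableSet_pick m _ E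
  have hcdf : ∀ j, |coin.real {r | I r ≤ j} - μ.real {s | J s ≤ j}| ≤ η := by
    intro j
    by_cases hj : j < m
    · refine coin_pick_le hj (fun i => g i [unary n]) (p := fun j => μ.real {s | J s ≤ j})
        (fun i k hik => measureReal_mono fun s (hs : J s ≤ i) => hs.trans hik) fun i hi => ?_
      exact (hle i n).trans (Finset.single_le_sum (f := fun i => ε i n)
        (fun i _ => (hε i).1 n) (Finset.mem_range.2 hi))
    · have h1 : {r | I r ≤ j} = Set.univ := by
        ext r
        have := pick_le m (fun i => ltTape r (g i [unary n]))
        simp only [Set.mem_ofPred_eq, Set.mem_univ, iff_true, hI]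
        omega
      have h2 : {s | J s ≤ j} = Set.univ := by
        ext s
        have := hJ s
        simp only [Set.mem_ofPred_eq, Set.mem_univ, iff_true]
        omega
      rw [h1, h2]
      simpa using hη0
  have hpt : ∀ j, |coin.real {r | I r = j} - μ.real {s | J s = j}| ≤ 2 * η := by
    intro j
    obtain _ | j := j
    · have := hcdf 0
      simp only [Nat.le_zero] at this
      linarith
    · have e1 : {r | I r = j + 1} = {r | I r ≤ j + 1} \ {r | I r ≤ j} := by
        ext r; simp only [Set.mem_ofPred_eq, Set.mem_sdiff]; omega
      have e2 : {s | J s = j + 1} = {s | J s ≤ j + 1} \ {s | J s ≤ j} := by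
        ext r; simp only [Set.mem_ofPred_eq, Set.mem_sdiff]; omega
      have s1 : {r | I r ≤ j} ⊆ {r | I r ≤ j + 1} := fun r (h : I r ≤ j) => h.trans (Nat.le_succ j)
      have s2 : {s | J s ≤ j} ⊆ {s | J s ≤ j + 1} := fun r (h : J r ≤ j) => h.trans (Nat.le_succ j)
      rw [e1, e2, measureReal_sdiff s1 (hIm (Set.Iic j)), measureReal_sdiff s2 .of_discrete]
      have h1 := abs_le.1 (hcdf (j + 1))
      have h2 := abs_le.1 (hcdf j)
      rw [abs_le]
      constructor <;> linarith
  classical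
  have hsum1 : coin.real {r | I r ∈ E} =
      ∑ j ∈ (Finset.range (m + 1)).filter (· ∈ E), coin.real {r | I r = j} := by
    rw [← measureReal_biUnion_finset]
    · congr 1
      ext r
      have := pick_le m (fun i => ltTape r (g i [unary n]))
      simp only [Set.mem_ofPred_eq, Finset.mem_filter, Finset.mem_range, Set.mem_iUnion,
        exists_prop]
      exact ⟨fun h => ⟨I r, ⟨Nat.lt_succ_of_le this, h⟩, rfl⟩, fun ⟨j, h, e⟩ => e ▸ h.2⟩
    · intro i _ j _ hij
      exact Set.disjoint_left.2 fun r (h : I r = i) (h' : I r = j) => hij (h.symm.trans h')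
    · exact fun j _ => hIm {j}
  have hsum2 : μ.real {s | J s ∈ E} =
      ∑ j ∈ (Finset.range (m + 1)).filter (· ∈ E), μ.real {s | J s = j} := by
    rw [← measureReal_biUnion_finset]
    · congr 1
      ext s
      have := hJ s
      simp only [Set.mem_ofPred_eq, Finset.mem_filter, Finset.mem_range, Set.mem_iUnion,
        exists_prop]
      exact ⟨fun h => ⟨J s, ⟨Nat.lt_succ_of_le this, h⟩, rfl⟩, fun ⟨j, h, e⟩ => e ▸ h.2⟩
    · intro i _ j _ hij
      exact Set.disjoint_left.2 fun r (h : J r = i) (h' : J r = j) => hij (h.symm.trans h')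
    · exact fun j _ => MeasurableSet.of_discrete
  rw [hsum1, hsum2, ← Finset.sum_sub_distrib]
  refine (Finset.abs_sum_le_sum_abs _ _).trans ?_
  refine (Finset.sum_le_card_nsmul _ _ _ fun j _ => hpt j).trans ?_
  rw [nsmul_eq_mul]
  have : ((Finset.range (m + 1)).filter (· ∈ E)).card ≤ m + 1 := by
    simpa using Finset.card_filter_le (Finset.range (m + 1)) (· ∈ E)
  have : (((Finset.range (m + 1)).filter (· ∈ E)).card : ℝ) ≤ m + 1 := by exact_mod_cast this
  exact mul_le_mul_of_nonneg_right this (by positivity)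

/-! ### The sequence of commitment games is computable -/

section Computable

variable (S : CommitmentScheme)

theorem commitmentGame_mem_iff (n : ℕ+) (h : Hist) : h ∈ (commitmentGame S n).H ↔
    h ∈ stageHist (S.commitments n) bitStrings {s | s.length ≤ n} := Iff.rfl

theorem commitmentGame_append_mem_iff (n : ℕ+) (h : Hist) (a : Str) :
    h ++ [a] ∈ (commitmentGame S n).H ↔ h ∈ (commitmentGame S n).H ∧
      a ∈ stageSet (S.commitments n) bitStrings {s | s.length ≤ n} h.length :=
  append_mem_stageHist _ _ _ h a

theorem CommitmentScheme.length_of_mem {n : ℕ+} {c : Str} (h : c ∈ S.commitments n) :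
    c.length = n := by
  obtain ⟨b, r, rfl⟩ := h
  exact S.length_C₁ n b r

theorem CommitmentScheme.mem_of_mem_of_length {m n : ℕ+} {c : Str} (h : c ∈ S.commitments m)
    (hn : c.length = n) : c ∈ S.commitments n := by
  have : m = n := PNat.eq ((S.length_of_mem h).symm.trans hn)
  exact this ▸ h

theorem pptDecides_of_isPolyTime {g : List Str → Bool} (hg : PT encTuple fun y => [g y])
    {dom : Set Hist} {T : ℕ+ → Set Hist}
    (h : ∀ n : ℕ+, ∀ h ∈ dom, g (unary n :: h) = true ↔ h ∈ T n) : PPTDecides dom T := by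
  refine ⟨_, (isPolyTime_iff.2 hg).isPPT, fun n x hx => ?_⟩
  have : {r : Tape | [g (unary n :: x)] = [true] ↔ x ∈ T n} = Set.univ := by
    ext r
    simpa using h n x hx
  rw [this]
  norm_num

theorem PT.encTuple_id : PT encTuple fun y : List Str => encTuple y := PT.refl _

theorem PT.encTuple_tail : PT encTuple fun y : List Str => encTuple y.tail :=
  PT.tail (T := fun y => y) PT.encTuple_id

theorem PT.encTuple_head : PT encTuple fun y : List Str => y.headD [] :=
  PT.head (T := fun y => y) PT.encTuple_id

theorem PT.not {X : Type*} {α : Type} [Fintype α] {u : X → List α} {c : X → Bool}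
    (h : PT u fun x => [c x]) : PT u fun x => [!(c x)] :=
  h.ofBool fun b => [!b]

/-- A commitment string reveals its security parameter by its length. As the input is known to be a
history of some game of the sequence, only lengths have to be checked, never whether a string is a
commitment. -/
theorem commitmentGame_histories :
    PPTDecides (⋃ n, (commitmentGame S n).H) fun n => (commitmentGame S n).H := by
  -- Here `y` is `1^n` followed by `h`. A missing third action reads as the empty word and passes
  -- its test; the empty history is treated apart, as its missing first action would fail `n ≤ |c|`.
  refine pptDecides_of_isPolyTime (g := fun y => decide (unary y.tail.length = []) ||
    ((decide ((y.headD []).length ≤ (y.tail.headD []).length) &&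
      decide ((y.tail.headD []).length ≤ (y.headD []).length)) &&
      decide ((y.tail.tail.tail.headD []).length ≤ (y.headD []).length))) ?_ ?_
  · have h0 := PT.encTuple_head
    have h1 := PT.encTuple_tail.head
    have h2 := PT.encTuple_tail.tail.tail.head
    exact (PT.encTuple_tail.count.eqConst []).or
      (((h0.length_le h1).and (h1.length_le h0)).and (h2.length_le h0))
  · intro n h hh
    obtain ⟨m, hm⟩ := Set.mem_iUnion.1 hh
    have key : ∀ c ∈ S.commitments m, (c ∈ S.commitments n ↔
        ((n : ℕ) ≤ c.length ∧ c.length ≤ n)) := by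
      intro c hc
      constructor
      · intro h
        rw [S.length_of_mem h]
        exact ⟨le_rfl, le_rfl⟩
      · rintro ⟨h1, h2⟩
        exact S.mem_of_mem_of_length hc (le_antisymm h2 h1)
    rw [commitmentGame_mem_iff] at hm ⊢
    rcases h with _ | ⟨x, _ | ⟨y, _ | ⟨z, _ | ⟨w, l⟩⟩⟩⟩
    · simp [stageHist, IsStageHist, unary]
    · have hx : x ∈ S.commitments m := hm
      simp [stageHist, IsStageHist, unary, key x hx]
    · obtain ⟨hx, hy⟩ : x ∈ S.commitments m ∧ y ∈ bitStrings := hm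
      simp [stageHist, IsStageHist, unary, key x hx, hy]
    · obtain ⟨hx, hy, hz⟩ : x ∈ S.commitments m ∧ y ∈ bitStrings ∧ z.length ≤ m := hm
      simp [stageHist, IsStageHist, unary, key x hx, hy]
    · exact hm.elim

theorem bitStrings_iff (y : Str) : y ∈ bitStrings ↔ y = [false] ∨ y = [true] := by
  simp [bitStrings]

/-- All conditions except the one on the first action are decided without error, and `D` is called
at most once, so its success probability carries over. -/
theorem commitmentGame_pptDecides
    (h : PPTDecides {h | h.length = 1} fun n => {h | ∃ c ∈ S.commitments n, h = [c]}) :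
    PPTDecides Set.univ fun n => (commitmentGame S n).H := by
  obtain ⟨D, hD, hdec⟩ := h
  let bit : Str → Bool := fun y => decide (y = [false]) || decide (y = [true])
  let wf : List Str → Bool := fun y => decide (unary y.tail.length = [true]) ||
    ((bit (y.tail.tail.headD []) && decide (unary y.tail.length = [true, true])) ||
      (bit (y.tail.tail.headD []) && (decide (unary y.tail.length = [true, true, true]) &&
        decide ((y.tail.tail.tail.headD []).length ≤ (y.headD []).length))))
  have hwf : PT encTuple fun y => [wf y] := by
    have hb := (PT.encTuple_tail.tail.head.eqConst [false]).or
      (PT.encTuple_tail.tail.head.eqConst [true])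
    have hc := PT.encTuple_tail.count
    exact (hc.eqConst [true]).or ((hb.and (hc.eqConst [true, true])).or
      (hb.and ((hc.eqConst [true, true, true]).and
        (PT.encTuple_tail.tail.tail.head.length_le PT.encTuple_head))))
  let nil : List Str → Bool := fun y => decide (unary y.tail.length = [])
  have hnil : PT encTuple fun y => [nil y] := PT.encTuple_tail.count.eqConst []
  have det : ∀ {g : List Str → Bool}, PT encTuple (fun y => [g y]) →
      RandPoly fun p => [g p.1] := fun h => RandPoly.poly (isPolyTime_iff.2 h) RandPoly.input
  refine ⟨fun y r => if nil y then [true] else if wf y then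
    D [y.headD [], y.tail.headD []] r else [], RandPoly.isPPT ((det hnil).ite
      (RandPoly.const [true]) ((det hwf).ite (RandPoly.call hD (φ := id)
        (fun _ => RandPoly.tapePrefix)
        (T := fun p => [p.1.headD [], p.1.tail.headD []])
        (RandPoly.input.head.enc_cons (RandPoly.input.tail.head.enc_cons
          (RandPoly.const (encTuple []))))) (RandPoly.const []))), fun n h _ => ?_⟩
  -- For the branches in which `D` is not called and the answer is certain.
  have one : ∀ P : Tape → Prop, (∀ r, P r) → (2 : ℝ) / 3 ≤ coin.real {r | P r} := by
    intro P hP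
    have : {r | P r} = Set.univ := by
      ext r
      simpa using hP r
    rw [this]
    norm_num
  by_cases h0 : h = []
  · subst h0
    refine one _ fun r => ?_
    simp [nil, unary, commitmentGame_mem_iff, stageHist, IsStageHist]
  · have hn : nil (unary n :: h) = false := by simp [nil, unary, h0]
    by_cases hw : wf (unary n :: h) = true
    · have := hdec n [h.headD []] rfl
      convert this using 5 with r
      · simp [hn, hw]
      · rw [commitmentGame_mem_iff]
        rcases h with _ | ⟨x, _ | ⟨y, _ | ⟨z, _ | ⟨w, l⟩⟩⟩⟩
        · exact absurd rfl h0
        · simp [stageHist, IsStageHist]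
        · have hy : y ∈ bitStrings := by
            simpa [wf, bit, unary, bitStrings_iff] using hw
          simp [stageHist, IsStageHist, hy]
        · have hy : y ∈ bitStrings ∧ z.length ≤ n := by
            simpa [wf, bit, unary, bitStrings_iff] using hw
          simp [stageHist, IsStageHist, hy]
        · simp [wf, unary, List.replicate_succ] at hw
    · refine one _ fun r => ?_
      simp only [hn, hw, if_false, Bool.false_eq_true]
      rw [commitmentGame_mem_iff]
      refine ⟨nofun, fun hh => absurd ?_ hw⟩
      rcases h with _ | ⟨x, _ | ⟨y, _ | ⟨z, _ | ⟨w, l⟩⟩⟩⟩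
      · exact absurd rfl h0
      · simp [wf, unary]
      · obtain ⟨hx, hy⟩ : x ∈ S.commitments n ∧ y ∈ bitStrings := hh
        simpa [wf, bit, unary, bitStrings_iff] using hy
      · obtain ⟨hx, hy, hz⟩ : x ∈ S.commitments n ∧ y ∈ bitStrings ∧ z.length ≤ n := hh
        have hy' : bit y = true := by simpa [bit, bitStrings_iff] using hy
        simp [wf, unary, hy', hz]
      · exact hh.elim

theorem ofDigits_pow (k : ℕ) :
    Nat.ofDigits 2 ((List.replicate k false ++ [true]).map Bool.toNat) = 2 ^ k := by
  induction k with
  | zero => simp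
  | succ k ih =>
    rw [List.replicate_succ, List.cons_append, List.map_cons, Nat.ofDigits_cons, ih, pow_succ]
    simp [mul_comm]

theorem mem_terminal_iff (n : ℕ+) (h : Hist) : h ∈ (commitmentGame S n).terminal ↔
    ∃ c ∈ S.commitments n, ∃ y : Bool, ∃ s : Str, s.length ≤ n ∧ h = [c, [y], s] := by
  constructor
  · rintro ⟨h1, h2⟩
    obtain ⟨c₀, hc₀⟩ := (S.commitments_nontrivial n).nonempty
    have h3 : ∀ a, a ∉ stageSet (S.commitments n) bitStrings {s | s.length ≤ n} h.length :=
      fun a ha => h2 a ((commitmentGame_append_mem_iff S n h a).2 ⟨h1, ha⟩)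
    rw [commitmentGame_mem_iff] at h1
    rcases h with _ | ⟨x, _ | ⟨y, _ | ⟨z, _ | ⟨w, l⟩⟩⟩⟩
    · exact absurd hc₀ (h3 c₀)
    · exact absurd (show [true] ∈ bitStrings by simp [bitStrings]) (h3 [true])
    · exact absurd (Nat.zero_le _) (h3 [])
    · obtain ⟨hx, hy, hz⟩ : x ∈ S.commitments n ∧ y ∈ bitStrings ∧ z.length ≤ n := h1
      rcases (bitStrings_iff y).1 hy with rfl | rfl
      · exact ⟨x, hx, false, z, hz, rfl⟩
      · exact ⟨x, hx, true, z, hz, rfl⟩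
    · exact h1.elim
  · rintro ⟨c, hc, y, s, hs, rfl⟩
    refine ⟨⟨hc, ?_, hs⟩, fun a ha => ?_⟩
    · cases y <;> simp [bitStrings]
    · exact ((commitmentGame_append_mem_iff S n _ a).1 ha).2

/-- The utilities are `±1`, and `±1` is exactly `±2^k / 2^k`; the machine has to write `k` zeros
followed by a one. -/
theorem commitmentGame_utility (i : Fin 2) :
    ∃ v : Hist → ℝ, PolyTimeRealOn (⋃ n, (commitmentGame S n).terminal) v ∧
      ∀ n, ∀ h ∈ (commitmentGame S n).terminal, (commitmentGame S n).u i h = v h := by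
  refine ⟨fun h => if i = 0 then commitmentWin S h else -commitmentWin S h, ?_,
    fun n h _ => rfl⟩
  obtain ⟨g, hg, hR⟩ := S.polyTime_R
  let win : List Str → Bool := fun y =>
    (decide (g [y.tail.headD [], y.tail.tail.tail.headD []] = [true]) &&
      !decide (y.tail.tail.headD [] = [true])) ||
    (decide (g [y.tail.headD [], y.tail.tail.tail.headD []] = [false]) &&
      !decide (y.tail.tail.headD [] = [false]))
  have hwin : PT encTuple fun y => [win y] := by
    have h1 := PT.poly hg (PT.encTuple_tail.head.enc_cons
      (PT.encTuple_tail.tail.tail.head.enc_cons PT.enc_nil))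
    have h2 := PT.encTuple_tail.tail.head
    exact ((h1.eqConst [true]).and (h2.eqConst [true]).not).or
      ((h1.eqConst [false]).and (h2.eqConst [false]).not)
  -- The sign is positive if player `0` wins and `i = 0`, or if player `0` does not win and `i = 1`.
  refine ⟨fun y => (if win y = decide (i = 0) then false else true) ::
    ((y.headD []).map (fun _ => false) ++ [true]), isPolyTime_iff.2 ?_, fun h hh k => ?_⟩
  · exact (hwin.ofBool fun b => [if b = decide (i = 0) then false else true]).append
      ((PT.encTuple_head.map fun _ => false).append (PT.const _ [true]))
  · obtain ⟨n, hn⟩ := Set.mem_iUnion.1 hh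
    obtain ⟨c, -, y, s, -, rfl⟩ := (mem_terminal_iff S n h).1 hn
    have hw : commitmentWin S [c, [y], s] = if win [unary k, c, [y], s] = true then 1 else -1 := by
      simp only [commitmentWin, win, List.tail_cons, List.headD_cons, hR]
      obtain h | ⟨b, h⟩ : S.R c s = none ∨ ∃ b, S.R c s = some b := by cases S.R c s <;> simp
      · simp [h]
      · cases b <;> cases y <;> simp [h]
    have hd : ∀ b : Bool, dyadic k (b :: (((unary k : Str)).map (fun _ => false) ++ [true])) =
        if b then -1 else 1 := by
      intro b
      have : ((unary k : Str)).map (fun _ => false) = List.replicate k false := by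
        simp [unary]
      rw [this, dyadic, ofDigits_pow]
      push_cast
      field_simp
    simp only [List.headD_cons, hd, hw]
    fin_cases i <;> cases win [unary k, c, [y], s] <;> simp

theorem commitmentGame_isComputableUniform : IsComputableUniform (commitmentGame S) where
  action_length := by
    refine ⟨Polynomial.X + 1, fun n h a ha => ?_⟩
    have ha := ((commitmentGame_append_mem_iff S n h a).1 ha).2
    simp only [Polynomial.eval_add, Polynomial.eval_X, Polynomial.eval_one]
    rcases h' : h.length with _ | _ | _ | k <;> rw [h'] at ha
    · exact (S.length_of_mem ha).le.trans (by omega)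
    · rcases (bitStrings_iff a).1 ha with rfl | rfl <;> simp
    · exact le_trans ha (by omega)
    · exact ha.elim
  histories := commitmentGame_histories S
  player := by
    refine ⟨fun h => if decide (unary h.length = [true]) then [true] else [],
      isPolyTime_iff.2 ?_, fun n h _ => ?_⟩
    · exact ((PT.count (T := fun y => y) PT.encTuple_id).eqConst [true]).ite (PT.const _ _)
        (PT.const _ _)
    · have : unary h.length = [true] ↔ h.length = 1 := by
        constructor
        · intro h'
          simpa [unary] using congrArg List.length h'
        · intro h'
          rw [h']
          rfl
      change _ = unary ((if h.length = 1 then 1 else 0 : Fin 2) : ℕ)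
      simp only [this, decide_eq_true_eq]
      split_ifs <;> rfl
  utility := commitmentGame_utility S

end Computable

/-! ### From commitment games to the envelope game -/

theorem stageHist_length_le {A B D : Set Str} {h : Hist} (hh : h ∈ stageHist A B D) :
    h.length ≤ 3 := by
  rcases h with _ | ⟨x, _ | ⟨y, _ | ⟨z, _ | ⟨w, l⟩⟩⟩⟩
  · simp
  · simp
  · simp
  · simp
  · exact hh.elim

theorem exists_append_mem_stageHist {A B D : Set Str} (hA : A.Nonempty) (hB : B.Nonempty)
    (hD : D.Nonempty) (h : Hist) :
    (∃ a, h ++ [a] ∈ stageHist A B D) ↔ h ∈ stageHist A B D ∧ h.length < 3 := by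
  simp only [append_mem_stageHist]
  constructor
  · rintro ⟨a, hh, ha⟩
    refine ⟨hh, ?_⟩
    by_contra hlt
    obtain ⟨k, hk⟩ : ∃ k, h.length = k + 3 := ⟨h.length - 3, by omega⟩
    rw [hk] at ha
    exact ha
  · rintro ⟨hh, hlt⟩
    obtain ⟨a, ha⟩ := hA
    obtain ⟨b, hb⟩ := hB
    obtain ⟨d, hd⟩ := hD
    obtain h0 | h0 | h0 : h.length = 0 ∨ h.length = 1 ∨ h.length = 2 := by omega
    · exact ⟨a, hh, by rw [h0]; exact ha⟩
    · exact ⟨b, hh, by rw [h0]; exact hb⟩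
    · exact ⟨d, hh, by rw [h0]; exact hd⟩

theorem mem_terminal_stageHist {A B D : Set Str} (hA : A.Nonempty) (hB : B.Nonempty)
    (hD : D.Nonempty) (h : Hist) :
    (h ∈ stageHist A B D ∧ ∀ a, h ++ [a] ∉ stageHist A B D) ↔
      h ∈ stageHist A B D ∧ h.length = 3 := by
  have := exists_append_mem_stageHist hA hB hD h
  constructor
  · rintro ⟨hh, hn⟩
    have h3 := stageHist_length_le hh
    refine ⟨hh, ?_⟩
    by_contra h4
    obtain ⟨a, ha⟩ := this.2 ⟨hh, by omega⟩
    exact hn a ha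
  · rintro ⟨hh, h3⟩
    refine ⟨hh, fun a ha => ?_⟩
    have := (this.1 ⟨a, ha⟩).2
    omega

theorem bit_mem (b : Bool) : [b] ∈ bitStrings := by cases b <;> simp [bitStrings]

theorem bitStrings_exists {w : Str} (h : w ∈ bitStrings) : ∃ b : Bool, w = [b] := by
  rcases (bitStrings_iff w).1 h with rfl | rfl
  exacts [⟨_, rfl⟩, ⟨_, rfl⟩]

/-- The history of the envelope game with the given moves. -/
def envHist (t : Bool × Bool × Bool) : Hist := [[t.1], [t.2.1], [t.2.2]]

theorem envHist_injective : Function.Injective envHist := by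
  rintro ⟨x, y, d⟩ ⟨x', y', d'⟩ h
  simpa [envHist] using h

theorem envelopeGame_mem_iff (h : Hist) :
    h ∈ envelopeGame.H ↔ h ∈ stageHist bitStrings bitStrings bitStrings := Iff.rfl

theorem envelopeGame_nonterminal_iff (h : Hist) :
    h ∈ envelopeGame.nonterminal ↔ h ∈ envelopeGame.H ∧ h.length < 3 :=
  exists_append_mem_stageHist bitStrings_nontrivial.nonempty bitStrings_nontrivial.nonempty
    bitStrings_nontrivial.nonempty h

theorem envelopeGame_terminal_iff (h : Hist) :
    h ∈ envelopeGame.terminal ↔ h ∈ envelopeGame.H ∧ h.length = 3 :=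
  mem_terminal_stageHist bitStrings_nontrivial.nonempty bitStrings_nontrivial.nonempty
    bitStrings_nontrivial.nonempty h

theorem envelopeGame_terminal : envelopeGame.terminal = Set.range envHist := by
  ext h
  rw [envelopeGame_terminal_iff, envelopeGame_mem_iff]
  constructor
  · rintro ⟨hh, h3⟩
    rcases h with _ | ⟨x, _ | ⟨y, _ | ⟨z, _ | ⟨w, l⟩⟩⟩⟩
    · simp at h3
    · simp at h3
    · simp at h3
    · obtain ⟨hx, hy, hz⟩ : x ∈ bitStrings ∧ y ∈ bitStrings ∧ z ∈ bitStrings := hh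
      obtain ⟨x, rfl⟩ := bitStrings_exists hx
      obtain ⟨y, rfl⟩ := bitStrings_exists hy
      obtain ⟨z, rfl⟩ := bitStrings_exists hz
      exact ⟨(x, y, z), rfl⟩
    · exact hh.elim
  · rintro ⟨⟨x, y, d⟩, rfl⟩
    exact ⟨⟨bit_mem x, bit_mem y, bit_mem d⟩, rfl⟩

section Map

variable (S : CommitmentScheme) (n : ℕ+)

theorem commitmentGame_nonterminal_iff (h : Hist) :
    h ∈ (commitmentGame S n).nonterminal ↔ h ∈ (commitmentGame S n).H ∧ h.length < 3 :=
  exists_append_mem_stageHist (S.commitments_nontrivial n).nonempty bitStrings_nontrivial.nonempty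
    (keys_nontrivial n).nonempty h

theorem commitmentGame_terminal_iff (h : Hist) :
    h ∈ (commitmentGame S n).terminal ↔ h ∈ (commitmentGame S n).H ∧ h.length = 3 :=
  mem_terminal_stageHist (S.commitments_nontrivial n).nonempty bitStrings_nontrivial.nonempty
    (keys_nontrivial n).nonempty h

/-- The bit to which a string commits. -/
def CommitmentScheme.bit (c : Str) : Bool := by
  classical exact decide (∃ s, S.R c s = some true)

/-- By binding only the key opens the commitment, and it opens it to `b`. -/
theorem CommitmentScheme.bit_C₁ (b : Bool) (r : Tape) : S.bit (S.C₁ n b r) = b := by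
  classical
  have h : (∃ s, S.R (S.C₁ n b r) s = some true) ↔ b = true := by
    constructor
    · rintro ⟨s, hs⟩
      by_cases h : s = S.C₂ n b r
      · rw [h, S.opens] at hs
        simpa using hs
      · rw [S.binding n b r s h] at hs
        simp at hs
    · rintro rfl
      exact ⟨_, S.opens n true r⟩
  unfold CommitmentScheme.bit
  cases b <;> simp_all

variable {n} in
theorem CommitmentScheme.bit_of_opens {c s : Str} {b : Bool} (hc : c ∈ S.commitments n)
    (h : S.R c s = some b) : S.bit c = b := by
  obtain ⟨b', r, rfl⟩ := hc
  rw [S.bit_C₁]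
  by_cases hs : s = S.C₂ n b' r
  · rw [hs, S.opens] at h
    simpa using h
  · rw [S.binding n b' r s hs] at h
    simp at h

/-- The history of the envelope game that corresponds to a history of a commitment game. -/
def toEnvelope : Hist → Hist
  | [] => []
  | [c] => [[S.bit c]]
  | [c, y] => [[S.bit c], y]
  | [c, y, s] => [[S.bit c], y, [(S.R c s).isSome]]
  | _ => []

theorem toEnvelope_mapsTo : Set.MapsTo (toEnvelope S) (commitmentGame S n).H envelopeGame.H := by
  intro h hh
  rcases h with _ | ⟨x, _ | ⟨y, _ | ⟨z, _ | ⟨w, l⟩⟩⟩⟩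
  · trivial
  · exact bit_mem _
  · exact ⟨bit_mem _, hh.2⟩
  · exact ⟨bit_mem _, hh.2.1, bit_mem _⟩
  · exact hh.elim

theorem toEnvelope_length {h : Hist} (hh : h ∈ (commitmentGame S n).H) :
    (toEnvelope S h).length = h.length := by
  rcases h with _ | ⟨x, _ | ⟨y, _ | ⟨z, _ | ⟨w, l⟩⟩⟩⟩
  · rfl
  · rfl
  · rfl
  · rfl
  · exact hh.elim

theorem C₁_mem (b : Bool) (r : Tape) : S.C₁ n b r ∈ S.commitments n := ⟨b, r, rfl⟩

/-- Keys have length `n - 1`, so `1^n` is a legal last move that opens nothing: it plays the role of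
destroying the envelope. -/
theorem R_unary (b : Bool) (r : Tape) : S.R (S.C₁ n b r) (unary n) = none := by
  refine S.binding n b r _ fun h => ?_
  have h1 := congrArg List.length h
  have h2 := n.pos
  rw [S.length_C₂] at h1
  simp only [unary, List.length_replicate] at h1
  omega

theorem toEnvelope_surjOn : Set.SurjOn (toEnvelope S) (commitmentGame S n).H envelopeGame.H := by
  intro h hh
  rcases h with _ | ⟨x, _ | ⟨y, _ | ⟨z, _ | ⟨w, l⟩⟩⟩⟩
  · exact ⟨[], trivial, rfl⟩
  · obtain ⟨x, rfl⟩ := bitStrings_exists hh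
    exact ⟨[S.C₁ n x fun _ => false], C₁_mem S n _ _, by simp [toEnvelope, S.bit_C₁]⟩
  · obtain ⟨hx, hy⟩ : x ∈ bitStrings ∧ y ∈ bitStrings := hh
    obtain ⟨x, rfl⟩ := bitStrings_exists hx
    exact ⟨[S.C₁ n x fun _ => false, y], ⟨C₁_mem S n _ _, hy⟩, by simp [toEnvelope, S.bit_C₁]⟩
  · obtain ⟨hx, hy, hz⟩ : x ∈ bitStrings ∧ y ∈ bitStrings ∧ z ∈ bitStrings := hh
    obtain ⟨x, rfl⟩ := bitStrings_exists hx
    obtain ⟨z, rfl⟩ := bitStrings_exists hz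
    cases z
    · refine ⟨[S.C₁ n x fun _ => false, y, unary n], ⟨C₁_mem S n _ _, hy, ?_⟩, ?_⟩
      · simp [unary]
      · simp [toEnvelope, S.bit_C₁, R_unary]
    · refine ⟨[S.C₁ n x fun _ => false, y, S.C₂ n x fun _ => false], ⟨C₁_mem S n _ _, hy, ?_⟩, ?_⟩
      · simp [S.length_C₂]
      · simp [toEnvelope, S.bit_C₁, S.opens]
  · exact hh.elim

theorem toEnvelope_terminal_iff {h : Hist} (hh : h ∈ (commitmentGame S n).H) :
    toEnvelope S h ∈ envelopeGame.terminal ↔ h ∈ (commitmentGame S n).terminal := by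
  rw [envelopeGame_terminal_iff, commitmentGame_terminal_iff, toEnvelope_length S n hh]
  simp [hh, toEnvelope_mapsTo S n hh]

theorem toEnvelope_historyMap :
    HistoryMap (commitmentGame S n) envelopeGame (toEnvelope S) where
  mapsTo := toEnvelope_mapsTo S n
  surjOn := toEnvelope_surjOn S n
  length_eq h hh := toEnvelope_length S n hh
  terminal_iff h hh := toEnvelope_terminal_iff S n hh
  player_eq h hh := by
    have := toEnvelope_length S n ((commitmentGame_nonterminal_iff S n h).1 hh).1
    change (if (toEnvelope S h).length = 1 then (1 : Fin 2) else 0) = if h.length = 1 then 1 else 0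
    rw [this]
  prefix_of h hh h' hp := by
    rcases h with _ | ⟨x, _ | ⟨y, _ | ⟨z, _ | ⟨w, l⟩⟩⟩⟩
    · rw [List.prefix_nil.1 hp]
    all_goals try exact hh.elim
    all_goals
      obtain ⟨t, ht⟩ := hp
      rcases h' with _ | ⟨x', _ | ⟨y', _ | ⟨z', _ | ⟨w', l'⟩⟩⟩⟩ <;> simp_all [toEnvelope]
  -- With perfect information, two histories in one information set are equal.
  sameInfo h h' hs := by
    obtain ⟨h1, -, e⟩ := hs
    have e : h = h' := e
    subst e
    have h2 := (commitmentGame_nonterminal_iff S n h).1 h1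
    have : toEnvelope S h ∈ envelopeGame.nonterminal := by
      rw [envelopeGame_nonterminal_iff, toEnvelope_length S n h2.1]
      exact ⟨toEnvelope_mapsTo S n h2.1, h2.2⟩
    exact ⟨this, this, rfl⟩
  lastAction h h' hs a _ := by
    obtain ⟨-, -, e⟩ := hs
    have e : h = h' := e
    rw [e]

/-- If a string opens `c` at all, it opens it to `bit c`; so the two winning conditions coincide. -/
theorem toEnvelope_utility {h : Hist} (hh : h ∈ (commitmentGame S n).terminal) (i : Fin 2) :
    (commitmentGame S n).u i h = envelopeGame.u i (toEnvelope S h) := by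
  have key : commitmentWin S h = envelopeWin (toEnvelope S h) := by
    obtain ⟨c, hc, y, s, -, rfl⟩ := (mem_terminal_iff S n h).1 hh
    simp only [commitmentWin, toEnvelope, envelopeWin]
    congr 1
    rw [eq_iff_iff]
    constructor
    · rintro ⟨b, hb, hy⟩
      rw [S.bit_of_opens hc hb, hb]
      exact ⟨rfl, fun h => hy h.symm⟩
    · rintro ⟨h1, h2⟩
      obtain ⟨b, hb⟩ := Option.isSome_iff_exists.1 (by simpa using h1)
      rw [S.bit_of_opens hc hb] at h2
      exact ⟨b, hb, fun h => h2 h.symm⟩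
  change (if i = 0 then commitmentWin S h else -commitmentWin S h) =
    if i = 0 then envelopeWin (toEnvelope S h) else -envelopeWin (toEnvelope S h)
  rw [key]

/-! ### Distributions on outcomes -/

theorem prefix_triple {h : Hist} {a x y z : Str} : h ++ [a] <+: [x, y, z] ↔
    (h = [] ∧ a = x) ∨ (h = [x] ∧ a = y) ∨ (h = [x, y] ∧ a = z) := by
  rcases h with _ | ⟨x', _ | ⟨y', _ | ⟨z', _ | ⟨w', l'⟩⟩⟩⟩ <;>
    simp [List.cons_prefix_cons, and_assoc]

variable {S n}

theorem nil_mem_turn : [] ∈ (commitmentGame S n).turn 0 :=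
  ⟨(commitmentGame_nonterminal_iff S n _).2 ⟨trivial, by simp⟩, rfl⟩

theorem singleton_mem_turn {c : Str} (hc : c ∈ S.commitments n) :
    [c] ∈ (commitmentGame S n).turn 1 :=
  ⟨(commitmentGame_nonterminal_iff S n _).2 ⟨hc, by simp⟩, rfl⟩

theorem pair_mem_turn {c : Str} (hc : c ∈ S.commitments n) (y : Bool) :
    [c, [y]] ∈ (commitmentGame S n).turn 0 :=
  ⟨(commitmentGame_nonterminal_iff S n _).2 ⟨⟨hc, bit_mem y⟩, by simp⟩, rfl⟩

theorem turn_zero_length {h : Hist} (hh : h ∈ (commitmentGame S n).turn 0) : h.length ≠ 1 := by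
  intro h1
  have : (if h.length = 1 then (1 : Fin 2) else 0) = 0 := hh.2
  rw [if_pos h1] at this
  exact absurd this (by decide)

theorem turn_one_length {h : Hist} (hh : h ∈ (commitmentGame S n).turn 1) : h.length = 1 := by
  by_contra h1
  have : (if h.length = 1 then (1 : Fin 2) else 0) = 1 := hh.2
  rw [if_neg h1] at this
  exact absurd this (by decide)

theorem follows_zero_iff (M : Strategy (commitmentGame S) 0) {c : Str} (hc : c ∈ S.commitments n)
    (y : Bool) (s : Str) (r : Tape) : M.Follows n r [c, [y], s] ↔
      M.M [unary n] r = c ∧ M.M [unary n, c, [y]] r = s := by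
  constructor
  · intro h
    exact ⟨h [] c (prefix_triple.2 (by simp)) nil_mem_turn,
      h [c, [y]] s (prefix_triple.2 (by simp)) (pair_mem_turn hc y)⟩
  · rintro ⟨h1, h2⟩ h a hp ht
    obtain ⟨rfl, rfl⟩ | ⟨rfl, rfl⟩ | ⟨rfl, rfl⟩ := prefix_triple.1 hp
    · exact h1
    · exact absurd rfl (turn_zero_length ht)
    · exact h2

theorem follows_one_iff (M : Strategy (commitmentGame S) 1) {c : Str} (hc : c ∈ S.commitments n)
    (y : Bool) (s : Str) (r : Tape) : M.Follows n r [c, [y], s] ↔ M.M [unary n, c] r = [y] := by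
  constructor
  · intro h
    exact h [c] [y] (prefix_triple.2 (by simp)) (singleton_mem_turn hc)
  · rintro h1 h a hp ht
    have := turn_one_length ht
    obtain ⟨rfl, rfl⟩ | ⟨rfl, rfl⟩ | ⟨rfl, rfl⟩ := prefix_triple.1 hp
    · simp at this
    · exact h1
    · simp at this

/-- The commitment strings, as a finite set. -/
def commitFinset (S : CommitmentScheme) (n : ℕ+) : Finset Str := (S.commitments_finite n).toFinset

theorem mem_commitFinset {c : Str} : c ∈ commitFinset S n ↔ c ∈ S.commitments n := by
  simp [commitFinset]

theorem strategy_zero_mem (M : Strategy (commitmentGame S) 0) (r : Tape) :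
    M.M [unary n] r ∈ S.commitments n :=
  ((commitmentGame_append_mem_iff S n _ _).1 (M.legal n [] nil_mem_turn r)).2

theorem strategy_zero_length (M : Strategy (commitmentGame S) 0) {c : Str}
    (hc : c ∈ S.commitments n) (y : Bool) (r : Tape) : (M.M [unary n, c, [y]] r).length ≤ n :=
  ((commitmentGame_append_mem_iff S n _ _).1 (M.legal n _ (pair_mem_turn hc y) r)).2

theorem strategy_one_mem (M : Strategy (commitmentGame S) 1) {c : Str}
    (hc : c ∈ S.commitments n) (r : Tape) : M.M [unary n, c] r ∈ bitStrings :=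
  ((commitmentGame_append_mem_iff S n _ _).1 (M.legal n _ (singleton_mem_turn hc) r)).2

theorem pi_two_real {Ω : Fin 2 → Type*} [∀ i, MeasurableSpace (Ω i)] (μ : ∀ i, Measure (Ω i))
    [∀ i, IsProbabilityMeasure (μ i)] (U : Set (Ω 0)) (V : Set (Ω 1)) :
    (Measure.pi μ).real {r | r 0 ∈ U ∧ r 1 ∈ V} = (μ 0).real U * (μ 1).real V := by
  have : {r : ∀ i, Ω i | r 0 ∈ U ∧ r 1 ∈ V} =
      Set.pi Set.univ (Fin.cons U (Fin.cons V finZeroElim) : ∀ i, Set (Ω i)) := by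
    ext r
    simp [Fin.forall_fin_two]
  rw [this, measureReal_def, Measure.pi_pi, Fin.prod_univ_two, ENNReal.toReal_mul]
  rfl

/-- For a fixed commitment `c` the event is a condition on the first tape and one on the second,
which are independent. Different `c` give disjoint events, since `c` is determined by the first
tape. -/
theorem imageDist_envHist (M : ∀ i, Strategy (commitmentGame S) i) (x y d : Bool) :
    imageDist (commitmentGame S) (toEnvelope S) M n (envHist (x, y, d)) =
      ∑ c ∈ commitFinset S n, coin.real {r | (M 0).M [unary n] r = c ∧ S.bit c = x ∧
          (S.R c ((M 0).M [unary n, c, [y]] r)).isSome = d} *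
        coin.real {r | (M 1).M [unary n, c] r = [y]} := by
  have hset : {r : Fin 2 → Tape | ∃ h' ∈ (commitmentGame S n).terminal,
      toEnvelope S h' = envHist (x, y, d) ∧ ∀ i, (M i).Follows n (r i) h'} =
      ⋃ c ∈ commitFinset S n, {r | r 0 ∈ {r | (M 0).M [unary n] r = c ∧ S.bit c = x ∧
          (S.R c ((M 0).M [unary n, c, [y]] r)).isSome = d} ∧
        r 1 ∈ {r | (M 1).M [unary n, c] r = [y]}} := by
    ext r
    simp only [Set.mem_ofPred_eq, Set.mem_iUnion, exists_prop, mem_commitFinset]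
    constructor
    · rintro ⟨h', ht, hf, hM⟩
      obtain ⟨c, hc, y', s, -, rfl⟩ := (mem_terminal_iff S n h').1 ht
      have h0 := (follows_zero_iff (M 0) hc y' s (r 0)).1 (hM 0)
      have h1 := (follows_one_iff (M 1) hc y' s (r 1)).1 (hM 1)
      simp only [toEnvelope, envHist, List.cons.injEq, and_true] at hf
      obtain ⟨hx, rfl, hd⟩ := hf
      exact ⟨c, hc, ⟨h0.1, hx, by rw [h0.2]; exact hd⟩, h1⟩
    · rintro ⟨c, hc, ⟨h1, h2, h3⟩, h4⟩
      refine ⟨[c, [y], (M 0).M [unary n, c, [y]] (r 0)],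
        (mem_terminal_iff S n _).2 ⟨c, hc, y, _, strategy_zero_length (M 0) hc y _, rfl⟩, ?_, ?_⟩
      · simp [toEnvelope, envHist, h2, h3]
      · refine Fin.forall_fin_two.2 ⟨(follows_zero_iff (M 0) hc y _ (r 0)).2 ⟨h1, rfl⟩,
          (follows_one_iff (M 1) hc y _ (r 1)).2 h4⟩
  rw [imageDist, hset, measureReal_biUnion_finset]
  · exact Finset.sum_congr rfl fun c _ => pi_two_real (fun _ : Fin 2 => coin) _ _
  · intro c _ c' _ hcc
    exact Set.disjoint_left.2 fun r h h' => hcc (h.1.1.symm.trans h'.1.1)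
  · intro c _
    have h0 : MeasurableSet {r | (M 0).M [unary n] r = c ∧ S.bit c = x ∧
        (S.R c ((M 0).M [unary n, c, [y]] r)).isSome = d} :=
      ((M 0).ppt.measurableSet [unary n] (· = c)).inter ((MeasurableSet.const _).inter
        ((M 0).ppt.measurableSet [unary n, c, [y]] fun s => (S.R c s).isSome = d))
    have h1 : MeasurableSet {r | (M 1).M [unary n, c] r = [y]} :=
      (M 1).ppt.measurableSet [unary n, c] (· = [y])
    have m0 : Measurable fun r : Fin 2 → Tape => r 0 := measurable_pi_apply 0
    have m1 : Measurable fun r : Fin 2 → Tape => r 1 := measurable_pi_apply 1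
    exact (m0 h0).inter (m1 h1)

theorem imageDist_eq_zero (M : ∀ i, Strategy (commitmentGame S) i) {h : Hist}
    (hh : h ∉ envelopeGame.terminal) :
    imageDist (commitmentGame S) (toEnvelope S) M n h = 0 := by
  have : {r : Fin 2 → Tape | ∃ h' ∈ (commitmentGame S n).terminal,
      toEnvelope S h' = h ∧ ∀ i, (M i).Follows n (r i) h'} = ∅ := by
    ext r
    simp only [Set.mem_ofPred_eq, Set.mem_empty_iff_false, iff_false]
    rintro ⟨h', ht, rfl, -⟩
    exact hh ((toEnvelope_terminal_iff S n ht.1).2 ht)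
  rw [imageDist, this, measureReal_empty]

theorem outcomeDist_eq_zero {σ : ∀ i, envelopeGame.Mixed i} {h : Hist}
    (hh : h ∉ envelopeGame.terminal) : envelopeGame.outcomeDist σ h = 0 := by
  simp [Game.outcomeDist, hh]

theorem sum_envelope_terminal (X : Hist → ℝ) :
    ∑ᶠ h ∈ envelopeGame.terminal, X h = ∑ t, X (envHist t) := by
  rw [envelopeGame_terminal, finsum_mem_range envHist_injective, finsum_eq_sum_of_fintype]

theorem acceptProb_eq_sum (D : List Str → Tape → Str) (n : ℕ) {X : Hist → ℝ}
    (hX : ∀ h ∉ envelopeGame.terminal, X h = 0) :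
    acceptProb D n X =
      ∑ t, X (envHist t) * coin.real {r | D (unary n :: envHist t) r = [true]} := by
  classical
  rw [acceptProb, tsum_eq_sum (s := Finset.univ.image envHist),
    Finset.sum_image envHist_injective.injOn]
  intro h hh
  rw [hX h, zero_mul]
  rw [envelopeGame_terminal]
  simpa using hh

/-- Acceptance probabilities lie in `[0, 1]`, so no distinguisher, efficient or not, gains more than
the statistical distance. -/
theorem StatClose.compIndist {X Y : ℕ+ → Hist → ℝ} (h : StatClose envelopeGame X Y)
    (hX : ∀ n, ∀ h ∉ envelopeGame.terminal, X n h = 0)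
    (hY : ∀ n, ∀ h ∉ envelopeGame.terminal, Y n h = 0) : CompIndist X Y := by
  intro D _
  obtain ⟨ε, hε, hle⟩ := h
  refine ⟨ε, hε, fun n => ?_⟩
  rw [acceptProb_eq_sum D n (hX n), acceptProb_eq_sum D n (hY n), ← Finset.sum_sub_distrib]
  refine le_trans ?_ (hle n)
  rw [sum_envelope_terminal]
  refine (Finset.abs_sum_le_sum_abs _ _).trans (Finset.sum_le_sum fun t _ => ?_)
  rw [← sub_mul, abs_mul]
  refine mul_le_of_le_one_right (abs_nonneg _) ?_
  rw [abs_of_nonneg measureReal_nonneg]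
  exact measureReal_le_one

end Map

/-! ### Strategies in the envelope game -/

theorem envelopeGame_nil_mem_turn : [] ∈ envelopeGame.turn 0 :=
  ⟨(envelopeGame_nonterminal_iff _).2 ⟨trivial, by simp⟩, rfl⟩

theorem envelopeGame_singleton_mem_turn (x : Bool) : [[x]] ∈ envelopeGame.turn 1 :=
  ⟨(envelopeGame_nonterminal_iff _).2 ⟨bit_mem x, by simp⟩, rfl⟩

theorem envelopeGame_pair_mem_turn (x y : Bool) : [[x], [y]] ∈ envelopeGame.turn 0 :=
  ⟨(envelopeGame_nonterminal_iff _).2 ⟨⟨bit_mem x, bit_mem y⟩, by simp⟩, rfl⟩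

/-- The information set of a history. -/
def Game.infoSet {c : ℕ} (G : Game c) {i : Fin c} {h : Hist} (hh : h ∈ G.turn i) : G.InfoSet i :=
  ⟨G.obs h, h, hh, rfl⟩

theorem envelopeGame_actions {i : Fin 2} (I : envelopeGame.InfoSet i) :
    envelopeGame.actions I = bitStrings := by
  have key : ∀ h ∈ envelopeGame.turn i, ∀ a, h ++ [a] ∈ envelopeGame.H ↔ a ∈ bitStrings := by
    intro h hh a
    obtain ⟨h1, h2⟩ := (envelopeGame_nonterminal_iff h).1 hh.1
    rw [envelopeGame_mem_iff, append_mem_stageHist]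
    have : stageSet bitStrings bitStrings bitStrings h.length = bitStrings := by
      obtain h0 | h0 | h0 : h.length = 0 ∨ h.length = 1 ∨ h.length = 2 := by omega
      all_goals rw [h0]; rfl
    rw [this]
    exact and_iff_right h1
  ext a
  constructor
  · intro ha
    obtain ⟨h, hh, e⟩ := I.2
    exact (key h hh a).1 (ha h hh e)
  · intro ha h hh _
    exact (key h hh a).2 ha

/-- The bit that a deterministic strategy plays at an information set. -/
def action {i : Fin 2} (s : envelopeGame.PureStrategy i) (I : envelopeGame.InfoSet i) : Bool :=
  (s I : Str).headD false

theorem apply_eq_iff {i : Fin 2} (s : envelopeGame.PureStrategy i) (I : envelopeGame.InfoSet i)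
    (b : Bool) : (s I : Str) = [b] ↔ action s I = b := by
  have hs : (s I : Str) ∈ bitStrings := by
    rw [← envelopeGame_actions I]
    exact (s I).2
  obtain ⟨b', hb⟩ := bitStrings_exists hs
  simp [action, hb]

/-- The bit that player `0` puts in the envelope. -/
def putBit (s : envelopeGame.PureStrategy 0) : Bool :=
  action s (envelopeGame.infoSet envelopeGame_nil_mem_turn)

/-- Does player `0` open the envelope? -/
def openBit (s : envelopeGame.PureStrategy 0) (x y : Bool) : Bool :=
  action s (envelopeGame.infoSet (envelopeGame_pair_mem_turn x y))

/-- The bit that player `1` chooses. -/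
def guessBit (s : envelopeGame.PureStrategy 1) : Bool :=
  action s (envelopeGame.infoSet (envelopeGame_singleton_mem_turn false))

/-- Player `0` puts `x` in the envelope, and opens it after `y` if `o y` holds. -/
def putStrategy (x : Bool) (o : Bool → Bool) : envelopeGame.PureStrategy 0 := fun I =>
  -- The label of an information set of player `0` is the history itself: empty at the first move,
  -- and ending with the bit of player `1` at the second.
  ⟨[if I.1 = [] then x else o (I.1.getLastD [] == [true])], by
    rw [envelopeGame_actions]; exact bit_mem _⟩

/-- Player `1` chooses `y`. -/
def guessStrategy (y : Bool) : envelopeGame.PureStrategy 1 := fun I =>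
  ⟨[y], by rw [envelopeGame_actions]; exact bit_mem _⟩

@[simp] theorem putBit_putStrategy (x : Bool) (o : Bool → Bool) :
    putBit (putStrategy x o) = x := rfl

@[simp] theorem openBit_putStrategy (x : Bool) (o : Bool → Bool) (x' y : Bool) :
    openBit (putStrategy x o) x' y = o y := by
  cases y <;> rfl

@[simp] theorem guessBit_guessStrategy (y : Bool) : guessBit (guessStrategy y) = y := rfl

theorem outcomeDist_envHist (σ : ∀ i, envelopeGame.Mixed i) (x y d : Bool) :
    envelopeGame.outcomeDist σ (envHist (x, y, d)) =
      (σ 0).toMeasure.real {s | putBit s = x ∧ openBit s x y = d} *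
        (σ 1).toMeasure.real {s | guessBit s = y} := by
  rw [Game.outcomeDist, ← pi_two_real fun i => (σ i).toMeasure]
  congr 1
  ext s
  simp only [Set.mem_ofPred_eq]
  -- Player `1` does not see the bit, so there is only one information set, whichever `x` represents
  -- it.
  have hinfo : envelopeGame.infoSet (envelopeGame_singleton_mem_turn x) =
    envelopeGame.infoSet (envelopeGame_singleton_mem_turn false) := Subtype.ext rfl
  constructor
  · rintro ⟨-, h⟩
    refine ⟨⟨?_, ?_⟩, ?_⟩
    · exact (apply_eq_iff _ _ _).1
        (h [] [x] (prefix_triple.2 (by simp)) 0 envelopeGame_nil_mem_turn)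
    · exact (apply_eq_iff _ _ _).1
        (h [[x], [y]] [d] (prefix_triple.2 (by simp)) 0 (envelopeGame_pair_mem_turn x y))
    · rw [guessBit, ← hinfo]
      exact (apply_eq_iff _ _ _).1
        (h [[x]] [y] (prefix_triple.2 (by simp)) 1 (envelopeGame_singleton_mem_turn x))
  · rintro ⟨⟨h1, h2⟩, h3⟩
    refine ⟨envelopeGame_terminal ▸ Set.mem_range_self _, fun h a hp i hi => ?_⟩
    rw [guessBit, ← hinfo] at h3
    obtain ⟨rfl, rfl⟩ | ⟨rfl, rfl⟩ | ⟨rfl, rfl⟩ := prefix_triple.1 hp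
    · obtain rfl : i = 0 := hi.2.symm
      exact (apply_eq_iff _ _ _).2 h1
    · obtain rfl : i = 1 := hi.2.symm
      exact (apply_eq_iff _ _ _).2 h3
    · obtain rfl : i = 0 := hi.2.symm
      exact (apply_eq_iff _ _ _).2 h2

/-! ### Implementing strategies of the envelope game -/

/-- The codes of the deterministic strategies of player `0` that put `x` in the envelope and, after
`y`, open it or not, as told by `d`. -/
def putCodes (x y d : Bool) : Set ℕ := {j | j.testBit 0 = x ∧ j.testBit (if y then 2 else 1) = d}

/-- The binary digits of the code are the bit `x`, the decision after `0` and the decision after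
`1`. -/
theorem exists_putCode (x : Bool) (o : Bool → Bool) :
    ∃ j ≤ 7, j.testBit 0 = x ∧ ∀ y, j.testBit (if y then 2 else 1) = o y := by
  refine ⟨x.toNat + 2 * (o false).toNat + 4 * (o true).toNat, ?_, ?_, fun y => ?_⟩
  · have := x.toNat_le
    have := (o false).toNat_le
    have := (o true).toNat_le
    omega
  · generalize o false = a
    generalize o true = b
    revert x a b
    decide
  · cases y
    · generalize o false = a
      generalize o true = b
      revert x a b
      decide
    · generalize o false = a
      generalize o true = b
      revert x a b
      decide

/-- A deterministic strategy influences the outcome only through the bit it puts and its decisions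
after that bit, so sampling one of eight codes suffices. -/
theorem exists_put_sampler (σ : envelopeGame.EffMixed 0) :
    ∃ g : ℕ → List Str → Str, (∀ i, IsPolyTime (g i)) ∧ ∃ ε, Negligible ε ∧
      ∀ (n : ℕ+) (x y d : Bool),
        |coin.real {r | pick 7 (fun i => ltTape r (g i [unary n])) ∈ putCodes x y d} -
          σ.1.toMeasure.real {s | putBit s = x ∧ openBit s x y = d}| ≤ ε n := by
  have : DiscreteMeasurableSpace (envelopeGame.PureStrategy 0) := ⟨fun _ => trivial⟩
  choose J hJ h0 h1 using fun s : envelopeGame.PureStrategy 0 =>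
    exists_putCode (putBit s) (openBit s (putBit s))
  obtain ⟨g, hg, ε, hε, h⟩ := exists_sampler σ.1.toMeasure 7 J hJ σ.2
  refine ⟨g, hg, ε, hε, fun n x y d => ?_⟩
  have : {s | putBit s = x ∧ openBit s x y = d} = {s | J s ∈ putCodes x y d} := by
    ext s
    simp only [putCodes, Set.mem_ofPred_eq, h0, h1]
    constructor
    · rintro ⟨rfl, h⟩
      exact ⟨rfl, h⟩
    · rintro ⟨rfl, h⟩
      exact ⟨rfl, h⟩
  rw [this]
  exact h n (putCodes x y d)

theorem exists_guess_sampler (σ : envelopeGame.EffMixed 1) :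
    ∃ g : ℕ → List Str → Str, (∀ i, IsPolyTime (g i)) ∧ ∃ ε, Negligible ε ∧
      ∀ (n : ℕ+) (y : Bool),
        |coin.real {r | (pick 1 fun i => ltTape r (g i [unary n])).testBit 0 = y} -
          σ.1.toMeasure.real {s | guessBit s = y}| ≤ ε n := by
  have : DiscreteMeasurableSpace (envelopeGame.PureStrategy 1) := ⟨fun _ => trivial⟩
  obtain ⟨g, hg, ε, hε, h⟩ := exists_sampler σ.1.toMeasure 1 (fun s => (guessBit s).toNat)
    (fun s => (guessBit s).toNat_le) σ.2
  refine ⟨g, hg, ε, hε, fun n y => ?_⟩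
  have : {s | guessBit s = y} = {s | (guessBit s).toNat ∈ {j : ℕ | j.testBit 0 = y}} := by
    ext s
    simp only [Set.mem_ofPred_eq]
    cases guessBit s <;> simp
  rw [this]
  exact h n {j | j.testBit 0 = y}

theorem RandPoly.ltTape {φ : Tape → Tape} (hφ : ∀ n : List Str × Tape → ℕ,
    RandPoly (fun p => unary (n p)) → RandPoly fun p => CompGame.tapePrefix (φ p.2) (n p))
    {w : List Str × Tape → Str} (hw : RandPoly w) :
    RandPoly fun p => [CompGame.ltTape (φ p.2) (w p)] :=
  (hφ _ (hw.map₁ fun _ => PT.unary_length)).ltList hw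

theorem RandPoly.sampler {φ : Tape → Tape} (hφ : ∀ n : List Str × Tape → ℕ,
    RandPoly (fun p => unary (n p)) → RandPoly fun p => CompGame.tapePrefix (φ p.2) (n p))
    {g : ℕ → List Str → Str} (hg : ∀ i, IsPolyTime (g i)) (m : ℕ) {γ : Type} [Fintype γ]
    (F : ℕ → List γ) :
    RandPoly fun p => F (CompGame.pick m fun i => CompGame.ltTape (φ p.2) (g i [p.1.headD []])) :=
  RandPoly.pick m (fun i p => CompGame.ltTape (φ p.2) (g i [p.1.headD []]))
    (fun i => RandPoly.ltTape hφ (RandPoly.poly (hg i) (T := fun p => [p.1.headD []])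
      (RandPoly.input.head.enc_cons (RandPoly.const (encTuple []))))) F

variable (S : CommitmentScheme)

theorem commitmentGame_turn_zero {n : ℕ+} {h : Hist} (hh : h ∈ (commitmentGame S n).turn 0) :
    h = [] ∨ ∃ c ∈ S.commitments n, ∃ y : Bool, h = [c, [y]] := by
  obtain ⟨h1, h2⟩ := (commitmentGame_nonterminal_iff S n h).1 hh.1
  have h3 := turn_zero_length hh
  rcases h with _ | ⟨x, _ | ⟨y, _ | ⟨z, l⟩⟩⟩
  · exact .inl rfl
  · exact absurd rfl h3
  · obtain ⟨hx, hy⟩ : x ∈ S.commitments n ∧ y ∈ bitStrings := h1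
    obtain ⟨y, rfl⟩ := bitStrings_exists hy
    exact .inr ⟨x, hx, y, rfl⟩
  · simp only [List.length_cons] at h2
    omega

theorem commitmentGame_turn_one {n : ℕ+} {h : Hist} (hh : h ∈ (commitmentGame S n).turn 1) :
    ∃ c ∈ S.commitments n, h = [c] := by
  have h1 := ((commitmentGame_nonterminal_iff S n h).1 hh.1).1
  obtain ⟨c, rfl⟩ := List.length_eq_one_iff.1 (turn_one_length hh)
  exact ⟨c, h1, rfl⟩

/-- The strategy `F` of player `0` draws a bit and a decision for either choice of player `1`,
commits to the bit, and then sends the key or a string that opens nothing. -/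
structure CommitsTo (σ : envelopeGame.EffMixed 0) (F : Strategy (commitmentGame S) 0) where
  /-- the drawn code -/
  code : ℕ+ → Tape → ℕ
  measurableSet_code : ∀ (n : ℕ+) (E : Set ℕ), MeasurableSet {r | code n r ∈ E}
  commit : ∀ (n : ℕ+) r,
    F.M [unary n] r = S.C₁ n ((code n (evenTape r)).testBit 0) (oddTape r)
  reveal : ∀ (n : ℕ+) c y r, F.M [unary n, c, [y]] r =
    if (code n (evenTape r)).testBit (if y then 2 else 1) then
      S.C₂ n ((code n (evenTape r)).testBit 0) (oddTape r) else unary n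
  close : ∃ ε, Negligible ε ∧ ∀ (n : ℕ+) (x y d : Bool),
    |coin.real {r | code n r ∈ putCodes x y d} -
      σ.1.toMeasure.real {s | putBit s = x ∧ openBit s x y = d}| ≤ ε n
  knows : ∃ N, IsPPT N ∧ ∀ (n : ℕ+) r, N [unary n] r = [(code n (evenTape r)).testBit 0] ∧
    ∀ c y, N [unary n, c, [y]] r = [(code n (evenTape r)).testBit (if y then 2 else 1)]

/-- The tape is the only memory of the machine. At the last move it draws the same code again from
the even half and computes the key with the same odd half that produced the commitment. -/
theorem exists_commitsTo (σ : envelopeGame.EffMixed 0) :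
    ∃ F : Strategy (commitmentGame S) 0, Nonempty (CommitsTo S σ F) := by
  obtain ⟨g, hg, hclose⟩ := exists_put_sampler σ
  obtain ⟨A₁, hA₁, e₁⟩ := S.ppt_C₁
  obtain ⟨A₂, hA₂, e₂⟩ := S.ppt_C₂
  let k : List Str → Tape → ℕ := fun x r => pick 7 fun i => ltTape (evenTape r) (g i [x.headD []])
  let first : List Str → Bool := fun x => decide (unary x.tail.length = [])
  let guess : List Str → Bool := fun x => decide (x.tail.tail.headD [] = [true])
  let o : List Str → Tape → Bool := fun x r =>
    if guess x then (k x r).testBit 2 else (k x r).testBit 1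
  have det : ∀ {g : List Str → Bool}, PT encTuple (fun y => [g y]) →
      RandPoly fun p => [g p.1] := fun h => RandPoly.poly (isPolyTime_iff.2 h) RandPoly.input
  have hfirst := det (g := first) (PT.encTuple_tail.count.eqConst [])
  have hguess := det (g := guess) (PT.encTuple_tail.tail.head.eqConst [true])
  have hbit : ∀ j, RandPoly fun p => [(k p.1 p.2).testBit j] := fun j =>
    RandPoly.sampler (φ := evenTape) (fun _ => RandPoly.evenPrefix) hg 7 fun i => [i.testBit j]
  have ho : RandPoly fun p => [o p.1 p.2] := by
    convert hguess.ite (hbit 2) (hbit 1) using 2 with p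
    simp only [o]
    split_ifs <;> rfl
  have hcall : ∀ {A}, IsPPT A →
      RandPoly fun p => A [p.1.headD [], [(k p.1 p.2).testBit 0]] (oddTape p.2) := fun hA =>
    RandPoly.call hA (φ := oddTape) (fun _ => RandPoly.oddPrefix)
      (T := fun p => [p.1.headD [], [(k p.1 p.2).testBit 0]])
      (RandPoly.input.head.enc_cons ((hbit 0).enc_cons (RandPoly.const (encTuple []))))
  -- The first component of the input is `1^n`; it doubles as the string that opens nothing.
  let M : List Str → Tape → Str := fun x r =>
    if first x then A₁ [x.headD [], [(k x r).testBit 0]] (oddTape r) else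
      if o x r then A₂ [x.headD [], [(k x r).testBit 0]] (oddTape r) else x.headD []
  let N : List Str → Tape → Str := fun x r => if first x then [(k x r).testBit 0] else [o x r]
  let code : ℕ+ → Tape → ℕ := fun n r => pick 7 fun i => ltTape r (g i [unary n])
  have hM₀ : ∀ (n : ℕ+) r,
      M [unary n] r = S.C₁ n ((code n (evenTape r)).testBit 0) (oddTape r) := fun n r => by
    exact e₁ n _ _
  have ho' : ∀ (n : ℕ+) c (y : Bool) r, o [unary n, c, [y]] r =
      (code n (evenTape r)).testBit (if y then 2 else 1) := fun n c y r => by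
    cases y <;> simp [o, guess, k, code]
  have hM₁ : ∀ (n : ℕ+) c (y : Bool) r, M [unary n, c, [y]] r =
      if (code n (evenTape r)).testBit (if y then 2 else 1) then
        S.C₂ n ((code n (evenTape r)).testBit 0) (oddTape r) else unary n := fun n c y r => by
    have h1 : first [unary n, c, [y]] = false := by simp [first, unary]
    simp only [M, h1, ho', List.headD_cons, Bool.false_eq_true, if_false, e₂]
    rfl
  refine ⟨⟨M, RandPoly.isPPT (hfirst.ite (hcall hA₁) (ho.ite (hcall hA₂) RandPoly.input.head)),
    fun n h hh r => ?_⟩, ⟨code, fun n E => measurableSet_pick 7 _ E, hM₀, hM₁, hclose, N,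
      RandPoly.isPPT (hfirst.ite (hbit 0) ho), fun n r => ⟨?_, fun c y => ?_⟩⟩⟩
  · obtain rfl | ⟨c, hc, y, rfl⟩ := commitmentGame_turn_zero S hh
    · change [] ++ [M [unary n] r] ∈ _
      rw [hM₀]
      exact C₁_mem S n _ _
    · refine (commitmentGame_append_mem_iff S n _ _).2 ⟨⟨hc, bit_mem y⟩, ?_⟩
      change (M [unary n, c, [y]] r).length ≤ n
      rw [hM₁]
      generalize (code n (evenTape r)).testBit (if y then 2 else 1) = b
      cases b
      · simp [unary]
      · rw [if_pos rfl, S.length_C₂]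
        exact Nat.sub_le _ _
  · rfl
  · have h1 : first [unary n, c, [y]] = false := by simp [first, unary]
    simp only [N, h1, ho', Bool.false_eq_true, if_false]

/-- The strategy `F` of player `1` draws a bit and plays it. -/
structure Guesses (σ : envelopeGame.EffMixed 1) (F : Strategy (commitmentGame S) 1) where
  /-- the drawn bit -/
  bit : ℕ+ → Tape → Bool
  guess : ∀ (n : ℕ+) c r, F.M [unary n, c] r = [bit n r]
  close : ∃ ε, Negligible ε ∧ ∀ (n : ℕ+) (y : Bool),
    |coin.real {r | bit n r = y} - σ.1.toMeasure.real {s | guessBit s = y}| ≤ ε n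

/-- The machine reads only `1^n` and its tape, so its answer does not depend on the commitment. -/
theorem exists_guesses (σ : envelopeGame.EffMixed 1) :
    ∃ F : Strategy (commitmentGame S) 1, Nonempty (Guesses S σ F) := by
  obtain ⟨g, hg, hclose⟩ := exists_guess_sampler σ
  refine ⟨⟨fun x r => [(pick 1 fun i => ltTape r (g i [x.headD []])).testBit 0],
    RandPoly.isPPT (RandPoly.sampler (φ := id) (fun _ => RandPoly.tapePrefix) hg 1
      fun i => [i.testBit 0]), fun n h hh r => ?_⟩,
    ⟨fun n r => (pick 1 fun i => ltTape r (g i [unary n])).testBit 0, fun _ _ _ => rfl, hclose⟩⟩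
  obtain ⟨c, hc, rfl⟩ := commitmentGame_turn_one S hh
  exact (commitmentGame_append_mem_iff S n _ _).2 ⟨hc, bit_mem _⟩

/-! ### Correspondence of strategies -/

theorem abs_mul_sub_mul_le {a a' b b' : ℝ} (ha : |a| ≤ 1) (hb : |b'| ≤ 1) :
    |a' * b' - a * b| ≤ |a' - a| + |b' - b| := by
  have : a' * b' - a * b = (a' - a) * b' + a * (b' - b) := by ring
  rw [this]
  refine (abs_add_le _ _).trans (add_le_add ?_ ?_)
  · rw [abs_mul]
    exact mul_le_of_le_one_right (abs_nonneg _) hb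
  · rw [abs_mul]
    exact mul_le_of_le_one_left (abs_nonneg _) ha

theorem abs_measureReal_le_one {Ω : Type*} [MeasurableSpace Ω] (μ : Measure Ω)
    [IsProbabilityMeasure μ] (E : Set Ω) : |μ.real E| ≤ 1 := by
  rw [abs_of_nonneg measureReal_nonneg]
  exact measureReal_le_one

theorem statClose_of_le {X Y : ℕ+ → Hist → ℝ} {ε δ : ℕ → ℝ} (hε : Negligible ε)
    (hδ : Negligible δ)
    (h : ∀ (n : ℕ+) x y d, |X n (envHist (x, y, d)) - Y n (envHist (x, y, d))| ≤ ε n + δ n) :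
    StatClose envelopeGame X Y := by
  -- The envelope game has eight terminal histories.
  refine ⟨_, (hε.add hδ).const_mul (a := 8) (by norm_num), fun n => ?_⟩
  rw [sum_envelope_terminal]
  refine (Finset.sum_le_card_nsmul Finset.univ _ (ε n + δ n) fun t _ => h n _ _ _).trans_eq ?_
  simp
  ring

theorem measurableSet_apply {A : Tape → Str} (hA : ∀ c, MeasurableSet {r | A r = c})
    {P : Str → Tape → Prop} (hP : ∀ c, MeasurableSet {r | P c r}) :
    MeasurableSet {r | P (A r) r} := by
  have : {r | P (A r) r} = ⋃ c, {r | A r = c} ∩ {r | P c r} := by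
    ext r
    simp
  rw [this]
  exact MeasurableSet.iUnion fun c => (hA c).inter (hP c)

theorem sum_coin_fiber (s : Finset Str) {A : Tape → Str} (hs : ∀ r, A r ∈ s)
    (hA : ∀ c, MeasurableSet {r | A r = c}) {P : Str → Tape → Prop}
    (hP : ∀ c, MeasurableSet {r | P c r}) :
    ∑ c ∈ s, coin.real {r | A r = c ∧ P c r} = coin.real {r | P (A r) r} := by
  rw [← measureReal_biUnion_finset]
  · congr 1
    ext r
    simp only [Set.mem_iUnion, Set.mem_ofPred_eq, exists_prop]
    constructor
    · rintro ⟨c, -, rfl, h⟩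
      exact h
    · exact fun h => ⟨_, hs r, rfl, h⟩
  · intro c _ c' _ hcc
    exact Set.disjoint_left.2 fun r h h' => hcc (h.1.symm.trans h'.1)
  · exact fun c _ => (hA c).inter (hP c)

/-- A mixed strategy must be a `PMF`, while the tape has no discrete law. The countably valued
summary `T` of the tape has one, and it is pushed forward along `f`. -/
theorem exists_pmf_map {Ω β : Type} [MeasurableSpace Ω] [DiscreteMeasurableSpace Ω]
    [MeasurableSpace β] [Countable β] [MeasurableSingletonClass β] {T : Tape → β}
    (hT : Measurable T) (f : β → Ω) :
    ∃ p : PMF Ω, ∀ E, p.toMeasure.real E = coin.real {r | f (T r) ∈ E} := by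
  have := Measure.isProbabilityMeasure_map (μ := coin) hT.aemeasurable
  refine ⟨(coin.map T).toPMF.map f, fun E => ?_⟩
  rw [← PMF.toMeasure_map f _ (measurable_of_countable f), Measure.toPMF_toMeasure,
    Measure.map_map (measurable_of_countable f) hT, measureReal_def, measureReal_def,
    Measure.map_apply ((measurable_of_countable f).comp hT) (.of_discrete)]
  rfl

variable {S : CommitmentScheme} {n : ℕ+}

theorem measurableSet_C₁ (b : Bool) (c : Str) : MeasurableSet {r | S.C₁ n b r = c} := by
  obtain ⟨A, hA, e⟩ := S.ppt_C₁
  simp only [← e]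
  exact hA.measurableSet [unary n, [b]] (· = c)

/-- The probability that the strategy `M` of player `1` answers `y` to a commitment to `x`. -/
def replyProb (M : Strategy (commitmentGame S) 1) (n : ℕ+) (x y : Bool) : ℝ :=
  ∑ c ∈ commitFinset S n, coin.real {r | S.C₁ n x r = c} *
    coin.real {r | M.M [unary n, c] r = [y]}

/-- The bit that the strategy `M` of player `1` answers to a commitment to `x`. -/
def reply (M : Strategy (commitmentGame S) 1) (n : ℕ+) (x : Bool) (r : Tape) : Bool :=
  decide (M.M [unary n, S.C₁ n x (evenTape r)] (oddTape r) = [true])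

theorem measurableSet_evenTape {A : Set Tape} (hA : MeasurableSet A) :
    MeasurableSet {r | evenTape r ∈ A} :=
  (measurable_pi_lambda _ fun _ => measurable_pi_apply _ : Measurable evenTape) hA

theorem measurableSet_oddTape {A : Set Tape} (hA : MeasurableSet A) :
    MeasurableSet {r | oddTape r ∈ A} :=
  (measurable_pi_lambda _ fun _ => measurable_pi_apply _ : Measurable oddTape) hA

theorem measurable_reply (M : Strategy (commitmentGame S) 1) (x : Bool) :
    Measurable (reply M n x) := by
  refine measurable_to_bool ?_
  have := measurableSet_apply (A := fun r => S.C₁ n x (evenTape r))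
    (fun c => measurableSet_evenTape (measurableSet_C₁ x c))
    (P := fun c r => M.M [unary n, c] (oddTape r) = [true])
    (fun c => measurableSet_oddTape (M.ppt.measurableSet [unary n, c] (· = [true])))
  convert this using 1
  ext r
  simp [reply]

/-- Making the commitment from the even half of a tape and running `M` on the odd half realizes the
independence implicit in the products. -/
theorem replyProb_eq (M : Strategy (commitmentGame S) 1) (x y : Bool) :
    replyProb M n x y = coin.real {r | reply M n x r = y} := by
  have h1 : ∀ r, reply M n x r = y ↔
      M.M [unary n, S.C₁ n x (evenTape r)] (oddTape r) = [y] := by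
    intro r
    obtain ⟨b, hb⟩ := bitStrings_exists (strategy_one_mem M (C₁_mem S n x (evenTape r)) (oddTape r))
    rw [reply, hb]
    cases b <;> cases y <;> simp
  simp only [h1]
  rw [← sum_coin_fiber (commitFinset S n) (A := fun r => S.C₁ n x (evenTape r))
    (fun r => mem_commitFinset.2 (C₁_mem S n _ _))
    (fun c => measurableSet_evenTape (measurableSet_C₁ x c))
    (P := fun c r => M.M [unary n, c] (oddTape r) = [y])
    (fun c => measurableSet_oddTape (M.ppt.measurableSet [unary n, c] (· = [y])))]
  exact Finset.sum_congr rfl fun c _ => (coin_even_odd (measurableSet_C₁ x c)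
    (M.ppt.measurableSet [unary n, c] (· = [y]))).symm

theorem replyProb_false (M : Strategy (commitmentGame S) 1) (x : Bool) :
    replyProb M n x false = 1 - replyProb M n x true := by
  have h : {r | reply M n x r = false} = {r | reply M n x r = true}ᶜ := by
    ext r
    simp
  rw [replyProb_eq, replyProb_eq, h]
  exact probReal_compl_eq_one_sub (measurable_reply M x (MeasurableSet.singleton true))

/-- The strategy, fed with `1^n` and a commitment, is literally a distinguisher; accepting means
answering `1`. -/
theorem acceptProb_outputDist (M : Strategy (commitmentGame S) 1) (x : Bool) :
    acceptProb M.M n (outputDist (S.C₁ n x)) = replyProb M n x true := by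
  classical
  rw [acceptProb, tsum_eq_sum (s := (commitFinset S n).image fun c => [c]), Finset.sum_image]
  · simp [replyProb, outputDist]
  · intro c _ c' _ h
    simpa using h
  · intro h hh
    have : {r | [S.C₁ n x r] = h} = ∅ := by
      ext r
      simp only [Set.mem_ofPred_eq, Set.mem_empty_iff_false, iff_false]
      rintro rfl
      exact hh (Finset.mem_image_of_mem _ (mem_commitFinset.2 (C₁_mem S n _ _)))
    rw [outputDist, this, measureReal_empty, zero_mul]

/-- This is the hiding property, applied with `M` itself as the distinguisher. The answer `0` has
the complementary probability, as a legal strategy answers with a bit. -/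
theorem exists_replyProb_close (M : Strategy (commitmentGame S) 1) :
    ∃ ε, Negligible ε ∧ ∀ (n : ℕ+) (x y : Bool),
      |replyProb M n x y - replyProb M n false y| ≤ ε n := by
  obtain ⟨ε, hε, h⟩ := S.is_hiding M.M M.ppt
  simp only [acceptProb_outputDist] at h
  refine ⟨ε, hε, fun n x y => ?_⟩
  cases x
  · simpa using hε.1 n
  · cases y
    · rw [replyProb_false, replyProb_false]
      convert h n using 2
      ring
    · rw [abs_sub_comm]
      exact h n

/-- The code and the commitment randomness come from independent halves of the tape. Given that the
code commits to `x`, the string sent is distributed as `C₁ n x`, so the sum over commitments becomes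
the reply probability. -/
theorem CommitsTo.imageDist_envHist {σ : envelopeGame.EffMixed 0}
    {F : Strategy (commitmentGame S) 0} (h : CommitsTo S σ F)
    {M : ∀ i, Strategy (commitmentGame S) i} (hM : M 0 = F) (x y d : Bool) :
    imageDist (commitmentGame S) (toEnvelope S) M n (envHist (x, y, d)) =
      coin.real {r | h.code n r ∈ putCodes x y d} * replyProb (M 1) n x y := by
  rw [CompGame.imageDist_envHist, hM, replyProb, Finset.mul_sum]
  refine Finset.sum_congr rfl fun c _ => ?_
  rw [← mul_assoc, ← coin_even_odd (h.measurableSet_code n _) (measurableSet_C₁ x c)]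
  congr 2
  ext r
  simp only [Set.mem_ofPred_eq, putCodes, h.commit, h.reveal]
  generalize (h.code n (evenTape r)).testBit 0 = b
  generalize (h.code n (evenTape r)).testBit (if y then 2 else 1) = o
  constructor
  · rintro ⟨rfl, rfl, h3⟩
    rw [S.bit_C₁]
    refine ⟨⟨rfl, ?_⟩, rfl⟩
    rw [← h3]
    cases o <;> simp [S.opens, R_unary]
  · rintro ⟨⟨rfl, rfl⟩, rfl⟩
    refine ⟨rfl, S.bit_C₁ n _ _, ?_⟩
    cases o <;> simp [S.opens, R_unary]

theorem Guesses.apply_eq {σ : envelopeGame.EffMixed 1} {F : Strategy (commitmentGame S) 1}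
    (h : Guesses S σ F) (c : Str) (y : Bool) :
    {r | F.M [unary n, c] r = [y]} = {r | h.bit n r = y} := by
  ext r
  simp [h.guess]

/-- The answer ignores the commitment, so the commitment probabilities sum to one. -/
theorem Guesses.replyProb {σ : envelopeGame.EffMixed 1} {F : Strategy (commitmentGame S) 1}
    (h : Guesses S σ F) (x y : Bool) :
    CompGame.replyProb F n x y = coin.real {r | h.bit n r = y} := by
  have := sum_coin_fiber (commitFinset S n) (A := S.C₁ n x)
    (fun r => mem_commitFinset.2 (C₁_mem S n _ _)) (fun c => measurableSet_C₁ x c)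
    (P := fun _ _ => True) fun _ => MeasurableSet.univ
  simp only [and_true] at this
  simp only [CompGame.replyProb, h.apply_eq]
  rw [← Finset.sum_mul, this]
  simp

theorem CommitsTo.statClose {σ : ∀ i, envelopeGame.EffMixed i}
    {M : ∀ i, Strategy (commitmentGame S) i} (h₀ : CommitsTo S (σ 0) (M 0))
    (h₁ : Guesses S (σ 1) (M 1)) :
    StatClose envelopeGame (fun n => imageDist (commitmentGame S) (toEnvelope S) M n)
      fun _ => envelopeGame.outcomeDist fun i => (σ i).1 := by
  obtain ⟨ε, hε, hε'⟩ := h₀.close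
  obtain ⟨δ, hδ, hδ'⟩ := h₁.close
  refine statClose_of_le hε hδ fun n x y d => ?_
  rw [h₀.imageDist_envHist rfl, outcomeDist_envHist, h₁.replyProb]
  exact (abs_mul_sub_mul_le (abs_measureReal_le_one _ _) (abs_measureReal_le_one _ _)).trans
    (add_le_add (hε' n x y d) (hδ' n y))

/-- The hypothesis `Follows` is essential at the last move: the key computed from the tape is sure
to open `c` only because `c` is the commitment made with that tape. -/
theorem CommitsTo.exists_knows {σ : envelopeGame.EffMixed 0} {F : Strategy (commitmentGame S) 0}
    (hF : CommitsTo S σ F) :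
    ∃ N, IsPPT N ∧ ∀ (n : ℕ+), ∀ h ∈ (commitmentGame S n).turn 0, ∀ r, F.Follows n r h →
      (toEnvelope S (h ++ [F.M (unary n :: (commitmentGame S n).obs h) r])).getLast? =
        some (N (unary n :: (commitmentGame S n).obs h) r) := by
  obtain ⟨N, hN, hN'⟩ := hF.knows
  refine ⟨N, hN, fun n h hh r hf => ?_⟩
  obtain rfl | ⟨c, hc, y, rfl⟩ := commitmentGame_turn_zero S hh
  · change (toEnvelope S [F.M [unary n] r]).getLast? = some (N [unary n] r)
    simp [toEnvelope, hF.commit, (hN' n r).1, S.bit_C₁]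
  · change (toEnvelope S [c, [y], F.M [unary n, c, [y]] r]).getLast? =
      some (N [unary n, c, [y]] r)
    have : F.M [unary n] r = c := hf [] c (by simp) nil_mem_turn
    rw [hF.commit] at this
    subst this
    simp only [toEnvelope, (hN' n r).2, hF.reveal]
    generalize (hF.code n (evenTape r)).testBit (if y then 2 else 1) = o
    cases o <;> simp [S.opens, R_unary]

/-- The answer of player `1` is copied unchanged to the envelope game, so the machine already
outputs it. -/
theorem exists_knows_one (F : Strategy (commitmentGame S) 1) :
    ∃ N, IsPPT N ∧ ∀ (n : ℕ+), ∀ h ∈ (commitmentGame S n).turn 1, ∀ r, F.Follows n r h →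
      (toEnvelope S (h ++ [F.M (unary n :: (commitmentGame S n).obs h) r])).getLast? =
        some (N (unary n :: (commitmentGame S n).obs h) r) := by
  refine ⟨F.M, F.ppt, fun n h hh r _ => ?_⟩
  obtain ⟨c, -, rfl⟩ := commitmentGame_turn_one S hh
  rfl

/-! ### Deviations -/

/-- The simulating strategy plays what `M'` would answer to a fresh commitment to `0`. In the real
play the commitment may be to `1`, but hiding makes the difference negligible. -/
theorem CommitsTo.exists_deviation {σ : ∀ i, envelopeGame.EffMixed i}
    {M : ∀ i, Strategy (commitmentGame S) i} (h : CommitsTo S (σ 0) (M 0))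
    (M' : Strategy (commitmentGame S) 1) :
    ∃ σ' : ℕ+ → envelopeGame.Mixed 1, CompIndist
      (fun n => imageDist (commitmentGame S) (toEnvelope S) (Function.update M 1 M') n)
      fun n => envelopeGame.outcomeDist (Function.update (fun i => (σ i).1) 1 (σ' n)) := by
  have : DiscreteMeasurableSpace (envelopeGame.PureStrategy 1) := ⟨fun _ => trivial⟩
  choose σ' hσ' using fun n : ℕ+ => exists_pmf_map (measurable_reply (n := n) M' false)
    guessStrategy
  obtain ⟨ε, hε, hε'⟩ := h.close
  obtain ⟨δ, hδ, hδ'⟩ := exists_replyProb_close M'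
  refine ⟨σ', StatClose.compIndist (statClose_of_le hε hδ fun n x y d => ?_)
    (fun n _ hh => imageDist_eq_zero _ hh) fun n _ hh => outcomeDist_eq_zero hh⟩
  rw [h.imageDist_envHist (Function.update_of_ne (by decide) _ _), outcomeDist_envHist, Function.update_self, Function.update_self,
    Function.update_of_ne (by decide), hσ']
  simp only [Set.mem_ofPred_eq, guessBit_guessStrategy]
  rw [← replyProb_eq]
  refine (abs_mul_sub_mul_le (abs_measureReal_le_one _ _) ?_).trans
    (add_le_add (hε' n x y d) (hδ' n x y))
  rw [replyProb_eq]
  exact abs_measureReal_le_one _ _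

/-- By binding, each tape of `M'` determines a deterministic strategy of the envelope game, and the
simulating strategy is its law. The simulation of `M'` is exact; the only error is the sampling
error of player `1`. -/
theorem Guesses.exists_deviation {σ : ∀ i, envelopeGame.EffMixed i}
    {M : ∀ i, Strategy (commitmentGame S) i} (h : Guesses S (σ 1) (M 1))
    (M' : Strategy (commitmentGame S) 0) :
    ∃ σ' : ℕ+ → envelopeGame.Mixed 0, CompIndist
      (fun n => imageDist (commitmentGame S) (toEnvelope S) (Function.update M 0 M') n)
      fun n => envelopeGame.outcomeDist (Function.update (fun i => (σ i).1) 0 (σ' n)) := by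
  have : DiscreteMeasurableSpace (envelopeGame.PureStrategy 0) := ⟨fun _ => trivial⟩
  have hfib : ∀ (n : ℕ+) c, MeasurableSet {r | M'.M [unary n] r = c} := fun n c =>
    M'.ppt.measurableSet [unary n] (· = c)
  let put : ℕ+ → Tape → Bool := fun n r => S.bit (M'.M [unary n] r)
  let opens : ℕ+ → Str → Bool → Tape → Bool := fun n c y r =>
    (S.R c (M'.M [unary n, c, [y]] r)).isSome
  have hopens : ∀ n c y b, MeasurableSet {r | opens n c y r = b} := fun n c y b =>
    M'.ppt.measurableSet [unary n, c, [y]] fun s => (S.R c s).isSome = b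
  -- The committed bit and, for each of the two possible answers, whether the string sent then opens
  -- the commitment.
  let T : ℕ+ → Tape → Bool × Bool × Bool := fun n r => (put n r,
    opens n (M'.M [unary n] r) false r, opens n (M'.M [unary n] r) true r)
  have hT : ∀ n, Measurable (T n) := fun n => by
    refine .prodMk (measurable_to_bool ?_) (.prodMk (measurable_to_bool ?_) (measurable_to_bool ?_))
    · exact M'.ppt.measurableSet [unary n] fun c => S.bit c = true
    · exact measurableSet_apply (hfib n) (P := fun c r => opens n c false r = true)
        fun c => hopens n c false true
    · exact measurableSet_apply (hfib n) (P := fun c r => opens n c true r = true)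
        fun c => hopens n c true true
  choose σ' hσ' using fun n : ℕ+ => exists_pmf_map (hT n)
    fun t => putStrategy t.1 fun y => if y then t.2.2 else t.2.1
  obtain ⟨δ, hδ, hδ'⟩ := h.close
  refine ⟨σ', StatClose.compIndist (statClose_of_le negligible_zero hδ fun n x y d => ?_)
    (fun n _ hh => imageDist_eq_zero _ hh) fun n _ hh => outcomeDist_eq_zero hh⟩
  have h1 : ∀ c, {r | (M 1).M [unary n, c] r = [y]} =
      {r | h.bit n r = y} := fun c => h.apply_eq c y
  rw [CompGame.imageDist_envHist, outcomeDist_envHist, Function.update_self, Function.update_self,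
    Function.update_of_ne (by decide), Function.update_of_ne (by decide), hσ']
  simp only [h1, Set.mem_ofPred_eq, putBit_putStrategy, openBit_putStrategy]
  rw [← Finset.sum_mul, sum_coin_fiber (commitFinset S n) (A := M'.M [unary n])
    (fun r => mem_commitFinset.2 (strategy_zero_mem M' r)) (hfib n)
    (P := fun c r => S.bit c = x ∧ opens n c y r = d)
    fun c => (MeasurableSet.const _).inter (hopens n c y d)]
  have h2 : {r | S.bit (M'.M [unary n] r) = x ∧ opens n (M'.M [unary n] r) y r = d} =
      {r | (T n r).1 = x ∧ (if y then (T n r).2.2 else (T n r).2.1) = d} := by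
    cases y <;> rfl
  rw [h2]
  refine (abs_mul_sub_mul_le (abs_measureReal_le_one _ _) (abs_measureReal_le_one _ _)).trans
    (add_le_add ?_ (hδ' n y))
  simp

/-! ### The representation -/

theorem exists_strategyMap (S : CommitmentScheme) :
    ∃ F : ∀ i, envelopeGame.EffMixed i → Strategy (commitmentGame S) i,
      StrategyMap (commitmentGame S) envelopeGame (fun _ => toEnvelope S) F := by
  choose F₀ hF₀ using exists_commitsTo S
  choose F₁ hF₁ using exists_guesses S
  let F : ∀ i, envelopeGame.EffMixed i → Strategy (commitmentGame S) i :=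
    Fin.cons F₀ (Fin.cons F₁ finZeroElim)
  have h₀ : ∀ σ : ∀ i, envelopeGame.EffMixed i, CommitsTo S (σ 0) (F 0 (σ 0)) := fun σ =>
    (hF₀ (σ 0)).some
  have h₁ : ∀ σ : ∀ i, envelopeGame.EffMixed i, Guesses S (σ 1) (F 1 (σ 1)) := fun σ =>
    (hF₁ (σ 1)).some
  refine ⟨F, fun σ => ?_, Fin.forall_fin_two.2 ⟨fun σ => ?_, fun σ => ?_⟩, fun σ => ?_⟩
  · exact CommitsTo.statClose (M := fun i => F i (σ i)) (h₀ σ) (h₁ σ)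
  · exact (hF₀ σ).some.exists_knows
  · exact exists_knows_one _
  · refine Fin.forall_fin_two.2 ⟨fun M' => ?_, fun M' => ?_⟩
    · exact Guesses.exists_deviation (M := fun i => F i (σ i)) (h₁ σ) M'
    · exact CommitsTo.exists_deviation (M := fun i => F i (σ i)) (h₀ σ) M'

theorem commitmentGame_represents (S : CommitmentScheme) :
    Represents (commitmentGame S) envelopeGame :=
  ⟨commitmentGame_isComputableUniform S, fun _ => toEnvelope S,
    fun n => toEnvelope_historyMap S n, fun n _ hh i => toEnvelope_utility S n hh i,
    exists_strategyMap S⟩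

end CompGame

end

theorem mainTheorem6 (S : CompGame.CommitmentScheme) :
    CompGame.Represents (CompGame.commitmentGame S) CompGame.envelopeGame ∧
    (CompGame.PPTDecides {h | h.length = 1} (fun n => {h | ∃ c ∈ S.commitments n, h = [c]}) →
      CompGame.PPTDecides Set.univ (fun n => (CompGame.commitmentGame S n).H)) := by
  exact ⟨CompGame.commitmentGame_represents S, CompGame.commitmentGame_pptDecides S⟩
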